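/- Let $\mathcal A(1)=\langle Sq^1,Sq^2\rangle$ be the subalgebra of the mod 2 Steenrod algebra generated by $Sq^1$ and $Sq^2$, let $Q_0=Sq^1$ and $Q_1=Sq^2Q_0+Q_0Sq^2$, and let $E(1)\subset\mathcal A(1)$ be the exterior subalgebra on $Q_0,Q_1$. Let $B$ be $\mathcal A(1)$ or $E(1)$. We consider $\mathbb Z$-graded $B$-modules with maps of degree $0$, with the tensor product $\otimes=\otimes_{\mathbb F_2}$ on which $B$ acts through the coproduct. Write $M\simeq N$ if $M$ and $N$ are stably equivalent, i.e. isomorphic in the category of $B$-modules modulo the maps that factor through projective modules, and put $(\Sigma M)_n=M_{n-1}$ and $H(M,Q_i)=\operatorname{Ker}Q_i/\operatorname{Im}Q_i$. Let $P_0$ be the submodule of the Laurent polynomial ring $\mathbb F_2[x,x^{-1}]$, $Sq^k x^n=\binom nk x^{n+k}$, spanned by the $x^n$ with $n\ge -1$, and let $R=P_0/\mathbb F_2\{x^0\}$. Put $\mathbf L_0 N=\Sigma R\otimes N$ and $\mathbf L_1N=P_0\otimes N$. **Theorem.** Let $M$ be a bounded-below $B$-module such that $H(M,Q_0)$ and $H(M,Q_1)$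 are finite-dimensional in each degree (for example, $M$ itself finite-dimensional in each degree). If $M$ is stably idempotent, i.e. $M\otimes M\simeq M$, then $M$ is stably equivalent to one of $0$, $\mathbb F_2$, $P_0$, $\Sigma R$, or $P_0\oplus\Sigma R$. Accordingly, the functor $N\mapsto M\otimes N$ from $B$-modules to the stable category is naturally isomorphic to $0$, the identity, $\mathbf L_1$, $\mathbf L_0$, or $\mathbf L_1\oplus\mathbf L_0$, respectively. -/

import Mathlib

open CategoryTheory
open scoped TensorProduct

universe u

namespace StMod

/-- The field with two elements. -/
abbrev F2 : Type := ZMod 2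

/-! ### Graded vector spaces -/

section Gradings

variable {V W : Type*} [AddCommGroup V] [Module F2 V] [AddCommGroup W] [Module F2 W]

/-- The usual grading of a tensor product: degree `n` is spanned by the `x ⊗ y` with `x`, `y`
homogeneous of degrees adding up to `n`. -/
def tensorGr (𝒱 : ℤ → Submodule F2 V) (𝒲 : ℤ → Submodule F2 W) (n : ℤ) :
    Submodule F2 (V ⊗[F2] W) :=
  Submodule.span F2
    {t | ∃ (i j : ℤ) (x : V) (y : W), x ∈ 𝒱 i ∧ y ∈ 𝒲 j ∧ i + j = n ∧ x ⊗ₜ[F2] y = t}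

theorem tmul_mem_tensorGr {𝒱 : ℤ → Submodule F2 V} {𝒲 : ℤ → Submodule F2 W} {i j n : ℤ}
    {x : V} {y : W} (hx : x ∈ 𝒱 i) (hy : y ∈ 𝒲 j) (h : i + j = n) :
    x ⊗ₜ[F2] y ∈ tensorGr 𝒱 𝒲 n :=
  Submodule.subset_span ⟨i, j, x, y, hx, hy, h, rfl⟩

theorem isInternal_of_finsupp (𝒱 : ℤ → Submodule F2 V) (hsup : ∀ x : V, x ∈ ⨆ n, 𝒱 n)
    (c : V →ₗ[F2] (ℤ →₀ V)) (hc : ∀ n, ∀ x ∈ 𝒱 n, c x = Finsupp.single n x) :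
    DirectSum.IsInternal 𝒱 := by
  classical
  refine DirectSum.isInternal_submodule_of_iSupIndep_of_iSup_eq_top ?_
    (eq_top_iff.2 fun x _ => hsup x)
  rw [iSupIndep_def]
  intro n
  rw [Submodule.disjoint_def]
  intro x hx hx'
  have h1 : c x n = x := by rw [hc n x hx]; simp
  have h2 : (⨆ j, ⨆ (_ : j ≠ n), 𝒱 j) ≤ LinearMap.ker ((Finsupp.lapply n).comp c) := by
    refine iSup_le fun j => iSup_le fun hj y hy => ?_
    simp [hc j y hy, hj]
  have h3 := h2 hx'
  simp only [LinearMap.mem_ker, LinearMap.comp_apply, Finsupp.lapply_apply] at h3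
  rw [← h1, h3]

theorem exists_finsupp_of_isInternal {𝒱 : ℤ → Submodule F2 V} (h : DirectSum.IsInternal 𝒱) :
    ∃ c : V →ₗ[F2] (ℤ →₀ V), ∀ n, ∀ x ∈ 𝒱 n, c x = Finsupp.single n x := by
  classical
  let e := LinearEquiv.ofBijective (DirectSum.coeLinearMap 𝒱) h
  refine ⟨(DirectSum.toModule F2 ℤ (ℤ →₀ V)
    (fun n => (Finsupp.lsingle n).comp (𝒱 n).subtype)).comp e.symm.toLinearMap, ?_⟩
  intro n x hx
  have : e.symm x = DirectSum.lof F2 ℤ (fun n => 𝒱 n) n ⟨x, hx⟩ := by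
    rw [LinearEquiv.symm_apply_eq]
    exact (DirectSum.coeLinearMap_lof 𝒱 n ⟨x, hx⟩).symm
  simp [this]

theorem mem_iSup_of_isInternal {𝒱 : ℤ → Submodule F2 V} (h : DirectSum.IsInternal 𝒱) (x : V) :
    x ∈ ⨆ n, 𝒱 n := by
  rw [h.submodule_iSup_eq_top]; trivial

theorem tensorGr_isInternal {𝒱 : ℤ → Submodule F2 V} {𝒲 : ℤ → Submodule F2 W}
    (hV : DirectSum.IsInternal 𝒱) (hW : DirectSum.IsInternal 𝒲) :
    DirectSum.IsInternal (tensorGr 𝒱 𝒲) := by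
  classical
  obtain ⟨c, hc⟩ := exists_finsupp_of_isInternal hV
  obtain ⟨d, hd⟩ := exists_finsupp_of_isInternal hW
  refine isInternal_of_finsupp _ ?_
    ((Finsupp.lmapDomain (V ⊗[F2] W) F2 (fun p : ℤ × ℤ => p.1 + p.2)).comp
      ((finsuppTensorFinsupp F2 F2 V W ℤ ℤ).toLinearMap.comp (TensorProduct.map c d))) ?_
  · intro t
    induction t using TensorProduct.induction_on with
    | zero => exact Submodule.zero_mem _
    | add a b ha hb => exact Submodule.add_mem _ ha hb
    | tmul x y =>
      induction mem_iSup_of_isInternal hV x using Submodule.iSup_induction' with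
      | zero => rw [TensorProduct.zero_tmul]; exact Submodule.zero_mem _
      | add a b _ _ ha hb => rw [TensorProduct.add_tmul]; exact Submodule.add_mem _ ha hb
      | mem i x hx =>
        induction mem_iSup_of_isInternal hW y using Submodule.iSup_induction' with
        | zero => rw [TensorProduct.tmul_zero]; exact Submodule.zero_mem _
        | add a b _ _ ha hb => rw [TensorProduct.tmul_add]; exact Submodule.add_mem _ ha hb
        | mem j y hy => exact Submodule.mem_iSup_of_mem (i + j) (tmul_mem_tensorGr hx hy rfl)
  · intro n t ht
    induction ht using Submodule.span_induction with
    | zero => simp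
    | add a b _ _ ha hb => rw [map_add, ha, hb, Finsupp.single_add]
    | smul r a _ ha => rw [map_smul, ha, Finsupp.smul_single]
    | mem t ht =>
      obtain ⟨i, j, x, y, hx, hy, rfl, rfl⟩ := ht
      simp [hc i x hx, hd j y hy]

theorem prod_isInternal {𝒱 : ℤ → Submodule F2 V} {𝒲 : ℤ → Submodule F2 W}
    (hV : DirectSum.IsInternal 𝒱) (hW : DirectSum.IsInternal 𝒲) :
    DirectSum.IsInternal (fun n => (𝒱 n).prod (𝒲 n)) := by
  classical
  obtain ⟨c, hc⟩ := exists_finsupp_of_isInternal hV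
  obtain ⟨d, hd⟩ := exists_finsupp_of_isInternal hW
  refine isInternal_of_finsupp _ ?_
    ((Finsupp.mapRange.linearMap (LinearMap.inl F2 V W)).comp (c.comp (LinearMap.fst F2 V W)) +
     (Finsupp.mapRange.linearMap (LinearMap.inr F2 V W)).comp (d.comp (LinearMap.snd F2 V W))) ?_
  · rintro ⟨x, y⟩
    have hx : (x, (0 : W)) ∈ ⨆ n, (𝒱 n).prod (𝒲 n) := by
      induction mem_iSup_of_isInternal hV x using Submodule.iSup_induction' with
      | zero => exact Submodule.zero_mem _
      | add a b _ _ ha hb => simpa using Submodule.add_mem _ ha hb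
      | mem i x hx => exact Submodule.mem_iSup_of_mem i ⟨hx, Submodule.zero_mem _⟩
    have hy : ((0 : V), y) ∈ ⨆ n, (𝒱 n).prod (𝒲 n) := by
      induction mem_iSup_of_isInternal hW y using Submodule.iSup_induction' with
      | zero => exact Submodule.zero_mem _
      | add a b _ _ ha hb => simpa using Submodule.add_mem _ ha hb
      | mem i x hx => exact Submodule.mem_iSup_of_mem i ⟨Submodule.zero_mem _, hx⟩
    simpa using Submodule.add_mem _ hx hy
  · rintro n ⟨x, y⟩ ⟨hx, hy⟩
    simp only [LinearMap.add_apply, LinearMap.comp_apply, LinearMap.fst_apply,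
      LinearMap.snd_apply, hc n x hx, hd n y hy]
    simp [← Finsupp.single_add]

end Gradings

/-! ### The Hopf algebras `A(1)` and `E(1)` -/

/-- An `F2`-bialgebra with homogeneous pieces `deg n`, respected by the coproduct and the
counit. -/
class GrBialg (B : Type) [Ring B] [Bialgebra F2 B] where
  deg : ℤ → Submodule F2 B
  comul_mem : ∀ n, ∀ b ∈ deg n, Coalgebra.comul (R := F2) b ∈ tensorGr deg deg n
  counit_eq_zero : ∀ n, n ≠ 0 → ∀ b ∈ deg n, Coalgebra.counit (R := F2) b = 0

section Words

variable {B : Type} [Ring B] [Algebra F2 B]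

/-- The span of the words of degree `n` in generators `g i` of degree `w i`. -/
def wordDeg (g : Fin 2 → B) (w : Fin 2 → ℤ) (n : ℤ) : Submodule F2 B :=
  Submodule.span F2 {b | ∃ l : List (Fin 2), (l.map w).sum = n ∧ (l.map g).prod = b}

theorem wordDeg_mul {g : Fin 2 → B} {w : Fin 2 → ℤ} {m n : ℤ} {a b : B}
    (ha : a ∈ wordDeg g w m) (hb : b ∈ wordDeg g w n) : a * b ∈ wordDeg g w (m + n) := by
  induction ha using Submodule.span_induction with
  | zero => simp
  | add x y _ _ hx hy => rw [add_mul]; exact Submodule.add_mem _ hx hy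
  | smul r x _ hx => rw [smul_mul_assoc]; exact Submodule.smul_mem _ r hx
  | mem x hx =>
    obtain ⟨l, hl, rfl⟩ := hx
    induction hb using Submodule.span_induction with
    | zero => simp
    | add x y _ _ hx hy => rw [mul_add]; exact Submodule.add_mem _ hx hy
    | smul r x _ hx => rw [mul_smul_comm]; exact Submodule.smul_mem _ r hx
    | mem y hy =>
      obtain ⟨k, hk, rfl⟩ := hy
      exact Submodule.subset_span ⟨l ++ k, by simp [hl, hk], by simp⟩

theorem gen_mem_wordDeg (g : Fin 2 → B) (w : Fin 2 → ℤ) (i : Fin 2) :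
    g i ∈ wordDeg g w (w i) :=
  Submodule.subset_span ⟨[i], by simp, by simp⟩

theorem one_mem_wordDeg (g : Fin 2 → B) (w : Fin 2 → ℤ) : (1 : B) ∈ wordDeg g w 0 :=
  Submodule.subset_span ⟨[], by simp, by simp⟩

theorem tensorGr_mul {g : Fin 2 → B} {w : Fin 2 → ℤ} {m n : ℤ} {a b : B ⊗[F2] B}
    (ha : a ∈ tensorGr (wordDeg g w) (wordDeg g w) m)
    (hb : b ∈ tensorGr (wordDeg g w) (wordDeg g w) n) :
    a * b ∈ tensorGr (wordDeg g w) (wordDeg g w) (m + n) := by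
  induction ha using Submodule.span_induction with
  | zero => simp
  | add x y _ _ hx hy => rw [add_mul]; exact Submodule.add_mem _ hx hy
  | smul r x _ hx => rw [smul_mul_assoc]; exact Submodule.smul_mem _ r hx
  | mem x hx =>
    obtain ⟨i, j, x, y, hx, hy, rfl, rfl⟩ := hx
    induction hb using Submodule.span_induction with
    | zero => simp
    | add x y _ _ hx hy => rw [mul_add]; exact Submodule.add_mem _ hx hy
    | smul r x _ hx => rw [mul_smul_comm]; exact Submodule.smul_mem _ r hx
    | mem y hy =>
      obtain ⟨i', j', x', y', hx', hy', rfl, rfl⟩ := hy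
      rw [Algebra.TensorProduct.tmul_mul_tmul]
      exact tmul_mem_tensorGr (wordDeg_mul hx hx') (wordDeg_mul hy hy') (by ring)

theorem comul_mem_of_gen {g : Fin 2 → B} {w : Fin 2 → ℤ} (Δ : B →ₐ[F2] B ⊗[F2] B)
    (h : ∀ i, Δ (g i) ∈ tensorGr (wordDeg g w) (wordDeg g w) (w i)) (n : ℤ) (b : B)
    (hb : b ∈ wordDeg g w n) : Δ b ∈ tensorGr (wordDeg g w) (wordDeg g w) n := by
  induction hb using Submodule.span_induction with
  | zero => simp
  | add x y _ _ hx hy => rw [map_add]; exact Submodule.add_mem _ hx hy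
  | smul r x _ hx => rw [map_smul]; exact Submodule.smul_mem _ r hx
  | mem x hx =>
    obtain ⟨l, rfl, rfl⟩ := hx
    induction l with
    | nil =>
      simpa [Algebra.TensorProduct.one_def] using
        tmul_mem_tensorGr (one_mem_wordDeg g w) (one_mem_wordDeg g w) (by simp)
    | cons i l ih => simpa using tensorGr_mul (h i) ih

theorem counit_of_gen {g : Fin 2 → B} {w : Fin 2 → ℤ} (ε : B →ₐ[F2] F2)
    (h : ∀ i, ε (g i) = 0) (n : ℤ) (hn : n ≠ 0) (b : B) (hb : b ∈ wordDeg g w n) : ε b = 0 := by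
  induction hb using Submodule.span_induction with
  | zero => simp
  | add x y _ _ hx hy => rw [map_add, hx, hy, add_zero]
  | smul r x _ hx => rw [map_smul, hx, smul_zero]
  | mem x hx =>
    obtain ⟨l, rfl, rfl⟩ := hx
    cases l with
    | nil => simp at hn
    | cons i l => simp [h i]

theorem smul_mem_of_gen {V : Type*} [AddCommGroup V] [Module F2 V] {g : Fin 2 → B}
    {w : Fin 2 → ℤ} (ρ : B →ₐ[F2] Module.End F2 V) (𝒱 : ℤ → Submodule F2 V)
    (h : ∀ i n, ∀ v ∈ 𝒱 n, ρ (g i) v ∈ 𝒱 (w i + n)) (m : ℤ) (b : B) (hb : b ∈ wordDeg g w m) :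
    ∀ n, ∀ v ∈ 𝒱 n, ρ b v ∈ 𝒱 (m + n) := by
  induction hb using Submodule.span_induction with
  | zero => simp
  | add x y _ _ hx hy =>
    intro n v hv; rw [map_add]; exact Submodule.add_mem _ (hx n v hv) (hy n v hv)
  | smul r x _ hx => intro n v hv; rw [map_smul]; exact Submodule.smul_mem _ r (hx n v hv)
  | mem x hx =>
    obtain ⟨l, rfl, rfl⟩ := hx
    induction l with
    | nil => intro n v hv; simpa using hv
    | cons i l ih =>
      intro n v hv
      have := h i _ _ (ih n v hv)
      simpa [add_assoc] using this

theorem map_mem_of_gen {C : Type} [Ring C] [Algebra F2 C] {g : Fin 2 → B} {w : Fin 2 → ℤ}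
    {g' : Fin 2 → C} {w' : Fin 2 → ℤ} (φ : B →ₐ[F2] C)
    (h : ∀ i, φ (g i) ∈ wordDeg g' w' (w i)) (n : ℤ) (b : B) (hb : b ∈ wordDeg g w n) :
    φ b ∈ wordDeg g' w' n := by
  induction hb using Submodule.span_induction with
  | zero => simp
  | add x y _ _ hx hy => rw [map_add]; exact Submodule.add_mem _ hx hy
  | smul r x _ hx => rw [map_smul]; exact Submodule.smul_mem _ r hx
  | mem x hx =>
    obtain ⟨l, rfl, rfl⟩ := hx
    induction l with
    | nil => simpa using one_mem_wordDeg g' w'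
    | cons i l ih => simpa using wordDeg_mul (h i) ih

end Words

/-- The Adem relations of `A(1)`, where `0` stands for `Sq^1` and `1` for `Sq^2`:
`Sq^1 Sq^1 = 0` and `Sq^2 Sq^2 = Sq^3 Sq^1 = Sq^1 Sq^2 Sq^1`. -/
inductive A1Rel : FreeAlgebra F2 (Fin 2) → FreeAlgebra F2 (Fin 2) → Prop
  | sq1_sq1 : A1Rel (FreeAlgebra.ι F2 0 * FreeAlgebra.ι F2 0) 0
  | sq2_sq2 : A1Rel (FreeAlgebra.ι F2 1 * FreeAlgebra.ι F2 1)
      (FreeAlgebra.ι F2 0 * FreeAlgebra.ι F2 1 * FreeAlgebra.ι F2 0)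

/-- The subalgebra `A(1)` of the mod 2 Steenrod algebra generated by `Sq^1` and `Sq^2`, through
its standard presentation. -/
abbrev A1 : Type := RingQuot A1Rel

/-- The relations of `E(1)`, where `0` stands for `Q_0` and `1` for `Q_1`:
`E(1)` is the exterior algebra on `Q_0` and `Q_1` over the field with two elements. -/
inductive E1Rel : FreeAlgebra F2 (Fin 2) → FreeAlgebra F2 (Fin 2) → Prop
  | q0_q0 : E1Rel (FreeAlgebra.ι F2 0 * FreeAlgebra.ι F2 0) 0
  | q1_q1 : E1Rel (FreeAlgebra.ι F2 1 * FreeAlgebra.ι F2 1) 0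
  | comm : E1Rel (FreeAlgebra.ι F2 0 * FreeAlgebra.ι F2 1)
      (FreeAlgebra.ι F2 1 * FreeAlgebra.ι F2 0)

/-- The exterior algebra `E(1)` on the Milnor primitives `Q_0` and `Q_1`. -/
abbrev E1 : Type := RingQuot E1Rel

namespace A1

/-- The generators `Sq^1` (index `0`) and `Sq^2` (index `1`). -/
noncomputable def gen (i : Fin 2) : A1 := RingQuot.mkAlgHom F2 A1Rel (FreeAlgebra.ι F2 i)

theorem gen00 : gen 0 * gen 0 = 0 := by
  have := RingQuot.mkAlgHom_rel F2 A1Rel.sq1_sq1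
  simpa [gen] using this

theorem gen11 : gen 1 * gen 1 = gen 0 * gen 1 * gen 0 := by
  have := RingQuot.mkAlgHom_rel F2 A1Rel.sq2_sq2
  simpa [gen] using this

/-- The universal property of `A(1)`. -/
noncomputable def lift {C : Type*} [Semiring C] [Algebra F2 C] (f : Fin 2 → C)
    (h0 : f 0 * f 0 = 0) (h1 : f 1 * f 1 = f 0 * f 1 * f 0) : A1 →ₐ[F2] C :=
  RingQuot.liftAlgHom F2 ⟨FreeAlgebra.lift F2 f, by
    intro x y h
    cases h <;> simp [h0, h1]⟩

@[simp] theorem lift_gen {C : Type*} [Semiring C] [Algebra F2 C] (f : Fin 2 → C)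
    (h0 : f 0 * f 0 = 0) (h1 : f 1 * f 1 = f 0 * f 1 * f 0) (i : Fin 2) :
    lift f h0 h1 (gen i) = f i := by
  simp [lift, gen]

theorem hom_ext {C : Type*} [Semiring C] [Algebra F2 C] {f g : A1 →ₐ[F2] C}
    (h : ∀ i, f (gen i) = g (gen i)) : f = g := by
  apply RingQuot.ringQuot_ext'
  ext i
  exact h i

end A1

namespace E1

/-- The generators `Q_0` (index `0`) and `Q_1` (index `1`). -/
noncomputable def gen (i : Fin 2) : E1 := RingQuot.mkAlgHom F2 E1Rel (FreeAlgebra.ι F2 i)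

theorem gen00 : gen 0 * gen 0 = 0 := by
  have := RingQuot.mkAlgHom_rel F2 E1Rel.q0_q0
  simpa [gen] using this

theorem gen11 : gen 1 * gen 1 = 0 := by
  have := RingQuot.mkAlgHom_rel F2 E1Rel.q1_q1
  simpa [gen] using this

theorem gen01 : gen 0 * gen 1 = gen 1 * gen 0 := by
  have := RingQuot.mkAlgHom_rel F2 E1Rel.comm
  simpa [gen] using this

/-- The universal property of `E(1)`. -/
noncomputable def lift {C : Type*} [Semiring C] [Algebra F2 C] (f : Fin 2 → C)
    (h0 : f 0 * f 0 = 0) (h1 : f 1 * f 1 = 0) (h2 : f 0 * f 1 = f 1 * f 0) : E1 →ₐ[F2] C :=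
  RingQuot.liftAlgHom F2 ⟨FreeAlgebra.lift F2 f, by
    intro x y h
    cases h <;> simp [h0, h1, h2]⟩

@[simp] theorem lift_gen {C : Type*} [Semiring C] [Algebra F2 C] (f : Fin 2 → C)
    (h0 : f 0 * f 0 = 0) (h1 : f 1 * f 1 = 0) (h2 : f 0 * f 1 = f 1 * f 0) (i : Fin 2) :
    lift f h0 h1 h2 (gen i) = f i := by
  simp [lift, gen]

theorem hom_ext {C : Type*} [Semiring C] [Algebra F2 C] {f g : E1 →ₐ[F2] C}
    (h : ∀ i, f (gen i) = g (gen i)) : f = g := by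
  apply RingQuot.ringQuot_ext'
  ext i
  exact h i

end E1

theorem add_self_F2 {V : Type*} [AddCommGroup V] [Module F2 V] (x : V) : x + x = 0 := by
  have : (1 + 1 : F2) • x = 0 := by
    rw [show (1 + 1 : F2) = 0 from rfl, zero_smul]
  simpa [add_smul] using this

theorem eq_of_add_eq_zero_F2 {V : Type*} [AddCommGroup V] [Module F2 V] {x y : V}
    (h : x + y = 0) : x = y := by
  rw [← add_zero x, ← add_self_F2 y, ← add_assoc, h, zero_add]

theorem A1.gen00' (x : A1) : gen 0 * (gen 0 * x) = 0 := by
  rw [← mul_assoc, gen00, zero_mul]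

/-- `Δ Sq^1 = Sq^1 ⊗ 1 + 1 ⊗ Sq^1` and `Δ Sq^2 = Sq^2 ⊗ 1 + Sq^1 ⊗ Sq^1 + 1 ⊗ Sq^2`. -/
noncomputable def A1.Δgen : Fin 2 → A1 ⊗[F2] A1 :=
  ![gen 0 ⊗ₜ 1 + 1 ⊗ₜ gen 0, gen 1 ⊗ₜ 1 + gen 0 ⊗ₜ gen 0 + 1 ⊗ₜ gen 1]

/-- The coproduct of `A(1)` (Cartan formula). -/
noncomputable def A1.Δ : A1 →ₐ[F2] A1 ⊗[F2] A1 :=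
  A1.lift A1.Δgen
    (by
      simp only [A1.Δgen, Matrix.cons_val_zero, add_mul, mul_add,
        Algebra.TensorProduct.tmul_mul_tmul, gen00, mul_one, one_mul, TensorProduct.zero_tmul,
        TensorProduct.tmul_zero, zero_add, add_zero]
      exact add_self_F2 (V := A1 ⊗[F2] A1) _)
    (by
      apply eq_of_add_eq_zero_F2 (V := A1 ⊗[F2] A1)
      simp only [A1.Δgen, Matrix.cons_val_zero, Matrix.cons_val_one, add_mul, mul_add,
        Algebra.TensorProduct.tmul_mul_tmul, gen00, gen11, mul_assoc, mul_one, one_mul,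
        TensorProduct.zero_tmul, TensorProduct.tmul_zero, zero_add, add_zero]
      abel_nf
      simp only [two_zsmul, add_self_F2 (V := A1 ⊗[F2] A1)])

/-- The counit of `A(1)`. -/
noncomputable def A1.ε : A1 →ₐ[F2] F2 := A1.lift (fun _ => 0) (by simp) (by simp)

noncomputable instance : Bialgebra F2 A1 :=
  Bialgebra.ofAlgHom A1.Δ A1.ε
    (by
      apply A1.hom_ext
      intro i
      fin_cases i
      · simp [A1.Δ, A1.Δgen, TensorProduct.add_tmul, TensorProduct.tmul_add,
          Algebra.TensorProduct.one_def]
        abel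
      · simp [A1.Δ, A1.Δgen, TensorProduct.add_tmul, TensorProduct.tmul_add,
          Algebra.TensorProduct.one_def]
        abel)
    (by
      apply A1.hom_ext
      intro i
      fin_cases i <;> simp [A1.Δ, A1.Δgen, A1.ε])
    (by
      apply A1.hom_ext
      intro i
      fin_cases i <;> simp [A1.Δ, A1.Δgen, A1.ε])

/-- The elements `Q_i ⊗ 1 + 1 ⊗ Q_i`. -/
noncomputable def E1.Δgen (i : Fin 2) : E1 ⊗[F2] E1 := gen i ⊗ₜ 1 + 1 ⊗ₜ gen i

/-- The coproduct of `E(1)`: both generators are primitive. -/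
noncomputable def E1.Δ : E1 →ₐ[F2] E1 ⊗[F2] E1 :=
  E1.lift E1.Δgen
    (by
      simp only [E1.Δgen, add_mul, mul_add,
        Algebra.TensorProduct.tmul_mul_tmul, gen00, mul_one, one_mul, TensorProduct.zero_tmul,
        TensorProduct.tmul_zero, zero_add, add_zero]
      exact add_self_F2 (V := E1 ⊗[F2] E1) _)
    (by
      simp only [E1.Δgen, add_mul, mul_add,
        Algebra.TensorProduct.tmul_mul_tmul, gen11, mul_one, one_mul, TensorProduct.zero_tmul,
        TensorProduct.tmul_zero, zero_add, add_zero]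
      exact add_self_F2 (V := E1 ⊗[F2] E1) _)
    (by
      simp only [E1.Δgen, add_mul, mul_add,
        Algebra.TensorProduct.tmul_mul_tmul, gen01, mul_one, one_mul]
      abel)

/-- The counit of `E(1)`. -/
noncomputable def E1.ε : E1 →ₐ[F2] F2 := E1.lift (fun _ => 0) (by simp) (by simp) (by simp)

noncomputable instance : Bialgebra F2 E1 :=
  Bialgebra.ofAlgHom E1.Δ E1.ε
    (by
      apply E1.hom_ext
      intro i
      simp [E1.Δ, E1.Δgen, TensorProduct.add_tmul, TensorProduct.tmul_add,
          Algebra.TensorProduct.one_def]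
      abel)
    (by
      apply E1.hom_ext
      intro i
      simp [E1.Δ, E1.Δgen, E1.ε])
    (by
      apply E1.hom_ext
      intro i
      simp [E1.Δ, E1.Δgen, E1.ε])

/-- The grading of `A(1)`, with `Sq^i` in degree `i`. -/
noncomputable instance : GrBialg A1 where
  deg := wordDeg A1.gen ![1, 2]
  comul_mem := comul_mem_of_gen A1.Δ (by
    have h0 := gen_mem_wordDeg A1.gen ![1, 2] 0
    have h1 := gen_mem_wordDeg A1.gen ![1, 2] 1
    have h := one_mem_wordDeg A1.gen ![1, 2]
    intro i
    fin_cases i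
    · simp only [A1.Δ, A1.lift_gen, A1.Δgen, Fin.zero_eta, Matrix.cons_val_zero]
      exact Submodule.add_mem _ (tmul_mem_tensorGr h0 h (by simp))
        (tmul_mem_tensorGr h h0 (by simp))
    · simp only [A1.Δ, A1.lift_gen, A1.Δgen, Fin.mk_one, Matrix.cons_val_one]
      exact Submodule.add_mem _ (Submodule.add_mem _ (tmul_mem_tensorGr h1 h (add_zero _))
        (tmul_mem_tensorGr h0 h0 (by simp))) (tmul_mem_tensorGr h h1 (zero_add _)))
  counit_eq_zero := counit_of_gen A1.ε fun i => by simp [A1.ε]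

/-- The grading of `E(1)`, with `Q_0` in degree `1` and `Q_1` in degree `3`. -/
noncomputable instance : GrBialg E1 where
  deg := wordDeg E1.gen ![1, 3]
  comul_mem := comul_mem_of_gen E1.Δ (by
    have h := one_mem_wordDeg E1.gen ![1, 3]
    intro i
    have h1 := gen_mem_wordDeg E1.gen ![1, 3] i
    rw [E1.Δ, E1.lift_gen, E1.Δgen]
    exact Submodule.add_mem _ (tmul_mem_tensorGr h1 h (add_zero _))
        (tmul_mem_tensorGr h h1 (zero_add _)))
  counit_eq_zero := counit_of_gen E1.ε fun i => by simp [E1.ε]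

/-- The Milnor primitives of `A(1)`: `Q_0 = Sq^1` and `Q_1 = Sq^2 Q_0 + Q_0 Sq^2`. -/
noncomputable def A1.milnor : Fin 2 → A1 := ![gen 0, gen 1 * gen 0 + gen 0 * gen 1]

theorem A1.milnor_one_sq : milnor 1 * milnor 1 = 0 := by
  have h : gen 1 * (gen 0 * gen 1 * gen 0) = gen 0 * gen 1 * gen 0 * gen 1 := by
    rw [← gen11, mul_assoc]
  simp only [milnor, Matrix.cons_val_one, Matrix.cons_val_fin_one]
  calc (gen 1 * gen 0 + gen 0 * gen 1) * (gen 1 * gen 0 + gen 0 * gen 1)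
      = gen 1 * (gen 0 * gen 1 * gen 0) + gen 1 * (gen 0 * gen 0) * gen 1
        + gen 0 * (gen 1 * gen 1) * gen 0 + gen 0 * gen 1 * gen 0 * gen 1 := by noncomm_ring
    _ = 0 := by
      rw [h, gen00, gen11]
      simp only [mul_assoc, gen00', mul_zero, zero_mul, add_zero]
      exact add_self_F2 (V := A1) _

/-- The inclusion of `E(1)` in `A(1)` as algebras, taking `Q_i` to the Milnor primitive `Q_i`. -/
noncomputable def E1.toA1Alg : E1 →ₐ[F2] A1 :=
  E1.lift A1.milnor
    (by simp [A1.milnor, A1.gen00])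
    A1.milnor_one_sq
    (by simp [A1.milnor, mul_add, add_mul, mul_assoc, A1.gen00, A1.gen00'])

theorem A1.comul_milnor (i : Fin 2) :
    A1.Δ (milnor i) = milnor i ⊗ₜ 1 + 1 ⊗ₜ milnor i := by
  fin_cases i
  · simp [milnor, A1.Δ, A1.Δgen]
  · apply eq_of_add_eq_zero_F2 (V := A1 ⊗[F2] A1)
    simp only [milnor, Fin.mk_one, Matrix.cons_val_one, Matrix.cons_val_fin_one, map_add, map_mul,
      A1.Δ, A1.lift_gen, A1.Δgen, Matrix.cons_val_zero, add_mul, mul_add,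
      Algebra.TensorProduct.tmul_mul_tmul, gen00, mul_one, one_mul, TensorProduct.add_tmul,
      TensorProduct.tmul_add, TensorProduct.zero_tmul, TensorProduct.tmul_zero, add_zero]
    abel_nf
    simp only [two_zsmul, add_self_F2 (V := A1 ⊗[F2] A1)]

/-- The inclusion of `E(1)` in `A(1)` as bialgebras. -/
noncomputable def E1.toA1 : E1 →ₐc[F2] A1 :=
  BialgHom.ofAlgHom E1.toA1Alg
    (E1.hom_ext fun i => by
      change A1.ε (E1.toA1Alg (E1.gen i)) = E1.ε (E1.gen i)
      fin_cases i <;> simp [E1.toA1Alg, E1.ε, A1.ε, A1.milnor])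
    (E1.hom_ext fun i => by
      change Algebra.TensorProduct.map E1.toA1Alg E1.toA1Alg (E1.Δ (E1.gen i)) =
        A1.Δ (E1.toA1Alg (E1.gen i))
      simp [E1.toA1Alg, E1.Δ, E1.Δgen, A1.comul_milnor])

theorem A1.milnor_mem (i : Fin 2) :
    milnor i ∈ wordDeg gen ![1, 2] ((![1, 3] : Fin 2 → ℤ) i) := by
  have h0 := gen_mem_wordDeg gen ![1, 2] 0
  have h1 := gen_mem_wordDeg gen ![1, 2] 1
  fin_cases i
  · exact h0
  · have h3 : (2 + 1 : ℤ) = 3 := by norm_num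
    have h3' : (1 + 2 : ℤ) = 3 := by norm_num
    have a := wordDeg_mul h1 h0
    have b := wordDeg_mul h0 h1
    simp only [Matrix.cons_val_one, Matrix.cons_val_zero, Matrix.cons_val_fin_one, h3, h3'] at a b
    exact Submodule.add_mem _ a b

/-- The two Hopf algebras `B` under consideration, `A(1)` and its subalgebra `E(1)`, with the
inclusion in `A(1)` and the Milnor primitives `Q_0` and `Q_1`. -/
class SubA1 (B : Type) [Ring B] [Bialgebra F2 B] [GrBialg B] where
  incl : B →ₐc[F2] A1
  incl_mem : ∀ n, ∀ b ∈ GrBialg.deg (B := B) n, incl b ∈ GrBialg.deg (B := A1) n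
  Q : Fin 2 → B
  incl_Q : ∀ i, incl (Q i) = A1.milnor i

noncomputable instance : SubA1 A1 where
  incl := BialgHom.id F2 A1
  incl_mem _ _ h := h
  Q := A1.milnor
  incl_Q _ := rfl

noncomputable instance : SubA1 E1 where
  incl := E1.toA1
  incl_mem := map_mem_of_gen E1.toA1Alg (w := ![1, 3]) (w' := ![1, 2]) (g := E1.gen)
    (g' := A1.gen) fun i => by
      rw [E1.toA1Alg, E1.lift_gen]
      exact A1.milnor_mem i
  Q := E1.gen
  incl_Q i := E1.lift_gen _ _ _ _ i

/-! ### Graded modules -/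

/-- A graded (left) `B`-module: an `F2`-vector space with a grading over the integers, internally
the direct sum of its homogeneous pieces, and an action `ρ` of `B` that is additive on degrees. -/
structure GrMod (B : Type) [Ring B] [Bialgebra F2 B] [GrBialg B] where
  carrier : Type u
  [addCommGroup : AddCommGroup carrier]
  [module : Module F2 carrier]
  gr : ℤ → Submodule F2 carrier
  isInternal : DirectSum.IsInternal gr
  ρ : B →ₐ[F2] Module.End F2 carrier
  smul_mem : ∀ m, ∀ b ∈ GrBialg.deg (B := B) m, ∀ n, ∀ v ∈ gr n, ρ b v ∈ gr (m + n)

attribute [instance] GrMod.addCommGroup GrMod.module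

namespace GrMod

variable {B : Type} [Ring B] [Bialgebra F2 B] [GrBialg B]

/-- A morphism of graded modules: `F2`-linear, of degree `0`, and commuting with `B`. -/
@[ext] structure Hom (M N : GrMod.{u} B) where
  lin : M.carrier →ₗ[F2] N.carrier
  map_mem : ∀ n, ∀ v ∈ M.gr n, lin v ∈ N.gr n
  map_smul : ∀ b v, lin (M.ρ b v) = N.ρ b (lin v)

/-- The category of graded `B`-modules. -/
instance : Category (GrMod.{u} B) where
  Hom := Hom
  id M := ⟨LinearMap.id, fun _ _ h => h, fun _ _ => rfl⟩
  comp f g := ⟨g.lin.comp f.lin, fun n v h => g.map_mem n _ (f.map_mem n v h), fun b v => by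
    simp [f.map_smul, g.map_smul]⟩

/-- The linear map underlying a morphism. -/
def lin {M N : GrMod.{u} B} (f : M ⟶ N) : M.carrier →ₗ[F2] N.carrier := Hom.lin f

@[simp] theorem lin_id (M : GrMod.{u} B) : lin (𝟙 M) = LinearMap.id := rfl

@[simp] theorem lin_comp {M N K : GrMod.{u} B} (f : M ⟶ N) (g : N ⟶ K) :
    lin (f ≫ g) = (lin g).comp (lin f) := rfl

theorem hom_ext {M N : GrMod.{u} B} {f g : M ⟶ N} (h : lin f = lin g) : f = g := Hom.ext h

/-- `M` is bounded below: `M_n = 0` for all `n` below some bound. -/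
def BoundedBelow (M : GrMod.{u} B) : Prop := ∃ N : ℤ, ∀ n < N, M.gr n = ⊥

/-- The Margolis homology of `M` with respect to `Q` in degree `n`: the classes in
`Ker Q / Im Q` of the elements of degree `n`. -/
abbrev MargolisH (M : GrMod.{u} B) (Q : B) (n : ℤ) : Type u :=
  ↥(LinearMap.ker (M.ρ Q) ⊓ M.gr n) ⧸
    (LinearMap.range (M.ρ Q)).comap (LinearMap.ker (M.ρ Q) ⊓ M.gr n).subtype

/-! ### The stable category -/

/-- `f` and `g` agree in the stable module category: their difference factors through a
projective module. -/
def StablyEq {M N : GrMod.{u} B} (f g : M ⟶ N) : Prop :=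
  ∃ (P : GrMod.{u} B) (_ : Projective P) (i : M ⟶ P) (p : P ⟶ N), lin f - lin g = lin (i ≫ p)

/-- `f` becomes an isomorphism in the stable module category. -/
def IsStableEquiv {M N : GrMod.{u} B} (f : M ⟶ N) : Prop :=
  ∃ g : N ⟶ M, StablyEq (f ≫ g) (𝟙 M) ∧ StablyEq (g ≫ f) (𝟙 N)

/-- `M` and `N` are stably equivalent: isomorphic in the stable module category. -/
def StablyIso (M N : GrMod.{u} B) : Prop := ∃ f : M ⟶ N, IsStableEquiv f

/-- Two functors on graded modules become naturally isomorphic as functors to the stable module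
category. -/
def StablyNatIso (F G : GrMod.{u} B ⥤ GrMod.{u} B) : Prop :=
  ∃ t : ∀ N, F.obj N ⟶ G.obj N, (∀ N, IsStableEquiv (t N)) ∧
    ∀ (N N' : GrMod.{u} B) (f : N ⟶ N'), StablyEq (F.map f ≫ t N') (t N ≫ G.map f)

/-! ### Constructions of graded modules -/

/-- The action of `B` on the tensor product of two representations, through the coproduct. -/
noncomputable def tensorρ {V W : Type u} [AddCommGroup V] [Module F2 V] [AddCommGroup W]
    [Module F2 W] (ρ : B →ₐ[F2] Module.End F2 V) (σ : B →ₐ[F2] Module.End F2 W) :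
    B →ₐ[F2] Module.End F2 (V ⊗[F2] W) :=
  (Module.endTensorEndAlgHom (R := F2) (S := F2) (A := F2) (M := V) (N := W)).comp
    ((Algebra.TensorProduct.map ρ σ).comp (Bialgebra.comulAlgHom F2 B))

theorem tensorρ_mem {V W : Type u} [AddCommGroup V] [Module F2 V] [AddCommGroup W]
    [Module F2 W] (ρ : B →ₐ[F2] Module.End F2 V) (σ : B →ₐ[F2] Module.End F2 W)
    {𝒱 : ℤ → Submodule F2 V} {𝒲 : ℤ → Submodule F2 W}
    (hρ : ∀ m, ∀ b ∈ GrBialg.deg (B := B) m, ∀ n, ∀ v ∈ 𝒱 n, ρ b v ∈ 𝒱 (m + n))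
    (hσ : ∀ m, ∀ b ∈ GrBialg.deg (B := B) m, ∀ n, ∀ v ∈ 𝒲 n, σ b v ∈ 𝒲 (m + n))
    (m : ℤ) (b : B) (hb : b ∈ GrBialg.deg m) (n : ℤ) (v : V ⊗[F2] W)
    (hv : v ∈ tensorGr 𝒱 𝒲 n) : tensorρ ρ σ b v ∈ tensorGr 𝒱 𝒲 (m + n) := by
  have hc := GrBialg.comul_mem m b hb
  change Module.endTensorEndAlgHom (R := F2) (S := F2) (A := F2) (M := V) (N := W)
    (Algebra.TensorProduct.map ρ σ (Coalgebra.comul (R := F2) b)) v ∈ _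
  generalize Coalgebra.comul (R := F2) b = c at hc
  induction hc using Submodule.span_induction with
  | zero => simp
  | add x y _ _ hx hy =>
    rw [map_add, map_add, LinearMap.add_apply]; exact Submodule.add_mem _ hx hy
  | smul r x _ hx =>
    rw [map_smul, map_smul, LinearMap.smul_apply]; exact Submodule.smul_mem _ r hx
  | mem x hx =>
    obtain ⟨i, j, x, y, hx, hy, rfl, rfl⟩ := hx
    induction hv using Submodule.span_induction with
    | zero => simp
    | add x y _ _ hx hy => rw [map_add]; exact Submodule.add_mem _ hx hy
    | smul r x _ hx => rw [map_smul]; exact Submodule.smul_mem _ r hx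
    | mem v hv =>
      obtain ⟨i', j', v, w, hv, hw, rfl, rfl⟩ := hv
      exact tmul_mem_tensorGr (hρ i x hx i' v hv) (hσ j y hy j' w hw) (by ring)

theorem lTensor_tensorρ {V W W' : Type u} [AddCommGroup V] [Module F2 V] [AddCommGroup W]
    [Module F2 W] [AddCommGroup W'] [Module F2 W'] (ρ : B →ₐ[F2] Module.End F2 V)
    (σ : B →ₐ[F2] Module.End F2 W) (σ' : B →ₐ[F2] Module.End F2 W') (f : W →ₗ[F2] W')
    (hf : ∀ b w, f (σ b w) = σ' b (f w)) (b : B) (v : V ⊗[F2] W) :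
    f.lTensor V (tensorρ ρ σ b v) = tensorρ ρ σ' b (f.lTensor V v) := by
  change f.lTensor V (Module.endTensorEndAlgHom (R := F2) (S := F2) (A := F2) (M := V) (N := W)
    (Algebra.TensorProduct.map ρ σ (Coalgebra.comul (R := F2) b)) v) =
    Module.endTensorEndAlgHom (R := F2) (S := F2) (A := F2) (M := V) (N := W')
    (Algebra.TensorProduct.map ρ σ' (Coalgebra.comul (R := F2) b)) (f.lTensor V v)
  induction Coalgebra.comul (R := F2) b using TensorProduct.induction_on with
  | zero => simp
  | add x y hx hy => simp only [map_add, LinearMap.add_apply, hx, hy]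
  | tmul x y =>
    induction v using TensorProduct.induction_on with
    | zero => simp
    | add x y hx hy => simp only [map_add, hx, hy]
    | tmul v w => exact congrArg (ρ x v ⊗ₜ[F2] ·) (hf y w)

theorem lTensor_mem {V W W' : Type u} [AddCommGroup V] [Module F2 V] [AddCommGroup W]
    [Module F2 W] [AddCommGroup W'] [Module F2 W'] {𝒱 : ℤ → Submodule F2 V}
    {𝒲 : ℤ → Submodule F2 W} {𝒲' : ℤ → Submodule F2 W'} (f : W →ₗ[F2] W')
    (hf : ∀ n, ∀ w ∈ 𝒲 n, f w ∈ 𝒲' n) (n : ℤ) (v : V ⊗[F2] W) (hv : v ∈ tensorGr 𝒱 𝒲 n) :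
    f.lTensor V v ∈ tensorGr 𝒱 𝒲' n := by
  induction hv using Submodule.span_induction with
  | zero => simp
  | add x y _ _ hx hy => rw [map_add]; exact Submodule.add_mem _ hx hy
  | smul r x _ hx => rw [map_smul]; exact Submodule.smul_mem _ r hx
  | mem v hv =>
    obtain ⟨i, j, v, w, hv, hw, rfl, rfl⟩ := hv
    exact tmul_mem_tensorGr hv (hf j w hw) rfl

/-- The tensor product over `F2`, with the diagonal action. -/
noncomputable def tensor (M N : GrMod.{u} B) : GrMod.{u} B where
  carrier := M.carrier ⊗[F2] N.carrier
  gr := tensorGr M.gr N.gr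
  isInternal := tensorGr_isInternal M.isInternal N.isInternal
  ρ := tensorρ M.ρ N.ρ
  smul_mem := tensorρ_mem M.ρ N.ρ M.smul_mem N.smul_mem

/-- The functor `N ↦ M ⊗ N`. -/
noncomputable def tensorFunctor (M : GrMod.{u} B) : GrMod.{u} B ⥤ GrMod.{u} B where
  obj N := M.tensor N
  map {N N'} f :=
    { lin := (lin f).lTensor M.carrier
      map_mem := lTensor_mem (lin f) (Hom.map_mem f)
      map_smul := lTensor_tensorρ M.ρ N.ρ N'.ρ (lin f) (Hom.map_smul f) }
  map_id _ := hom_ext (LinearMap.lTensor_id _ _)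
  map_comp _ _ := hom_ext (LinearMap.lTensor_comp _ _ _)

/-- The direct sum of two graded modules. -/
def directSum (M N : GrMod.{u} B) : GrMod.{u} B where
  carrier := M.carrier × N.carrier
  gr n := (M.gr n).prod (N.gr n)
  isInternal := prod_isInternal M.isInternal N.isInternal
  ρ := AlgHom.ofLinearMap
    (LinearMap.mk ⟨fun b => (M.ρ b).prodMap (N.ρ b), fun a b => by ext <;> simp⟩
      (fun r b => by ext <;> simp))
    (by ext <;> simp) (fun a b => by
      change (M.ρ (a * b)).prodMap (N.ρ (a * b)) =
        (M.ρ a).prodMap (N.ρ a) * (M.ρ b).prodMap (N.ρ b)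
      rw [map_mul, map_mul]
      rfl)
  smul_mem m b hb n v hv := ⟨M.smul_mem m b hb n v.1 hv.1, N.smul_mem m b hb n v.2 hv.2⟩

/-- The functor `N ↦ F N ⊕ G N`. -/
def sumFunctor (F G : GrMod.{u} B ⥤ GrMod.{u} B) : GrMod.{u} B ⥤ GrMod.{u} B where
  obj N := (F.obj N).directSum (G.obj N)
  map f :=
    { lin := (lin (F.map f)).prodMap (lin (G.map f))
      map_mem := fun n _ hv =>
        ⟨Hom.map_mem (F.map f) n _ hv.1, Hom.map_mem (G.map f) n _ hv.2⟩
      map_smul := fun b v =>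
        Prod.ext (Hom.map_smul (F.map f) b v.1) (Hom.map_smul (G.map f) b v.2) }
  map_id N := hom_ext (by
    change (lin (F.map (𝟙 N))).prodMap (lin (G.map (𝟙 N))) = LinearMap.id
    rw [F.map_id, G.map_id]
    rfl)
  map_comp f g := hom_ext (by
    change (lin (F.map (f ≫ g))).prodMap (lin (G.map (f ≫ g))) =
      ((lin (F.map g)).prodMap (lin (G.map g))).comp ((lin (F.map f)).prodMap (lin (G.map f)))
    rw [F.map_comp, G.map_comp]
    rfl)

/-- The suspension: `(Σ^k M)_n = M_{n-k}`, with the same action of `B`. -/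
def suspend (k : ℤ) (M : GrMod.{u} B) : GrMod.{u} B where
  carrier := M.carrier
  gr n := M.gr (n - k)
  isInternal := by
    obtain ⟨c, hc⟩ := exists_finsupp_of_isInternal M.isInternal
    refine isInternal_of_finsupp _ (fun x => ?_)
      ((Finsupp.lmapDomain M.carrier F2 (fun n : ℤ => n + k)).comp c) ?_
    · induction mem_iSup_of_isInternal M.isInternal x using Submodule.iSup_induction' with
      | zero => exact Submodule.zero_mem _
      | add a b _ _ ha hb => exact Submodule.add_mem _ ha hb
      | mem i x hx => exact Submodule.mem_iSup_of_mem (i + k) (by simpa using hx)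
    · intro n x hx
      simp [hc _ x hx]
  ρ := M.ρ
  smul_mem m b hb n v hv := by
    have := M.smul_mem m b hb (n - k) v hv
    rwa [← add_sub_assoc] at this

/-- The zero module. -/
def zero : GrMod.{u} B where
  carrier := PUnit.{u + 1}
  gr _ := ⊥
  isInternal := isInternal_of_finsupp _ (fun _ => Submodule.zero_mem _) 0 (fun n x _ => by
    exact Finsupp.ext fun _ => Subsingleton.elim _ _)
  ρ := AlgHom.ofLinearMap 0 (by ext) (fun _ _ => by ext)
  smul_mem _ _ _ _ _ _ := Subsingleton.elim _ _

/-- The constant functor with value `0`. -/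
def zeroFunctor : GrMod.{u} B ⥤ GrMod.{u} B := (Functor.const _).obj zero

/-- The module `F2`, concentrated in degree `0`, on which `B` acts through the counit. -/
noncomputable def unit : GrMod.{u} B where
  carrier := ULift.{u} F2
  gr n := if n = 0 then ⊤ else ⊥
  isInternal := isInternal_of_finsupp _
    (fun x => Submodule.mem_iSup_of_mem 0 (by simp)) (Finsupp.lsingle 0) (fun n x hx => by
      by_cases h : n = 0
      · subst h; rfl
      · rw [if_neg h, Submodule.mem_bot] at hx
        subst hx; simp)
  ρ := (Algebra.ofId F2 _).comp (Bialgebra.counitAlgHom F2 B)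
  smul_mem m b hb n v hv := by
    by_cases hm : m = 0
    · subst hm
      rw [zero_add]
      exact Submodule.smul_mem _ (Coalgebra.counit (R := F2) b) hv
    · have : Bialgebra.counitAlgHom F2 B b = 0 := GrBialg.counit_eq_zero m hm b hb
      rw [AlgHom.comp_apply, this, map_zero]
      exact Submodule.zero_mem _

/-- A graded `A(1)`-module, restricted to the subalgebra `B`. -/
noncomputable def restrict (B : Type) [Ring B] [Bialgebra F2 B] [GrBialg B] [SubA1 B]
    (M : GrMod.{u} A1) : GrMod.{u} B where
  carrier := M.carrier
  gr := M.gr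
  isInternal := M.isInternal
  ρ := M.ρ.comp (SubA1.incl (B := B) : B →ₐ[F2] A1)
  smul_mem m b hb := M.smul_mem m _ (SubA1.incl_mem m b hb)

/-! ### Monomial modules -/

section Monomial

/-- The exponents in `S`. -/
abbrev Expo (S : Set ℤ) : Type u := {s : ULift.{u} ℤ // s.down ∈ S}

open Classical in
/-- The operation `Sq^k x^n = (n choose k) x^(n+k)` on the span of the `x^n` with `n ∈ S`, where
`x^(n+k)` is read as `0` if `n + k` is not in `S`. The binomial coefficient
`n (n-1) ⋯ (n-k+1) / k!` makes sense for negative `n`, too. -/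
noncomputable def monoSq (S : Set ℤ) (k : ℕ) :
    (Expo.{u} S →₀ F2) →ₗ[F2] (Expo.{u} S →₀ F2) :=
  Finsupp.linearCombination F2 fun s =>
    if h : s.1.down + k ∈ S then
      Finsupp.single (⟨⟨s.1.down + k⟩, h⟩ : Expo.{u} S) ((Ring.choose s.1.down k : ℤ) : F2)
    else 0

theorem monoSq_single (S : Set ℤ) (k : ℕ) (s : Expo.{u} S) (h : s.1.down + k ∈ S) :
    monoSq S k (Finsupp.single s 1) = ((Ring.choose s.1.down k : ℤ) : F2) •
      Finsupp.single (⟨⟨s.1.down + k⟩, h⟩ : Expo.{u} S) 1 := by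
  simp [monoSq, h]

theorem monoSq_single_zero (S : Set ℤ) (k : ℕ) (s : Expo.{u} S) (h : s.1.down + k ∉ S) :
    monoSq S k (Finsupp.single s 1) = 0 := by
  simp [monoSq, h]

theorem choose_one_mul (n : ℤ) :
    ((Ring.choose n 1 : ℤ) : F2) * ((Ring.choose (n + 1) 1 : ℤ) : F2) = 0 := by
  rw [Ring.choose_one_right, Ring.choose_one_right, ← Int.cast_mul,
    ZMod.intCast_zmod_eq_zero_iff_dvd]
  exact (Int.even_mul_succ_self n).two_dvd

theorem choose_two_mul (n : ℤ) :
    ((Ring.choose n 2 : ℤ) : F2) * ((Ring.choose (n + 2) 2 : ℤ) : F2) = 0 := by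
  have h1 := Ring.choose_succ_succ n 1
  have h2 := Ring.choose_succ_succ (n + 1) 1
  rw [Ring.choose_one_right] at h1 h2
  have h3 : n + 2 = n + 1 + 1 := by ring
  norm_num at h1 h2
  rw [h3, h2, h1, ← Int.cast_mul, ZMod.intCast_zmod_eq_zero_iff_dvd]
  have := (Int.even_mul_succ_self (Ring.choose n 2)).two_dvd
  obtain ⟨c, hc⟩ := this
  exact ⟨c + n * Ring.choose n 2, by linear_combination hc⟩

theorem choose_one_mul' (n : ℤ) :
    ((Ring.choose n 1 : ℤ) : F2) * ((Ring.choose (n + 3) 1 : ℤ) : F2) = 0 := by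
  rw [Ring.choose_one_right, Ring.choose_one_right, ← Int.cast_mul,
    ZMod.intCast_zmod_eq_zero_iff_dvd]
  obtain ⟨c, hc⟩ := (Int.even_mul_succ_self n).two_dvd
  exact ⟨c + n, by linear_combination hc⟩

theorem monoSq_one_one (S : Set ℤ) : monoSq.{u} S 1 * monoSq.{u} S 1 = 0 := by
  refine Finsupp.lhom_ext' fun s => LinearMap.ext_ring ?_
  change monoSq S 1 (monoSq S 1 (Finsupp.single s 1)) = 0
  by_cases h : s.1.down + (1 : ℕ) ∈ S
  · rw [monoSq_single S 1 s h, map_smul]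
    by_cases h' : s.1.down + (1 : ℕ) + (1 : ℕ) ∈ S
    · rw [monoSq_single S 1 _ h', smul_smul]
      have := choose_one_mul s.1.down
      push_cast
      rw [this, zero_smul]
    · rw [monoSq_single_zero S 1 _ h', smul_zero]
  · rw [monoSq_single_zero S 1 s h, map_zero]

theorem monoSq_two_two (S : Set ℤ) : monoSq.{u} S 2 * monoSq.{u} S 2 = 0 := by
  refine Finsupp.lhom_ext' fun s => LinearMap.ext_ring ?_
  change monoSq S 2 (monoSq S 2 (Finsupp.single s 1)) = 0
  by_cases h : s.1.down + (2 : ℕ) ∈ S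
  · rw [monoSq_single S 2 s h, map_smul]
    by_cases h' : s.1.down + (2 : ℕ) + (2 : ℕ) ∈ S
    · rw [monoSq_single S 2 _ h', smul_smul]
      have := choose_two_mul s.1.down
      push_cast
      rw [this, zero_smul]
    · rw [monoSq_single_zero S 2 _ h', smul_zero]
  · rw [monoSq_single_zero S 2 s h, map_zero]

theorem monoSq_one_two_one (S : Set ℤ) :
    monoSq.{u} S 1 * monoSq.{u} S 2 * monoSq.{u} S 1 = 0 := by
  refine Finsupp.lhom_ext' fun s => LinearMap.ext_ring ?_
  change monoSq S 1 (monoSq S 2 (monoSq S 1 (Finsupp.single s 1))) = 0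
  by_cases h : s.1.down + (1 : ℕ) ∈ S
  · rw [monoSq_single S 1 s h, map_smul]
    by_cases h' : s.1.down + (1 : ℕ) + (2 : ℕ) ∈ S
    · rw [monoSq_single S 2 _ h', map_smul, map_smul]
      by_cases h'' : s.1.down + (1 : ℕ) + (2 : ℕ) + (1 : ℕ) ∈ S
      · rw [monoSq_single S 1 _ h'']
        have h3 := choose_one_mul' s.1.down
        have h4 : s.1.down + (1 : ℕ) + (2 : ℕ) = s.1.down + 3 := by push_cast; ring
        rw [← h4] at h3
        rw [smul_smul, smul_smul]
        refine (congrArg (· • _) ?_).trans (zero_smul F2 _)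
        rw [mul_assoc, mul_left_comm]
        exact (congrArg (_ * ·) h3).trans (mul_zero _)
      · rw [monoSq_single_zero S 1 _ h'', smul_zero, smul_zero]
    · rw [monoSq_single_zero S 2 _ h', smul_zero, map_zero]
  · rw [monoSq_single_zero S 1 s h, map_zero, map_zero]

/-- The span of the homogeneous elements `x^n`. -/
noncomputable def monoGr (S : Set ℤ) (n : ℤ) : Submodule F2 (Expo.{u} S →₀ F2) :=
  Finsupp.supported F2 F2 {s | s.1.down = n}

theorem monoGr_isInternal (S : Set ℤ) : DirectSum.IsInternal (monoGr.{u} S) := by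
  refine isInternal_of_finsupp _ ?_ (Finsupp.linearCombination F2 fun s =>
    Finsupp.single s.1.down (Finsupp.single s 1)) ?_
  · intro f
    induction f using Finsupp.induction_linear with
    | zero => exact Submodule.zero_mem _
    | add f g hf hg => exact Submodule.add_mem _ hf hg
    | single s a =>
      exact Submodule.mem_iSup_of_mem s.1.down (Finsupp.single_mem_supported F2 a rfl)
  · intro n f hf
    rw [monoGr, Finsupp.supported_eq_span_single] at hf
    induction hf using Submodule.span_induction with
    | zero => simp
    | add a b _ _ ha hb => rw [map_add, ha, hb, Finsupp.single_add]
    | smul r a _ ha => rw [map_smul, ha, Finsupp.smul_single]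
    | mem f hf =>
      obtain ⟨s, rfl, rfl⟩ := hf
      simp

theorem monoSq_mem (S : Set ℤ) (k : ℕ) (n : ℤ) (f : Expo.{u} S →₀ F2) (hf : f ∈ monoGr S n) :
    monoSq S k f ∈ monoGr S (k + n) := by
  rw [monoGr, Finsupp.supported_eq_span_single] at hf
  induction hf using Submodule.span_induction with
  | zero => simp
  | add a b _ _ ha hb => rw [map_add]; exact Submodule.add_mem _ ha hb
  | smul r a _ ha => rw [map_smul]; exact Submodule.smul_mem _ r ha
  | mem f hf =>
    obtain ⟨s, rfl, rfl⟩ := hf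
    by_cases h : s.1.down + k ∈ S
    · rw [monoSq_single S k s h]
      exact Submodule.smul_mem _ _ (Finsupp.single_mem_supported F2 1 (add_comm _ _))
    · rw [monoSq_single_zero S k s h]; exact Submodule.zero_mem _

/-- The action of `A(1)` through `Sq^1` and `Sq^2`. -/
noncomputable def monoρ (S : Set ℤ) : A1 →ₐ[F2] Module.End F2 (Expo.{u} S →₀ F2) :=
  A1.lift ![monoSq S 1, monoSq S 2] (monoSq_one_one S)
    ((monoSq_two_two S).trans (monoSq_one_two_one S).symm)

theorem monoρ_gen (S : Set ℤ) (i : Fin 2) :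
    monoρ.{u} S (A1.gen i) = (![monoSq S 1, monoSq S 2] : Fin 2 → _) i :=
  A1.lift_gen _ _ _ i

/-- The `A(1)`-module with basis the `x^n`, `n ∈ S`, with `x^n` in degree `n`, and
`Sq^k x^n = (n choose k) x^(n+k)`, where `x^(n+k)` is read as `0` if `n + k` is not in `S`. -/
noncomputable def mono (S : Set ℤ) : GrMod.{u} A1 where
  carrier := Expo.{u} S →₀ F2
  gr := monoGr S
  isInternal := monoGr_isInternal S
  ρ := monoρ S
  smul_mem := smul_mem_of_gen _ _ fun i n v hv => by
    rw [monoρ_gen]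
    fin_cases i
    · exact monoSq_mem S 1 n v hv
    · exact monoSq_mem S 2 n v hv

end Monomial

section Standard

variable (B : Type) [Ring B] [Bialgebra F2 B] [GrBialg B] [SubA1 B]

/-- The module `P_0`: the submodule of the Laurent polynomials `F2[x, x⁻¹]` spanned by the `x^n`
with `n ≥ -1`. -/
noncomputable def P0 : GrMod.{u} B := restrict B (mono {n | -1 ≤ n})

/-- The module `R`: the quotient of `P_0` by the submodule `F2` spanned by `x^0`. -/
noncomputable def R : GrMod.{u} B := restrict B (mono {n | -1 ≤ n ∧ n ≠ 0})

/-- The localization functor `L_0 N = ΣR ⊗ N`. -/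
noncomputable def L0 : GrMod.{u} B ⥤ GrMod.{u} B := tensorFunctor (suspend 1 (R B))

/-- The localization functor `L_1 N = P_0 ⊗ N`. -/
noncomputable def L1 : GrMod.{u} B ⥤ GrMod.{u} B := tensorFunctor (P0 B)

/-- `M ⊗ M` is stably equivalent to `M`. -/
def StablyIdempotent {B : Type} [Ring B] [Bialgebra F2 B] [GrBialg B] (M : GrMod.{u} B) : Prop :=
  StablyIso (M.tensor M) M

/-- The Margolis homology groups `H(M, Q_0)` and `H(M, Q_1)` are finite-dimensional in each
degree. -/
def FiniteMargolis {B : Type} [Ring B] [Bialgebra F2 B] [GrBialg B] [SubA1 B]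
    (M : GrMod.{u} B) : Prop :=
  ∀ (i : Fin 2) (n : ℤ), Module.Finite F2 (MargolisH M (SubA1.Q i) n)

end Standard

end GrMod

end StMod

/-! Both `Q₀` and `Q₁` are primitive with square zero, so Margolis homology satisfies a Künneth
theorem. It vanishes on projectives (`acyc_of_projective`), hence turns stable equivalences into
isomorphisms (`qIso_of_isStableEquiv`). A stable equivalence `φ : M ⊗ M → M` therefore gives `H ⊗ H
≅ H` for each of the two homologies. As `H` is bounded below and finite in each degree, comparing
lowest degrees and dimensions leaves only `H = 0` or `H = F₂` in degree `0` (`acyc_or_oneDim`).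

Conversely, a map of bounded below modules that is an isomorphism on both homologies is a stable
equivalence (`isStableEquiv_of_qIso`). This rests on `projective_of_acyc`: the kernel of a minimal
free cover of an acyclic module is acyclic and is killed by the top class of `B`. But the top class
acts injectively on the lowest degree of an acyclic module (`detects_E1`, `detects_A1`), so the
kernel is zero. It remains to construct a map from one of the five models to `M`.

If `H(M, Q₀)` is nonzero, a generating cycle `z` of degree `0` becomes the image of `x⁻¹` under a
map `ΣR → M`. The images of the other monomials are found one period at a time: each obstruction is
a `Q₀`-cycle of positive degree, hence a boundary (`extends_E1`, `extends_A1`). If `H(M, Q₁)` is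
nonzero, one needs a class `x` of degree `0` that is annihilated by the generators of `B` and is no
`Q₁`-boundary. If `x` is no `Q₀`-boundary either, then `F₂ → M` is an equivalence. If `x = Q₀ w`,
then `x⁻¹ ↦ w` extends to `P₀ → M`, and this map is an equivalence when `H(M, Q₀) = 0`; otherwise it
is combined with `ΣR → M`.

The main difficulty is to find `x`. Over `E(1)` a zigzag between `Q₀` and `Q₁` does it; it stops
because `M` is bounded below, and it is never obstructed because both homologies vanish in negative
degrees (`exists_Q0_cycle`). Over `A(1)` the class must be killed by `Sq²` too. Here the
multiplication `φ` enters a second time: replacing a class by a corrected version of its square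
brings `Sq² x` into better and better form, until it vanishes (`exists_double_one`,
`exists_double_two`, `exists_unit_class_A1`).

The statement on functors follows since `- ⊗ N` preserves projectives (`projective_tensor`), hence
stable equivalences. -/

namespace StMod

/-! ### Homogeneous components and homogeneous linear maps -/

section Projections

variable {V W : Type*} [AddCommGroup V] [Module F2 V] [AddCommGroup W] [Module F2 W]
variable {𝒱 : ℤ → Submodule F2 V} {𝒲 : ℤ → Submodule F2 W}

/-- A linear map is homogeneous of degree `k`. -/
def Homog (𝒱 : ℤ → Submodule F2 V) (𝒲 : ℤ → Submodule F2 W) (k : ℤ) (f : V →ₗ[F2] W) : Prop :=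
  ∀ n, ∀ x ∈ 𝒱 n, f x ∈ 𝒲 (k + n)

theorem gr_induction (h : DirectSum.IsInternal 𝒱) {p : V → Prop} (h0 : p 0)
    (hadd : ∀ x y, p x → p y → p (x + y)) (hmem : ∀ n, ∀ x ∈ 𝒱 n, p x) (x : V) : p x := by
  induction mem_iSup_of_isInternal h x using Submodule.iSup_induction' with
  | zero => exact h0
  | add a b _ _ ha hb => exact hadd a b ha hb
  | mem i x hx => exact hmem i x hx

/-- The decomposition of a vector into its homogeneous components. -/
noncomputable def decomp (h : DirectSum.IsInternal 𝒱) : V →ₗ[F2] (ℤ →₀ V) :=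
  (exists_finsupp_of_isInternal h).choose

theorem decomp_of_mem (h : DirectSum.IsInternal 𝒱) {n : ℤ} {x : V} (hx : x ∈ 𝒱 n) :
    decomp h x = Finsupp.single n x :=
  (exists_finsupp_of_isInternal h).choose_spec n x hx

/-- The projection onto the homogeneous component of degree `n`. -/
noncomputable def pr (h : DirectSum.IsInternal 𝒱) (n : ℤ) : V →ₗ[F2] V :=
  (Finsupp.lapply n).comp (decomp h)

theorem pr_of_mem (h : DirectSum.IsInternal 𝒱) {n : ℤ} {x : V} (hx : x ∈ 𝒱 n) :
    pr h n x = x := by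
  simp [pr, decomp_of_mem h hx]

theorem pr_of_ne (h : DirectSum.IsInternal 𝒱) {m n : ℤ} {x : V} (hx : x ∈ 𝒱 m) (hmn : m ≠ n) :
    pr h n x = 0 := by
  simp [pr, decomp_of_mem h hx, hmn]

theorem pr_mem (h : DirectSum.IsInternal 𝒱) (n : ℤ) (x : V) : pr h n x ∈ 𝒱 n := by
  refine gr_induction h (p := fun x => pr h n x ∈ 𝒱 n) (by simp) (fun x y hx hy => ?_)
    (fun m x hx => ?_) x
  · rw [map_add]; exact Submodule.add_mem _ hx hy
  · by_cases hmn : m = n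
    · subst hmn; rwa [pr_of_mem h hx]
    · rw [pr_of_ne h hx hmn]; exact Submodule.zero_mem _

theorem decomp_sum (h : DirectSum.IsInternal 𝒱) (x : V) :
    Finsupp.lsum F2 (fun _ : ℤ => (LinearMap.id : V →ₗ[F2] V)) (decomp h x) = x := by
  refine gr_induction h (p := fun x => Finsupp.lsum F2
    (fun _ : ℤ => (LinearMap.id : V →ₗ[F2] V)) (decomp h x) = x) (by simp)
    (fun x y hx hy => by rw [map_add, map_add, hx, hy]) (fun m x hx => ?_) x
  simp [decomp_of_mem h hx]

theorem sum_pr (h : DirectSum.IsInternal 𝒱) (x : V) :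
    ∑ n ∈ (decomp h x).support, pr h n x = x := by
  conv_rhs => rw [← decomp_sum h x]
  rfl

theorem ext_pr (h : DirectSum.IsInternal 𝒱) {x y : V} (hxy : ∀ n, pr h n x = pr h n y) :
    x = y := by
  rw [← decomp_sum h x, ← decomp_sum h y]
  congr 1
  exact Finsupp.ext hxy

theorem eq_zero_of_mem_of_mem (h : DirectSum.IsInternal 𝒱) {m n : ℤ} {x : V} (hm : x ∈ 𝒱 m)
    (hn : x ∈ 𝒱 n) (hmn : m ≠ n) : x = 0 := by
  rw [← pr_of_mem h hn, pr_of_ne h hm hmn]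

theorem pr_homog (hV : DirectSum.IsInternal 𝒱) (hW : DirectSum.IsInternal 𝒲) {k : ℤ}
    {f : V →ₗ[F2] W} (hf : Homog 𝒱 𝒲 k f) (n : ℤ) (x : V) :
    pr hW (k + n) (f x) = f (pr hV n x) := by
  refine gr_induction hV (p := fun x => pr hW (k + n) (f x) = f (pr hV n x)) (by simp)
    (fun x y hx hy => by simp [hx, hy]) (fun m x hx => ?_) x
  by_cases hmn : m = n
  · subst hmn; rw [pr_of_mem hV hx, pr_of_mem hW (hf _ x hx)]
  · rw [pr_of_ne hV hx hmn, pr_of_ne hW (hf _ x hx) (by omega), map_zero]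

theorem Homog.exists_preimage (hV : DirectSum.IsInternal 𝒱) (hW : DirectSum.IsInternal 𝒲) {k : ℤ}
    {f : V →ₗ[F2] W} (hf : Homog 𝒱 𝒲 k f) {n : ℤ} {w : W} (hw : w ∈ 𝒲 n)
    (hr : w ∈ LinearMap.range f) (m : ℤ) (hm : k + m = n) : ∃ v ∈ 𝒱 m, f v = w := by
  obtain ⟨v, rfl⟩ := hr
  refine ⟨pr hV m v, pr_mem hV _ _, ?_⟩
  subst hm
  rw [← pr_homog hV hW hf, pr_of_mem hW hw]

/-- The component of degree `k` of a linear map. -/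
noncomputable def degPart (hV : DirectSum.IsInternal 𝒱) (hW : DirectSum.IsInternal 𝒲) (k : ℤ)
    (f : V →ₗ[F2] W) : V →ₗ[F2] W :=
  (Finsupp.lsum F2 fun n : ℤ => (pr hW (k + n)).comp f).comp (decomp hV)

theorem degPart_of_mem (hV : DirectSum.IsInternal 𝒱) (hW : DirectSum.IsInternal 𝒲) (k : ℤ)
    (f : V →ₗ[F2] W) {n : ℤ} {x : V} (hx : x ∈ 𝒱 n) :
    degPart hV hW k f x = pr hW (k + n) (f x) := by
  simp [degPart, decomp_of_mem hV hx]

theorem degPart_homog (hV : DirectSum.IsInternal 𝒱) (hW : DirectSum.IsInternal 𝒲) (k : ℤ)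
    (f : V →ₗ[F2] W) : Homog 𝒱 𝒲 k (degPart hV hW k f) := fun n x hx => by
  rw [degPart_of_mem hV hW k f hx]; exact pr_mem hW _ _

theorem eq_of_homog {f g : V →ₗ[F2] W} (hV : DirectSum.IsInternal 𝒱)
    (h : ∀ n, ∀ x ∈ 𝒱 n, f x = g x) : f = g :=
  LinearMap.ext (gr_induction hV (by simp) (fun x y hx hy => by simp [hx, hy]) h)

/-- A homogeneous surjection has a homogeneous section. -/
theorem Homog.exists_section (hV : DirectSum.IsInternal 𝒱) (hW : DirectSum.IsInternal 𝒲)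
    {f : V →ₗ[F2] W} (hf : Homog 𝒱 𝒲 0 f) (hs : Function.Surjective f) :
    ∃ s : W →ₗ[F2] V, Homog 𝒲 𝒱 0 s ∧ ∀ w, f (s w) = w := by
  obtain ⟨s, hs⟩ := f.exists_rightInverse_of_surjective (LinearMap.range_eq_top.2 hs)
  -- An arbitrary linear section exists; since `f` has degree `0`, the degree `0` part of that
  -- section is still a section.
  refine ⟨degPart hW hV 0 s, degPart_homog hW hV 0 s, fun w => ?_⟩
  have : f.comp (degPart hW hV 0 s) = LinearMap.id := eq_of_homog hW fun n x hx => by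
    have h : f (s x) = x := LinearMap.congr_fun hs x
    rw [LinearMap.comp_apply, degPart_of_mem hW hV 0 s hx, ← pr_homog hV hW hf, h,
      LinearMap.id_apply, pr_of_mem hW (by simpa using hx)]
  exact LinearMap.congr_fun this w

/-- A homogeneous differential has a homogeneous generalized inverse. -/
theorem Homog.exists_genInverse (hV : DirectSum.IsInternal 𝒱) {k : ℤ}
    {d : V →ₗ[F2] V} (hd : Homog 𝒱 𝒱 k d) :
    ∃ g : V →ₗ[F2] V, Homog 𝒱 𝒱 (-k) g ∧ ∀ v, d (g (d v)) = d v := by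
  -- The generalized inverse is a projection onto the range of `d` followed by a section of `d`.
  -- Passing to its component of degree `-k` keeps the identity `d g d = d`, because `d` is
  -- homogeneous.
  obtain ⟨s, hs⟩ := d.rangeRestrict.exists_rightInverse_of_surjective
    (LinearMap.range_eq_top.2 d.surjective_rangeRestrict)
  obtain ⟨p, hp⟩ := (LinearMap.range d).subtype.exists_leftInverse_of_injective
    (Submodule.ker_subtype _)
  have hg : ∀ v, d ((s.comp p) (d v)) = d v := fun v => by
    have h1 : p (d v) = ⟨d v, v, rfl⟩ := LinearMap.congr_fun hp ⟨d v, v, rfl⟩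
    have h2 := LinearMap.congr_fun hs ⟨d v, v, rfl⟩
    rw [LinearMap.comp_apply, h1]
    exact congrArg Subtype.val h2
  refine ⟨degPart hV hV (-k) (s.comp p), degPart_homog hV hV _ _, fun v => ?_⟩
  have : d.comp ((degPart hV hV (-k) (s.comp p)).comp d) = d := eq_of_homog hV fun n x hx => by
    rw [LinearMap.comp_apply, LinearMap.comp_apply, degPart_of_mem hV hV _ _ (hd n x hx),
      ← pr_homog hV hV hd, hg, pr_of_mem hV (by simpa using hd n x hx)]
  exact LinearMap.congr_fun this v

/-- A variant of `isInternal_of_finsupp` that asks for one projection per degree, with no finiteness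
condition. It suits subspaces and quotients, to which projections restrict or descend. -/
theorem isInternal_of_projections (𝒱 : ℤ → Submodule F2 V) (hsup : ∀ x : V, x ∈ ⨆ n, 𝒱 n)
    (p : ℤ → V →ₗ[F2] V) (hp : ∀ n, ∀ x ∈ 𝒱 n, p n x = x)
    (hp' : ∀ m n, m ≠ n → ∀ x ∈ 𝒱 m, p n x = 0) : DirectSum.IsInternal 𝒱 := by
  classical
  refine DirectSum.isInternal_submodule_of_iSupIndep_of_iSup_eq_top ?_
    (eq_top_iff.2 fun x _ => hsup x)
  rw [iSupIndep_def]
  intro n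
  rw [Submodule.disjoint_def]
  intro x hx hx'
  have h2 : (⨆ j, ⨆ (_ : j ≠ n), 𝒱 j) ≤ LinearMap.ker (p n) :=
    iSup_le fun j => iSup_le fun hj y hy => hp' j n hj y hy
  rw [← hp n x hx]
  exact h2 hx'

theorem mem_iSup_pr (h : DirectSum.IsInternal 𝒱) {S : Submodule F2 V}
    (hS : ∀ x ∈ S, ∀ n, pr h n x ∈ S) (x : S) : x ∈ ⨆ n, (𝒱 n).comap S.subtype := by
  have : x = ∑ n ∈ (decomp h x.1).support, (⟨pr h n x.1, hS x.1 x.2 n⟩ : S) := by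
    apply Subtype.ext
    rw [AddSubmonoidClass.coe_finsetSum]
    exact (sum_pr h x.1).symm
  rw [this]
  exact Submodule.sum_mem _ fun n _ => Submodule.mem_iSup_of_mem n (pr_mem h n x.1)

theorem sub_isInternal (h : DirectSum.IsInternal 𝒱) {S : Submodule F2 V}
    (hS : ∀ x ∈ S, ∀ n, pr h n x ∈ S) :
    DirectSum.IsInternal fun n => (𝒱 n).comap S.subtype :=
  isInternal_of_projections _ (mem_iSup_pr h hS)
    (fun n => (pr h n).restrict fun x hx => hS x hx n)
    (fun _ _ hx => Subtype.ext (pr_of_mem h hx))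
    (fun _ _ hmn _ hx => Subtype.ext (pr_of_ne h hx hmn))

theorem quot_isInternal (h : DirectSum.IsInternal 𝒱) {S : Submodule F2 V}
    (hS : ∀ x ∈ S, ∀ n, pr h n x ∈ S) :
    DirectSum.IsInternal fun n => (𝒱 n).map S.mkQ := by
  refine isInternal_of_projections _ (fun x => ?_)
    (fun n => S.mapQ S (pr h n) fun x hx => hS x hx n) ?_ ?_
  · obtain ⟨x, rfl⟩ := S.mkQ_surjective x
    refine gr_induction h (p := fun x => S.mkQ x ∈ ⨆ n, (𝒱 n).map S.mkQ) (by simp)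
      (fun x y hx hy => by rw [map_add]; exact Submodule.add_mem _ hx hy) (fun n x hx => ?_) x
    exact Submodule.mem_iSup_of_mem n (Submodule.mem_map_of_mem hx)
  · rintro n _ ⟨x, hx, rfl⟩
    simp [pr_of_mem h hx]
  · rintro m n hmn _ ⟨x, hx, rfl⟩
    simp [pr_of_ne h hx hmn]

theorem range_pr_mem (hV : DirectSum.IsInternal 𝒱) (hW : DirectSum.IsInternal 𝒲) {k : ℤ}
    {f : V →ₗ[F2] W} (hf : Homog 𝒱 𝒲 k f) (x : W) (hx : x ∈ LinearMap.range f) (n : ℤ) :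
    pr hW n x ∈ LinearMap.range f := by
  obtain ⟨v, rfl⟩ := hx
  refine ⟨pr hV (n - k) v, ?_⟩
  rw [← pr_homog hV hW hf, add_sub_cancel]

theorem ker_pr_mem (hV : DirectSum.IsInternal 𝒱) (hW : DirectSum.IsInternal 𝒲) {k : ℤ}
    {f : V →ₗ[F2] W} (hf : Homog 𝒱 𝒲 k f) (x : V) (hx : x ∈ LinearMap.ker f) (n : ℤ) :
    pr hV n x ∈ LinearMap.ker f := by
  rw [LinearMap.mem_ker] at hx ⊢
  rw [← pr_homog hV hW hf, hx, map_zero]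

end Projections

namespace GrMod

/-! ### Submodules, quotients and projectives in the category of graded modules -/

section Basic

variable {B : Type} [Ring B] [Bialgebra F2 B] [GrBialg B]

theorem lin_mem {M N : GrMod.{u} B} (f : M ⟶ N) {n : ℤ} {v : M.carrier} (hv : v ∈ M.gr n) :
    lin f v ∈ N.gr n := Hom.map_mem f n v hv

theorem lin_ρ {M N : GrMod.{u} B} (f : M ⟶ N) (b : B) (v : M.carrier) :
    lin f (M.ρ b v) = N.ρ b (lin f v) := Hom.map_smul f b v

theorem homog_lin {M N : GrMod.{u} B} (f : M ⟶ N) : Homog M.gr N.gr 0 (lin f) :=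
  fun n x hx => by rw [zero_add]; exact lin_mem f hx

theorem homog_ρ (M : GrMod.{u} B) {k : ℤ} {b : B} (hb : b ∈ GrBialg.deg k) :
    Homog M.gr M.gr k (M.ρ b) := M.smul_mem k b hb

theorem lin_comp_apply {M N K : GrMod.{u} B} (f : M ⟶ N) (g : N ⟶ K) (v : M.carrier) :
    lin (f ≫ g) v = lin g (lin f v) := rfl

theorem ρ_mul (M : GrMod.{u} B) (b c : B) (v : M.carrier) :
    M.ρ (b * c) v = M.ρ b (M.ρ c v) := by
  rw [map_mul]; rfl

/-- The morphism with a given underlying linear map. -/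
def mkHom {M N : GrMod.{u} B} (f : M.carrier →ₗ[F2] N.carrier) (hf : Homog M.gr N.gr 0 f)
    (h : ∀ b v, f (M.ρ b v) = N.ρ b (f v)) : M ⟶ N :=
  { lin := f, map_mem := fun n v hv => by simpa using hf n v hv, map_smul := h }

/-- The zero morphism. -/
def zeroHom (M N : GrMod.{u} B) : M ⟶ N :=
  mkHom 0 (fun _ _ _ => Submodule.zero_mem _) (fun b v => by simp)

/-- The graded submodule on a subspace that is stable under `B` and under projections. -/
noncomputable def sub (M : GrMod.{u} B) (S : Submodule F2 M.carrier)
    (hS : ∀ b, ∀ x ∈ S, M.ρ b x ∈ S) (hg : ∀ x ∈ S, ∀ n, pr M.isInternal n x ∈ S) :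
    GrMod.{u} B where
  carrier := S
  gr n := (M.gr n).comap S.subtype
  isInternal := sub_isInternal M.isInternal hg
  ρ := AlgHom.ofLinearMap
    (LinearMap.mk ⟨fun b => (M.ρ b).restrict (hS b), fun a b => by ext; simp⟩
      (fun r b => by ext; simp))
    (by ext; simp) (fun a b => by
      ext x
      change (M.ρ (a * b)) x.1 = M.ρ a (M.ρ b x.1)
      exact ρ_mul M a b x.1)
  smul_mem m b hb n v hv := M.smul_mem m b hb n v.1 hv

/-- The inclusion of a graded submodule. -/
noncomputable def subι (M : GrMod.{u} B) (S : Submodule F2 M.carrier)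
    (hS : ∀ b, ∀ x ∈ S, M.ρ b x ∈ S) (hg : ∀ x ∈ S, ∀ n, pr M.isInternal n x ∈ S) :
    M.sub S hS hg ⟶ M :=
  mkHom S.subtype (fun n x hx => by rw [zero_add]; exact hx) (fun _ _ => rfl)

/-- The quotient by a subspace that is stable under `B` and under projections. -/
noncomputable def quot (M : GrMod.{u} B) (S : Submodule F2 M.carrier)
    (hS : ∀ b, ∀ x ∈ S, M.ρ b x ∈ S) (hg : ∀ x ∈ S, ∀ n, pr M.isInternal n x ∈ S) :
    GrMod.{u} B where
  carrier := M.carrier ⧸ S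
  gr n := (M.gr n).map S.mkQ
  isInternal := quot_isInternal M.isInternal hg
  ρ := AlgHom.ofLinearMap
    (LinearMap.mk ⟨fun b => S.mapQ S (M.ρ b) (hS b), fun a b => by
        apply Submodule.linearMap_qext; ext; simp⟩
      (fun r b => by apply Submodule.linearMap_qext; ext; simp))
    (by apply Submodule.linearMap_qext; ext; simp) (fun a b => by
      apply Submodule.linearMap_qext
      ext x
      change S.mkQ (M.ρ (a * b) x) = S.mkQ (M.ρ a (M.ρ b x))
      rw [ρ_mul])
  smul_mem m b hb n v hv := by
    obtain ⟨x, hx, rfl⟩ := hv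
    exact ⟨M.ρ b x, M.smul_mem m b hb n x hx, rfl⟩

/-- The projection onto a quotient. -/
noncomputable def quotπ (M : GrMod.{u} B) (S : Submodule F2 M.carrier)
    (hS : ∀ b, ∀ x ∈ S, M.ρ b x ∈ S) (hg : ∀ x ∈ S, ∀ n, pr M.isInternal n x ∈ S) :
    M ⟶ M.quot S hS hg :=
  mkHom S.mkQ (fun n x hx => by rw [zero_add]; exact ⟨x, hx, rfl⟩) (fun _ _ => rfl)

theorem range_lin_stable {M N : GrMod.{u} B} (f : M ⟶ N) (b : B) :
    ∀ x ∈ LinearMap.range (lin f), N.ρ b x ∈ LinearMap.range (lin f) := by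
  rintro _ ⟨x, rfl⟩
  exact ⟨M.ρ b x, lin_ρ f b x⟩

theorem ker_lin_stable {M N : GrMod.{u} B} (f : M ⟶ N) (b : B) :
    ∀ x ∈ LinearMap.ker (lin f), M.ρ b x ∈ LinearMap.ker (lin f) := by
  intro x hx
  rw [LinearMap.mem_ker] at hx ⊢
  rw [lin_ρ, hx, map_zero]

/-- The cokernel of a morphism. -/
noncomputable def coker {M N : GrMod.{u} B} (f : M ⟶ N) : GrMod.{u} B :=
  N.quot (LinearMap.range (lin f)) (range_lin_stable f)
    (range_pr_mem M.isInternal N.isInternal (homog_lin f))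

/-- The projection onto the cokernel. -/
noncomputable def cokerπ {M N : GrMod.{u} B} (f : M ⟶ N) : N ⟶ coker f := N.quotπ _ _ _

theorem cokerπ_surjective {M N : GrMod.{u} B} (f : M ⟶ N) :
    Function.Surjective (lin (cokerπ f)) := Submodule.mkQ_surjective _

theorem cokerπ_eq_zero {M N : GrMod.{u} B} (f : M ⟶ N) (x : N.carrier) :
    lin (cokerπ f) x = 0 ↔ x ∈ LinearMap.range (lin f) :=
  Submodule.Quotient.mk_eq_zero _

/-- The kernel of a morphism. -/
noncomputable def kern {M N : GrMod.{u} B} (f : M ⟶ N) : GrMod.{u} B :=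
  M.sub (LinearMap.ker (lin f)) (ker_lin_stable f)
    (ker_pr_mem M.isInternal N.isInternal (homog_lin f))

/-- The inclusion of the kernel. -/
noncomputable def kernι {M N : GrMod.{u} B} (f : M ⟶ N) : kern f ⟶ M := M.subι _ _ _

theorem kernι_injective {M N : GrMod.{u} B} (f : M ⟶ N) :
    Function.Injective (lin (kernι f)) := Subtype.val_injective

theorem mem_range_kernι {M N : GrMod.{u} B} (f : M ⟶ N) (x : M.carrier) (hx : lin f x = 0) :
    ∃ k, lin (kernι f) k = x := ⟨⟨x, hx⟩, rfl⟩

theorem kernι_lin {M N : GrMod.{u} B} (f : M ⟶ N) (k : (kern f).carrier) :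
    lin f (lin (kernι f) k) = 0 := k.2

/-- The projection to the cokernel and the zero map agree after composition with `f`, so they are
equal and the cokernel is zero. -/
theorem surjective_of_epi {M N : GrMod.{u} B} (f : M ⟶ N) [Epi f] :
    Function.Surjective (lin f) := by
  have h : f ≫ cokerπ f = f ≫ zeroHom N _ := by
    apply hom_ext
    ext x
    exact (cokerπ_eq_zero f _).2 ⟨x, rfl⟩
  rw [cancel_epi] at h
  intro y
  have := congrArg (fun g => lin g y) h
  exact (cokerπ_eq_zero f y).1 this

theorem epi_of_surjective {M N : GrMod.{u} B} (f : M ⟶ N) (hf : Function.Surjective (lin f)) :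
    Epi f where
  left_cancellation g h e := by
    apply hom_ext
    ext y
    obtain ⟨x, rfl⟩ := hf y
    exact congrArg (fun g => lin g x) e

/-- Epimorphisms are exactly the surjections, so the categorical lifting property can be tested on
elements. -/
theorem projective_iff {P : GrMod.{u} B} : Projective P ↔
    ∀ (X Y : GrMod.{u} B) (f : P ⟶ Y) (e : X ⟶ Y), Function.Surjective (lin e) →
      ∃ g : P ⟶ X, g ≫ e = f :=
  ⟨fun h X Y f e he => by
    have := epi_of_surjective e he
    exact ⟨Projective.factorThru f e, Projective.factorThru_comp f e⟩,
  fun h => ⟨fun f e _ => h _ _ f e (surjective_of_epi e)⟩⟩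

theorem projective_of_retract {P Q : GrMod.{u} B} [Projective Q] (i : P ⟶ Q) (r : Q ⟶ P)
    (h : i ≫ r = 𝟙 P) : Projective P :=
  ⟨fun f e _ => ⟨i ≫ Projective.factorThru (r ≫ f) e, by
    rw [Category.assoc, Projective.factorThru_comp, ← Category.assoc, h, Category.id_comp]⟩⟩

/-- The inverse of a bijective morphism. -/
noncomputable def homInv {M N : GrMod.{u} B} (f : M ⟶ N) (hf : Function.Bijective (lin f)) :
    N ⟶ M :=
  mkHom (LinearEquiv.ofBijective (lin f) hf).symm.toLinearMap (fun n x hx => by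
      obtain ⟨v, hv, rfl⟩ := (homog_lin f).exists_preimage M.isInternal N.isInternal hx
        (LinearMap.range_eq_top.2 hf.2 ▸ Submodule.mem_top) n (zero_add n)
      rw [zero_add]
      convert hv
      exact (LinearEquiv.ofBijective (lin f) hf).symm_apply_apply v)
    (fun b v => by
      obtain ⟨v, rfl⟩ := hf.2 v
      have h := (LinearEquiv.ofBijective (lin f) hf).symm_apply_apply
      simp only [LinearEquiv.ofBijective_apply] at h
      rw [← lin_ρ]
      simp only [LinearEquiv.coe_coe, h])

theorem homInv_comp {M N : GrMod.{u} B} (f : M ⟶ N) (hf : Function.Bijective (lin f)) :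
    homInv f hf ≫ f = 𝟙 N :=
  hom_ext (LinearMap.ext fun v => (LinearEquiv.ofBijective (lin f) hf).apply_symm_apply v)

theorem comp_homInv {M N : GrMod.{u} B} (f : M ⟶ N) (hf : Function.Bijective (lin f)) :
    f ≫ homInv f hf = 𝟙 M :=
  hom_ext (LinearMap.ext fun v => (LinearEquiv.ofBijective (lin f) hf).symm_apply_apply v)

end Basic

end GrMod

end StMod

namespace StMod

namespace GrMod

/-! ### Tensor products of graded modules -/

section Tensor

variable {B : Type} [Ring B] [Bialgebra F2 B] [GrBialg B]

/-- The element `x ⊗ y` of `M ⊗ N`. -/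
noncomputable def tm {M N : GrMod.{u} B} (x : M.carrier) (y : N.carrier) :
    (M.tensor N).carrier := x ⊗ₜ[F2] y

variable {M M' N N' : GrMod.{u} B}

theorem tm_add (x : M.carrier) (y y' : N.carrier) : tm x (y + y') = tm x y + tm x y' :=
  TensorProduct.tmul_add x y y'

theorem add_tm (x x' : M.carrier) (y : N.carrier) : tm (x + x') y = tm x y + tm x' y :=
  TensorProduct.add_tmul x x' y

theorem tm_zero (x : M.carrier) : tm x (0 : N.carrier) = 0 := TensorProduct.tmul_zero _ x

theorem zero_tm (y : N.carrier) : tm (0 : M.carrier) y = 0 := TensorProduct.zero_tmul _ y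

theorem tm_mem {i j n : ℤ} {x : M.carrier} {y : N.carrier} (hx : x ∈ M.gr i) (hy : y ∈ N.gr j)
    (h : i + j = n) : tm x y ∈ (M.tensor N).gr n := tmul_mem_tensorGr hx hy h

theorem tensor_induction {p : (M.tensor N).carrier → Prop} (h0 : p 0)
    (hadd : ∀ x y, p x → p y → p (x + y)) (ht : ∀ x y, p (tm x y)) (z : (M.tensor N).carrier) :
    p z :=
  TensorProduct.induction_on z h0 ht hadd

theorem tensor_lin_ext {W : Type*} [AddCommGroup W] [Module F2 W]
    {f g : (M.tensor N).carrier →ₗ[F2] W} (h : ∀ x y, f (tm x y) = g (tm x y)) : f = g :=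
  TensorProduct.ext' h

/-- The linear map on `M ⊗ N` given by a bilinear map. -/
noncomputable def tlift {W : Type*} [AddCommGroup W] [Module F2 W]
    (f : M.carrier →ₗ[F2] N.carrier →ₗ[F2] W) : (M.tensor N).carrier →ₗ[F2] W :=
  TensorProduct.lift f

theorem tlift_tm {W : Type*} [AddCommGroup W] [Module F2 W]
    (f : M.carrier →ₗ[F2] N.carrier →ₗ[F2] W) (x : M.carrier) (y : N.carrier) :
    tlift f (tm x y) = f x y := TensorProduct.lift.tmul x y

/-- The tensor product of two linear maps. -/
noncomputable def tmap (f : M.carrier →ₗ[F2] M'.carrier) (g : N.carrier →ₗ[F2] N'.carrier) :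
    (M.tensor N).carrier →ₗ[F2] (M'.tensor N').carrier := TensorProduct.map f g

theorem tmap_tm (f : M.carrier →ₗ[F2] M'.carrier) (g : N.carrier →ₗ[F2] N'.carrier)
    (x : M.carrier) (y : N.carrier) : tmap f g (tm x y) = tm (f x) (g y) := rfl

theorem tensor_gr_le {n : ℤ} {S : Submodule F2 (M.tensor N).carrier}
    (h : ∀ i j, ∀ x ∈ M.gr i, ∀ y ∈ N.gr j, i + j = n → tm x y ∈ S) :
    (M.tensor N).gr n ≤ S :=
  Submodule.span_le.2 fun _ ⟨i, j, x, y, hx, hy, hij, ht⟩ => ht ▸ h i j x hx y hy hij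

/-- The action of `B ⊗ B` on `M ⊗ N`. -/
noncomputable def tact (M N : GrMod.{u} B) :
    B ⊗[F2] B →ₐ[F2] Module.End F2 (M.tensor N).carrier :=
  (Module.endTensorEndAlgHom (R := F2) (S := F2) (A := F2) (M := M.carrier)
    (N := N.carrier)).comp (Algebra.TensorProduct.map M.ρ N.ρ)

theorem tact_tmul (b c : B) (x : M.carrier) (y : N.carrier) :
    tact M N (b ⊗ₜ c) (tm x y) = tm (M.ρ b x) (N.ρ c y) := rfl

theorem tensor_ρ (b : B) : (M.tensor N).ρ b = tact M N (Coalgebra.comul (R := F2) b) := rfl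

theorem homog_tmap {f : M.carrier →ₗ[F2] M'.carrier} {g : N.carrier →ₗ[F2] N'.carrier} {k l : ℤ}
    (hf : Homog M.gr M'.gr k f) (hg : Homog N.gr N'.gr l g) :
    Homog (M.tensor N).gr (M'.tensor N').gr (k + l) (tmap f g) := fun n =>
  tensor_gr_le (S := ((M'.tensor N').gr (k + l + n)).comap (tmap f g)) fun i j x hx y hy h =>
    tm_mem (hf i x hx) (hg j y hy) (by rw [← h]; ring)

theorem tact_natural (f : M.carrier →ₗ[F2] M'.carrier) (g : N.carrier →ₗ[F2] N'.carrier)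
    (hf : ∀ b v, f (M.ρ b v) = M'.ρ b (f v)) (hg : ∀ b v, g (N.ρ b v) = N'.ρ b (g v))
    (X : B ⊗[F2] B) (t : (M.tensor N).carrier) :
    tmap f g (tact M N X t) = tact M' N' X (tmap f g t) := by
  induction X using TensorProduct.induction_on with
  | zero => simp
  | add x y hx hy => simp only [map_add, LinearMap.add_apply, hx, hy]
  | tmul b c =>
    have : (tmap f g).comp (tact M N (b ⊗ₜ c)) = (tact M' N' (b ⊗ₜ c)).comp (tmap f g) :=
      tensor_lin_ext fun x y => by
        simp only [LinearMap.comp_apply, tact_tmul, tmap_tm, hf, hg]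
    exact LinearMap.congr_fun this t

/-- The tensor product of two morphisms. -/
noncomputable def tensorHom (f : M ⟶ M') (g : N ⟶ N') : M.tensor N ⟶ M'.tensor N' :=
  mkHom (tmap (lin f) (lin g)) (homog_tmap (k := 0) (l := 0) (homog_lin f) (homog_lin g))
    (fun _ t => tact_natural _ _ (lin_ρ f) (lin_ρ g) _ t)

theorem tensorHom_tm (f : M ⟶ M') (g : N ⟶ N') (x : M.carrier) (y : N.carrier) :
    lin (tensorHom f g) (tm x y) = tm (lin f x) (lin g y) := rfl

theorem tensorHom_comp {M'' N'' : GrMod.{u} B} (f : M ⟶ M') (g : N ⟶ N') (f' : M' ⟶ M'')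
    (g' : N' ⟶ N'') : tensorHom f g ≫ tensorHom f' g' = tensorHom (f ≫ f') (g ≫ g') :=
  hom_ext (tensor_lin_ext fun _ _ => rfl)

theorem tensorHom_id : tensorHom (𝟙 M) (𝟙 N) = 𝟙 (M.tensor N) :=
  hom_ext (tensor_lin_ext fun _ _ => rfl)

theorem tensor_ρ_of_primitive {b : B} (hb : Coalgebra.comul (R := F2) b = b ⊗ₜ 1 + 1 ⊗ₜ b)
    (x : M.carrier) (y : N.carrier) :
    (M.tensor N).ρ b (tm x y) = tm (M.ρ b x) y + tm x (N.ρ b y) := by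
  rw [tensor_ρ, hb, map_add, LinearMap.add_apply, tact_tmul, tact_tmul, map_one, map_one]
  rfl

theorem ρ_mem (M : GrMod.{u} B) {m n k : ℤ} {b : B} (hb : b ∈ GrBialg.deg m) {v : M.carrier}
    (hv : v ∈ M.gr n) (h : m + n = k) : M.ρ b v ∈ M.gr k := h ▸ M.smul_mem m b hb n v hv

end Tensor

/-! ### Acyclic modules, homology isomorphisms and lower bounds -/

section Acyclic

variable {B : Type} [Ring B] [Bialgebra F2 B] [GrBialg B]

/-- The homology of `M` with respect to `q` vanishes. -/
def Acyc (M : GrMod.{u} B) (q : B) : Prop := ∀ v, M.ρ q v = 0 → ∃ u, M.ρ q u = v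

/-- `f` induces an isomorphism in homology with respect to `q`. -/
structure QIso {M N : GrMod.{u} B} (f : M ⟶ N) (q : B) : Prop where
  inj : ∀ v, M.ρ q v = 0 → (∃ w, N.ρ q w = lin f v) → ∃ u, M.ρ q u = v
  surj : ∀ w, N.ρ q w = 0 → ∃ v w', M.ρ q v = 0 ∧ w = lin f v + N.ρ q w'

theorem acyc_of_homotopy {M : GrMod.{u} B} {q : B} (h : M.carrier →ₗ[F2] M.carrier)
    (hh : ∀ v, M.ρ q (h v) + h (M.ρ q v) = v) : M.Acyc q := fun v hv =>
  ⟨h v, by simpa [hv] using hh v⟩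

theorem acyc_of_retract {M N : GrMod.{u} B} {q : B} (hN : N.Acyc q) (i : M ⟶ N) (r : N ⟶ M)
    (h : i ≫ r = 𝟙 M) : M.Acyc q := fun v hv => by
  obtain ⟨u, hu⟩ := hN (lin i v) (by rw [← lin_ρ, hv, map_zero])
  exact ⟨lin r u, by rw [← lin_ρ, hu, ← lin_comp_apply, h]; rfl⟩

/-- This is the relevant piece of the long exact homology sequence, as a chase: a cycle of the
kernel bounds some `x` in `F`, and `x` is corrected by `q y` so that it lies in the kernel. The
correction is invisible to `q` because `q² = 0`. -/
theorem acyc_kern {F M : GrMod.{u} B} {q : B} (hq : q * q = 0) (f : F ⟶ M)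
    (hf : Function.Surjective (lin f)) (hF : F.Acyc q) (hM : M.Acyc q) : (kern f).Acyc q := by
  intro k hk
  obtain ⟨x, hx⟩ := hF (lin (kernι f) k) (by rw [← lin_ρ, hk, map_zero])
  obtain ⟨m, hm⟩ := hM (lin f x) (by rw [← lin_ρ, hx, kernι_lin])
  obtain ⟨y, rfl⟩ := hf m
  obtain ⟨k', hk'⟩ := mem_range_kernι f (x - F.ρ q y) (by rw [map_sub, lin_ρ, hm, sub_self])
  refine ⟨k', kernι_injective f ?_⟩
  rw [lin_ρ, hk', map_sub, hx, ← ρ_mul, hq]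
  simp

theorem boundedBelow_kern {F M : GrMod.{u} B} (f : F ⟶ M) (hF : F.BoundedBelow) :
    (kern f).BoundedBelow := by
  obtain ⟨N, hN⟩ := hF
  refine ⟨N, fun n hn => (Submodule.eq_bot_iff _).2 fun x hx => kernι_injective f ?_⟩
  rw [map_zero]
  exact (Submodule.mem_bot F2).1 (hN n hn ▸ lin_mem (kernι f) hx)

theorem boundedBelow_of_surjective {M N : GrMod.{u} B} (f : M ⟶ N)
    (hf : Function.Surjective (lin f)) (hM : M.BoundedBelow) : N.BoundedBelow := by
  obtain ⟨b, hb⟩ := hM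
  refine ⟨b, fun n hn => (Submodule.eq_bot_iff _).2 fun x hx => ?_⟩
  obtain ⟨v, hv, rfl⟩ := (homog_lin f).exists_preimage M.isInternal N.isInternal hx
    (LinearMap.range_eq_top.2 hf ▸ Submodule.mem_top) n (zero_add n)
  rw [hb n hn, Submodule.mem_bot] at hv
  rw [hv, map_zero]

theorem boundedBelow_tensor {M N : GrMod.{u} B} (hM : M.BoundedBelow) (hN : N.BoundedBelow) :
    (M.tensor N).BoundedBelow := by
  obtain ⟨a, ha⟩ := hM
  obtain ⟨b, hb⟩ := hN
  refine ⟨a + b, fun n hn => eq_bot_iff.2 (tensor_gr_le fun i j x hx y hy h => ?_)⟩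
  rw [Submodule.mem_bot]
  rcases lt_or_ge i a with hi | hi
  · rw [ha i hi, Submodule.mem_bot] at hx
    rw [hx, zero_tm]
  · rw [hb j (by omega), Submodule.mem_bot] at hy
    rw [hy, tm_zero]

theorem boundedBelow_directSum {M N : GrMod.{u} B} (hM : M.BoundedBelow) (hN : N.BoundedBelow) :
    (M.directSum N).BoundedBelow := by
  obtain ⟨a, ha⟩ := hM
  obtain ⟨b, hb⟩ := hN
  refine ⟨min a b, fun n hn => ?_⟩
  change (M.gr n).prod (N.gr n) = ⊥
  rw [ha n (by omega), hb n (by omega)]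
  exact Submodule.prod_bot

theorem boundedBelow_suspend {M : GrMod.{u} B} (k : ℤ) (hM : M.BoundedBelow) :
    (M.suspend k).BoundedBelow := by
  obtain ⟨a, ha⟩ := hM
  exact ⟨a + k, fun n hn => ha _ (by omega)⟩

theorem boundedBelow_unit : (unit : GrMod.{u} B).BoundedBelow :=
  ⟨0, fun _ hn => if_neg hn.ne⟩

theorem boundedBelow_zero : (zero : GrMod.{u} B).BoundedBelow := ⟨0, fun _ _ => rfl⟩

end Acyclic

/-! ### Direct sums -/

section Sums

variable {B : Type} [Ring B] [Bialgebra F2 B] [GrBialg B] {M N K : GrMod.{u} B}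

/-- The element `(x, y)` of a direct sum. -/
def sp (x : M.carrier) (y : N.carrier) : (M.directSum N).carrier := (x, y)

/-- The components of an element of a direct sum. -/
theorem exists_sp (z : (M.directSum N).carrier) : ∃ x y, z = sp x y := ⟨z.1, z.2, rfl⟩

theorem sp_inj {x x' : M.carrier} {y y' : N.carrier} : sp x y = sp x' y' ↔ x = x' ∧ y = y' :=
  Prod.mk_inj

theorem sp_add (x x' : M.carrier) (y y' : N.carrier) :
    sp x y + sp x' y' = sp (x + x') (y + y') := rfl

theorem sp_sub (x x' : M.carrier) (y y' : N.carrier) :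
    sp x y - sp x' y' = sp (x - x') (y - y') := rfl

theorem sp_zero : (0 : (M.directSum N).carrier) = sp 0 0 := rfl

theorem sp_ρ (b : B) (x : M.carrier) (y : N.carrier) :
    (M.directSum N).ρ b (sp x y) = sp (M.ρ b x) (N.ρ b y) := rfl

/-- The morphism to a direct sum with given components. -/
noncomputable def sumLift (f : K ⟶ M) (g : K ⟶ N) : K ⟶ M.directSum N :=
  mkHom ((lin f).prod (lin g)) (fun n x hx => ⟨homog_lin f n x hx, homog_lin g n x hx⟩)
    (fun b v => Prod.ext (lin_ρ f b v) (lin_ρ g b v))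

/-- The morphism from a direct sum with given components. -/
noncomputable def sumDesc (f : M ⟶ K) (g : N ⟶ K) : M.directSum N ⟶ K :=
  mkHom ((lin f).coprod (lin g))
    (fun n _ hx => Submodule.add_mem _ (homog_lin f n _ hx.1) (homog_lin g n _ hx.2))
    (fun b v => by
      change lin f (M.ρ b v.1) + lin g (N.ρ b v.2) = K.ρ b (lin f v.1 + lin g v.2)
      rw [map_add, lin_ρ, lin_ρ])

theorem lin_sumLift (f : K ⟶ M) (g : K ⟶ N) (x : K.carrier) :
    lin (sumLift f g) x = sp (lin f x) (lin g x) := rfl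

theorem lin_sumDesc (f : M ⟶ K) (g : N ⟶ K) (x : M.carrier) (y : N.carrier) :
    lin (sumDesc f g) (sp x y) = lin f x + lin g y := rfl

/-- The inclusion of the first summand. -/
noncomputable def sumInl (M N : GrMod.{u} B) : M ⟶ M.directSum N := sumLift (𝟙 M) (zeroHom M N)

/-- The inclusion of the second summand. -/
noncomputable def sumInr (M N : GrMod.{u} B) : N ⟶ M.directSum N := sumLift (zeroHom N M) (𝟙 N)

/-- The projection onto the first summand. -/
noncomputable def sumFst (M N : GrMod.{u} B) : M.directSum N ⟶ M := sumDesc (𝟙 M) (zeroHom N M)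

theorem lin_sumInl (x : M.carrier) : lin (sumInl M N) x = sp x 0 := rfl

theorem lin_sumInr (y : N.carrier) : lin (sumInr M N) y = sp 0 y := rfl

theorem lin_sumFst (x : M.carrier) (y : N.carrier) : lin (sumFst M N) (sp x y) = x := add_zero x

end Sums

end GrMod

end StMod

namespace StMod

/-! ### The twisting isomorphism of `B ⊗ B` and the common structure of `A(1)` and `E(1)` -/

section Twist

variable (B : Type) [Ring B] [Bialgebra F2 B]

/-- The right `B`-linear map `b ⊗ c ↦ Δ(b) (1 ⊗ c)`. -/
noncomputable def twist : B ⊗[F2] B →ₗ[F2] B ⊗[F2] B :=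
  TensorProduct.lift ((LinearMap.mul F2 (B ⊗[F2] B)).compl₁₂ (Coalgebra.comul (R := F2))
    (Algebra.TensorProduct.includeRight (R := F2) (A := B) (B := B)).toLinearMap)

variable {B}

theorem twist_tmul (b c : B) :
    twist B (b ⊗ₜ c) = Coalgebra.comul (R := F2) b * (1 ⊗ₜ[F2] c) := rfl

theorem twist_mul (X : B ⊗[F2] B) (c : B) : twist B (X * (1 ⊗ₜ c)) = twist B X * (1 ⊗ₜ c) := by
  induction X using TensorProduct.induction_on with
  | zero => simp
  | add x y hx hy => simp only [add_mul, map_add, hx, hy]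
  | tmul b d => simp [twist_tmul, mul_assoc]

theorem range_twist_mul_right {y : B ⊗[F2] B} (hy : y ∈ LinearMap.range (twist B)) (c : B) :
    y * (1 ⊗ₜ c) ∈ LinearMap.range (twist B) := by
  obtain ⟨x, rfl⟩ := hy
  exact ⟨x * (1 ⊗ₜ c), twist_mul x c⟩

end Twist

/-- For primitive `g`, `Δ(bg)(1 ⊗ c) = Δ(b)(g ⊗ c) + Δ(b)(1 ⊗ gc)`, and the last term is the image
of `b ⊗ gc`. -/
theorem range_twist_mul_left {B : Type} [Ring B] [Bialgebra F2 B] {g : B}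
    (hg : Coalgebra.comul (R := F2) g = g ⊗ₜ 1 + 1 ⊗ₜ g) {y : B ⊗[F2] B}
    (hy : y ∈ LinearMap.range (twist B)) : y * (g ⊗ₜ 1) ∈ LinearMap.range (twist B) := by
  obtain ⟨x, rfl⟩ := hy
  induction x using TensorProduct.induction_on with
  | zero => rw [map_zero, zero_mul]; exact Submodule.zero_mem _
  | add x y hx hy => rw [map_add, add_mul]; exact Submodule.add_mem _ hx hy
  | tmul b c =>
    refine ⟨(b * g) ⊗ₜ c + b ⊗ₜ (g * c), ?_⟩
    rw [map_add, twist_tmul, twist_tmul, twist_tmul, Bialgebra.comul_mul, hg]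
    simp only [mul_assoc, add_mul, Algebra.TensorProduct.tmul_mul_tmul, one_mul, mul_one, mul_add]
    rw [add_assoc, add_self_F2 (V := B ⊗[F2] B), add_zero]

/-- The elements whose left multiplication preserves `p` form a subalgebra containing the
generators. Applying such an element to `1` gives the claim. -/
theorem induction_of_adjoin {B : Type} [Ring B] [Algebra F2 B] {gen : Fin 2 → B}
    (adjoin : ∀ S : Subalgebra F2 B, (∀ i, gen i ∈ S) → S = ⊤) {p : B → Prop} (h1 : p 1) (hz : p 0) (hadd : ∀ x y, p x → p y → p (x + y))
    (hmul : ∀ i x, p x → p (gen i * x)) (b : B) : p b := by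
  let S : Subalgebra F2 B :=
    { carrier := {b | ∀ x, p x → p (b * x)}
      mul_mem' := fun {a b} ha hb x hx => by rw [mul_assoc]; exact ha _ (hb _ hx)
      add_mem' := fun {a b} ha hb x hx => by rw [add_mul]; exact hadd _ _ (ha _ hx) (hb _ hx)
      algebraMap_mem' := fun r x hx => by
        rw [← Algebra.smul_def]
        -- The only scalars are `0` and `1`, so `p` need not be assumed stable under scalar
        -- multiplication.
        have : r = 0 ∨ r = 1 := by revert r; decide
        rcases this with rfl | rfl
        · rw [zero_smul]; exact hz
        · rwa [one_smul] }
  have hS : b ∈ S := by rw [adjoin S hmul]; trivial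
  simpa using hS 1 h1

/-- The structure of `A(1)` and `E(1)` that enters the theory of their stable modules. -/
class Kit (B : Type) [Ring B] [Bialgebra F2 B] [GrBialg B] [SubA1 B] where
  gen : Fin 2 → B
  wt : Fin 2 → ℤ
  wt_pos : ∀ i, 0 < wt i
  gen_mem : ∀ i, gen i ∈ GrBialg.deg (wt i)
  adjoin : ∀ S : Subalgebra F2 B, (∀ i, gen i ∈ S) → S = ⊤
  internal : DirectSum.IsInternal (GrBialg.deg (B := B))
  one_mem : (1 : B) ∈ GrBialg.deg 0
  mul_mem : ∀ {m n : ℤ} {a b : B}, a ∈ GrBialg.deg m → b ∈ GrBialg.deg n →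
    a * b ∈ GrBialg.deg (m + n)
  finite : Module.Finite F2 B
  counit_gen : ∀ i, Coalgebra.counit (R := F2) (gen i) = 0
  twist_gen : ∀ i, ∀ y ∈ LinearMap.range (twist B), y * (gen i ⊗ₜ 1) ∈ LinearMap.range (twist B)
  top : B
  topDeg : ℤ
  top_mem : top ∈ GrBialg.deg topDeg
  top_ne : top ≠ 0
  gen_mul_top : ∀ i, gen i * top = 0
  top_mul_gen : ∀ i, top * gen i = 0
  homotopy : Fin 2 → B →ₗ[F2] B
  homotopy_eq : ∀ i b, SubA1.Q i * homotopy i b + homotopy i (SubA1.Q i * b) = b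
  Q_mem : ∀ i, SubA1.Q (B := B) i ∈ GrBialg.deg ((![1, 3] : Fin 2 → ℤ) i)
  Q_comul : ∀ i, Coalgebra.comul (R := F2) (SubA1.Q (B := B) i) =
    SubA1.Q i ⊗ₜ 1 + 1 ⊗ₜ SubA1.Q i
  Q_sq : ∀ i, SubA1.Q (B := B) i * SubA1.Q i = 0
  Q_comm : SubA1.Q (B := B) 0 * SubA1.Q 1 = SubA1.Q 1 * SubA1.Q 0

namespace Kit

variable {B : Type} [Ring B] [Bialgebra F2 B] [GrBialg B] [SubA1 B] [Kit B]

theorem induction {p : B → Prop} (h1 : p 1) (hz : p 0) (hadd : ∀ x y, p x → p y → p (x + y))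
    (hmul : ∀ i x, p x → p (gen i * x)) (b : B) : p b :=
  induction_of_adjoin adjoin h1 hz hadd hmul b

/-- The generators kill the top class and have counit `0`, so `B` acts on the top class through the
counit. This makes the embedding into the hull linear over `B`. -/
theorem mul_top (b : B) : b * top = Coalgebra.counit (R := F2) b • top := by
  refine induction (p := fun b => b * top = Coalgebra.counit (R := F2) b • top) (by simp)
    (by simp) (fun x y hx hy => by rw [add_mul, hx, hy, map_add, add_smul]) (fun i x hx => ?_) b
  rw [mul_assoc, hx, mul_smul_comm, gen_mul_top, Bialgebra.counit_mul, counit_gen, zero_mul,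
    smul_zero, zero_smul]

theorem top_mul (b : B) : top * b = Coalgebra.counit (R := F2) b • top := by
  refine induction (p := fun b => top * b = Coalgebra.counit (R := F2) b • top) (by simp)
    (by simp) (fun x y hx hy => by rw [mul_add, hx, hy, map_add, add_smul]) (fun i x hx => ?_) b
  rw [← mul_assoc, top_mul_gen, zero_mul, Bialgebra.counit_mul, counit_gen, zero_mul,
    zero_smul]

/-- This takes the place of an antipode: the range contains `1 ⊗ 1`, and it is stable under right
multiplication by `b ⊗ 1` (checked on generators) and by `1 ⊗ c`. -/
theorem twist_surjective : Function.Surjective (twist B) := by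
  let S : Subalgebra F2 B :=
    { carrier := {b | ∀ y ∈ LinearMap.range (twist B), y * (b ⊗ₜ 1) ∈ LinearMap.range (twist B)}
      mul_mem' := fun {a b} ha hb y hy => by
        have := hb _ (ha y hy)
        rwa [mul_assoc, Algebra.TensorProduct.tmul_mul_tmul, mul_one] at this
      add_mem' := fun {a b} ha hb y hy => by
        rw [TensorProduct.add_tmul, mul_add]; exact Submodule.add_mem _ (ha _ hy) (hb _ hy)
      algebraMap_mem' := fun r y hy => by
        rw [Algebra.algebraMap_eq_smul_one, ← TensorProduct.smul_tmul', mul_smul_comm,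
          ← Algebra.TensorProduct.one_def, mul_one]
        exact Submodule.smul_mem _ r hy }
  intro y
  rw [← LinearMap.mem_range]
  induction y using TensorProduct.induction_on with
  | zero => exact Submodule.zero_mem _
  | add x y hx hy => exact Submodule.add_mem _ hx hy
  | tmul b c =>
    have hb : b ∈ S := by rw [adjoin S twist_gen]; trivial
    have h1 : (1 ⊗ₜ 1 : B ⊗[F2] B) ∈ LinearMap.range (twist B) :=
      ⟨1 ⊗ₜ 1, by simp [twist_tmul, Algebra.TensorProduct.one_def]⟩
    simpa using range_twist_mul_right (hb _ h1) c

/-- `B ⊗ B` is finite-dimensional, so a surjective endomorphism is injective. -/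
theorem twist_injective : Function.Injective (twist B) := by
  have := finite (B := B)
  exact LinearMap.injective_iff_surjective.2 twist_surjective

/-- The twisting map as an equivalence. -/
noncomputable def twistEquiv : B ⊗[F2] B ≃ₗ[F2] B ⊗[F2] B :=
  LinearEquiv.ofBijective (twist B) ⟨twist_injective, twist_surjective⟩

theorem twistEquiv_symm_mul (X : B ⊗[F2] B) (c : B) :
    twistEquiv.symm (X * (1 ⊗ₜ c)) = twistEquiv.symm X * (1 ⊗ₜ c) := by
  rw [LinearEquiv.symm_apply_eq]
  change _ = twist B _
  rw [twist_mul]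
  congr 1
  exact (twistEquiv.apply_symm_apply X).symm

end Kit

namespace GrMod

/-! ### Free modules, and the projectivity of `P ⊗ N` for projective `P` -/

section Free

variable {B : Type} [Ring B] [Bialgebra F2 B] [GrBialg B] [SubA1 B] [Kit B]

/-- The free module `B ⊗ N` on the underlying graded vector space of `N`. -/
noncomputable def free (N : GrMod.{u} B) : GrMod.{u} B where
  carrier := B ⊗[F2] N.carrier
  gr := tensorGr GrBialg.deg N.gr
  isInternal := tensorGr_isInternal Kit.internal N.isInternal
  ρ := (Module.endTensorEndAlgHom (R := F2) (S := F2) (A := F2) (M := B)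
    (N := N.carrier)).comp (Algebra.TensorProduct.includeLeft.comp (Algebra.lmul F2 B))
  smul_mem m b hb n v hv := by
    induction hv using Submodule.span_induction with
    | zero => rw [map_zero]; exact Submodule.zero_mem _
    | add x y _ _ hx hy => rw [map_add]; exact Submodule.add_mem _ hx hy
    | smul r x _ hx => rw [map_smul]; exact Submodule.smul_mem _ r hx
    | mem v hv =>
      obtain ⟨i', j', v, w, hv, hw, rfl, rfl⟩ := hv
      exact tmul_mem_tensorGr (Kit.mul_mem hb hv) hw (by ring)

/-- The element `b ⊗ x` of a free module. -/
noncomputable def fm {N : GrMod.{u} B} (b : B) (x : N.carrier) : (free N).carrier := b ⊗ₜ[F2] x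

variable {N M : GrMod.{u} B}

theorem fm_ρ (b c : B) (x : N.carrier) : (free N).ρ b (fm c x) = fm (b * c) x := rfl

theorem fm_smul (r : F2) (b : B) (x : N.carrier) : fm (r • b) x = r • fm b x := rfl

theorem fm_smul' (r : F2) (b : B) (x : N.carrier) : fm b (r • x) = r • fm b x :=
  TensorProduct.tmul_smul r b x

theorem add_fm (b c : B) (x : N.carrier) : fm (b + c) x = fm b x + fm c x :=
  TensorProduct.add_tmul b c x

theorem fm_add (b : B) (x y : N.carrier) : fm b (x + y) = fm b x + fm b y :=
  TensorProduct.tmul_add b x y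

theorem zero_fm (x : N.carrier) : fm (0 : B) x = 0 := TensorProduct.zero_tmul _ x

theorem fm_zero (b : B) : fm b (0 : N.carrier) = 0 := TensorProduct.tmul_zero _ b

theorem free_induction {p : (free N).carrier → Prop} (h0 : p 0)
    (hadd : ∀ x y, p x → p y → p (x + y)) (ht : ∀ b x, p (fm b x)) (z : (free N).carrier) :
    p z :=
  TensorProduct.induction_on z h0 ht hadd

theorem fm_mem {i j n : ℤ} {b : B} {x : N.carrier} (hb : b ∈ GrBialg.deg i) (hx : x ∈ N.gr j)
    (h : i + j = n) : fm b x ∈ (free N).gr n := tmul_mem_tensorGr hb hx h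

theorem free_lin_ext {W : Type*} [AddCommGroup W] [Module F2 W]
    {f g : (free N).carrier →ₗ[F2] W} (h : ∀ b x, f (fm b x) = g (fm b x)) : f = g :=
  TensorProduct.ext' h

theorem free_gr_le {n : ℤ} {S : Submodule F2 (free N).carrier}
    (h : ∀ i j, ∀ b ∈ GrBialg.deg i, ∀ x ∈ N.gr j, i + j = n → fm b x ∈ S) :
    (free N).gr n ≤ S :=
  Submodule.span_le.2 fun _ ⟨i, j, b, x, hb, hx, hij, ht⟩ => ht ▸ h i j b hb x hx hij

/-- The linear map on `B ⊗ N` given by a bilinear map. -/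
noncomputable def flift {W : Type*} [AddCommGroup W] [Module F2 W]
    (f : B →ₗ[F2] N.carrier →ₗ[F2] W) : (free N).carrier →ₗ[F2] W :=
  TensorProduct.lift f

theorem flift_fm {W : Type*} [AddCommGroup W] [Module F2 W]
    (f : B →ₗ[F2] N.carrier →ₗ[F2] W) (b : B) (x : N.carrier) :
    flift f (fm b x) = f b x := TensorProduct.lift.tmul b x

/-- The morphism on a free module extending a linear map of degree `0`. -/
noncomputable def freeLift (l : N.carrier →ₗ[F2] M.carrier) (hl : Homog N.gr M.gr 0 l) :
    free N ⟶ M :=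
  mkHom (flift (M.ρ.toLinearMap.compl₂ l))
    (fun n => free_gr_le (S := (M.gr (0 + n)).comap _) fun i j b hb x hx h => by
      rw [Submodule.mem_comap, flift_fm]
      exact ρ_mem M hb (hl j x hx) (by omega))
    (fun b v => by
      refine free_induction (p := fun v => flift (M.ρ.toLinearMap.compl₂ l) ((free N).ρ b v) =
        M.ρ b (flift (M.ρ.toLinearMap.compl₂ l) v)) (by simp)
        (fun x y hx hy => by simp only [map_add, hx, hy]) (fun c x => ?_) v
      rw [fm_ρ, flift_fm, flift_fm]
      exact ρ_mul M b c (l x))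

theorem freeLift_fm (l : N.carrier →ₗ[F2] M.carrier) (hl : Homog N.gr M.gr 0 l) (b : B)
    (x : N.carrier) : lin (freeLift l hl) (fm b x) = M.ρ b (l x) := flift_fm _ b x

theorem free_hom_ext {f g : free N ⟶ M} (h : ∀ x, lin f (fm 1 x) = lin g (fm 1 x)) : f = g :=
  hom_ext (free_lin_ext fun b x => by
    rw [← mul_one b, ← fm_ρ, lin_ρ, lin_ρ, h])

theorem homog_fm_one : Homog N.gr (free N).gr 0 (TensorProduct.mk F2 B N.carrier 1) :=
  fun _ _ hx => fm_mem Kit.one_mem hx rfl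

theorem homog_comp {U V W : Type*} [AddCommGroup U] [Module F2 U] [AddCommGroup V] [Module F2 V]
    [AddCommGroup W] [Module F2 W] {𝒰 : ℤ → Submodule F2 U} {𝒱 : ℤ → Submodule F2 V}
    {𝒲 : ℤ → Submodule F2 W} {k l : ℤ} {f : U →ₗ[F2] V} {g : V →ₗ[F2] W} (hg : Homog 𝒱 𝒲 l g)
    (hf : Homog 𝒰 𝒱 k f) : Homog 𝒰 𝒲 (l + k) (g.comp f) := fun n x hx => by
  rw [add_assoc]; exact hg _ _ (hf n x hx)

/-- A map out of a free module is determined by a degree `0` linear map on its generators, and that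
lifts through a homogeneous linear section of the surjection. -/
theorem projective_free (N : GrMod.{u} B) : Projective (free N) := by
  rw [projective_iff]
  intro X Y f e he
  obtain ⟨s, hs, hse⟩ := (homog_lin e).exists_section X.isInternal Y.isInternal he
  refine ⟨freeLift (s.comp ((lin f).comp (TensorProduct.mk F2 B N.carrier 1)))
    (homog_comp (l := 0) (k := 0) hs (homog_comp (l := 0) (k := 0) (homog_lin f)
      homog_fm_one)), free_hom_ext fun x => ?_⟩
  rw [lin_comp_apply, freeLift_fm, map_one]
  exact hse _

/-- The linear endomorphism of `B ⊗ N` induced by one of `B`. -/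
noncomputable def freeMap (h : B →ₗ[F2] B) : (free N).carrier →ₗ[F2] (free N).carrier :=
  h.rTensor N.carrier

theorem freeMap_fm (h : B →ₗ[F2] B) (b : B) (x : N.carrier) :
    freeMap h (fm b x) = fm (h b) x := rfl

/-- Left multiplication by `Q_i` on `B` has a contracting homotopy, and tensoring that homotopy with
the generators contracts the free module. -/
theorem acyc_free (N : GrMod.{u} B) (i : Fin 2) : (free N).Acyc (SubA1.Q i) :=
  acyc_of_homotopy (freeMap (Kit.homotopy i)) fun v => by
    have : ((free N).ρ (SubA1.Q i)).comp (freeMap (Kit.homotopy i)) +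
        (freeMap (Kit.homotopy i)).comp ((free N).ρ (SubA1.Q i)) = LinearMap.id :=
      free_lin_ext fun b x => by
        simp only [LinearMap.add_apply, LinearMap.comp_apply, freeMap_fm, fm_ρ, ← add_fm,
          Kit.homotopy_eq, LinearMap.id_apply]
    exact LinearMap.congr_fun this v

/-- The action map from a free module. -/
noncomputable def freeCounit (M : GrMod.{u} B) : free M ⟶ M :=
  freeLift LinearMap.id (fun n x hx => by rw [zero_add]; exact hx)

theorem freeCounit_fm (b : B) (x : M.carrier) : lin (freeCounit M) (fm b x) = M.ρ b x :=
  freeLift_fm _ _ b x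

theorem freeCounit_surjective (M : GrMod.{u} B) : Function.Surjective (lin (freeCounit M)) :=
  fun x => ⟨fm 1 x, by rw [freeCounit_fm, map_one]; rfl⟩

theorem exists_retract_free (P : GrMod.{u} B) (hP : Projective P) :
    ∃ i : P ⟶ free P, i ≫ freeCounit P = 𝟙 P :=
  projective_iff.1 hP _ _ (𝟙 P) (freeCounit P) (freeCounit_surjective P)

theorem acyc_of_projective {P : GrMod.{u} B} (hP : Projective P) (i : Fin 2) :
    P.Acyc (SubA1.Q i) := by
  obtain ⟨s, hs⟩ := exists_retract_free P hP
  exact acyc_of_retract (acyc_free P i) s _ hs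

/-- The action of `b ⊗ c` on `B ⊗ (P ⊗ N)` that takes `1 ⊗ p ⊗ n` to `b ⊗ p ⊗ c n`. -/
noncomputable def actIn (P N : GrMod.{u} B) :
    B ⊗[F2] B →ₗ[F2] (P.tensor N).carrier →ₗ[F2] (free (P.tensor N)).carrier :=
  TensorProduct.lift (LinearMap.mk₂ F2
    (fun b c => (TensorProduct.mk F2 B (P.tensor N).carrier b).comp (tmap LinearMap.id (N.ρ c)))
    (fun b b' c => by rw [map_add, LinearMap.add_comp]; rfl)
    (fun r b c => by rw [map_smul, LinearMap.smul_comp]; rfl)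
    (fun b c c' => by
      refine tensor_lin_ext fun p n => ?_
      change fm b (tm p (N.ρ (c + c') n)) = fm b (tm p (N.ρ c n)) + fm b (tm p (N.ρ c' n))
      rw [map_add, LinearMap.add_apply, tm_add, fm_add])
    (fun r b c => by
      refine tensor_lin_ext fun p n => ?_
      change fm b (tm p (N.ρ (r • c) n)) = r • fm b (tm p (N.ρ c n))
      rw [map_smul, LinearMap.smul_apply, ← fm_smul']
      exact congrArg (fm b) (TensorProduct.tmul_smul r p (N.ρ c n))))

theorem actIn_tmul {P N : GrMod.{u} B} (b c : B) (p : P.carrier) (n : N.carrier) :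
    actIn P N (b ⊗ₜ c) (tm p n) = fm b (tm p (N.ρ c n)) := rfl

theorem actIn_mul {P N : GrMod.{u} B} (X : B ⊗[F2] B) (c : B) (p : P.carrier) (n : N.carrier) :
    actIn P N (X * (1 ⊗ₜ c)) (tm p n) = actIn P N X (tm p (N.ρ c n)) := by
  induction X using TensorProduct.induction_on with
  | zero => simp
  | add x y hx hy => simp only [add_mul, map_add, LinearMap.add_apply, hx, hy]
  | tmul b d =>
    rw [Algebra.TensorProduct.tmul_mul_tmul, actIn_tmul, actIn_tmul, ρ_mul, mul_one]

theorem homog_tmap_fm_one (P N : GrMod.{u} B) :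
    Homog (P.tensor N).gr ((free P).tensor N).gr 0
      (tmap (M' := free P) (N' := N) (TensorProduct.mk F2 B P.carrier 1) LinearMap.id) :=
  homog_tmap (k := 0) (l := 0) homog_fm_one (fun n x hx => by rw [zero_add]; exact hx)

/-- The untwisting isomorphism `B ⊗ (P ⊗ N) → (B ⊗ P) ⊗ N`. -/
noncomputable def untwist (P N : GrMod.{u} B) : free (P.tensor N) ⟶ (free P).tensor N :=
  freeLift _ (homog_tmap_fm_one P N)

theorem untwist_fm {P N : GrMod.{u} B} (b : B) (p : P.carrier) (n : N.carrier) :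
    lin (untwist P N) (fm b (tm p n)) =
      tact (free P) N (Coalgebra.comul (R := F2) b) (tm (fm 1 p) n) := freeLift_fm _ _ b _

/-- On elements `1 ⊗ p ⊗ n` the untwisting morphism is governed by `twist` on `B ⊗ B` alone. The
inverse of `twist` therefore provides an inverse, `retwist`. -/
theorem untwist_actIn {P N : GrMod.{u} B} (X : B ⊗[F2] B) (p : P.carrier) (n : N.carrier) :
    lin (untwist P N) (actIn P N X (tm p n)) = tact (free P) N (twist B X) (tm (fm 1 p) n) := by
  induction X using TensorProduct.induction_on with
  | zero => simp
  | add x y hx hy => simp only [map_add, LinearMap.add_apply, hx, hy]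
  | tmul b c =>
    rw [actIn_tmul, untwist_fm, twist_tmul, map_mul, Module.End.mul_apply, tact_tmul, map_one]
    rfl

/-- The inverse of `untwist`. -/
noncomputable def retwist (P N : GrMod.{u} B) :
    ((free P).tensor N).carrier →ₗ[F2] (free (P.tensor N)).carrier :=
  tlift (flift
    { toFun := fun b => (TensorProduct.mk F2 P.carrier N.carrier).compr₂
        (actIn P N (Kit.twistEquiv.symm (b ⊗ₜ 1)))
      map_add' := fun b c => by
        ext p n
        simp only [TensorProduct.add_tmul, map_add]
        rfl
      map_smul' := fun r c => by
        ext p n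
        simp only [← TensorProduct.smul_tmul', map_smul]
        rfl })

theorem retwist_tm {P N : GrMod.{u} B} (b : B) (p : P.carrier) (n : N.carrier) :
    retwist P N (tm (fm b p) n) = actIn P N (Kit.twistEquiv.symm (b ⊗ₜ 1)) (tm p n) := by
  rw [retwist, tlift_tm, flift_fm]
  rfl

theorem retwist_tact {P N : GrMod.{u} B} (X : B ⊗[F2] B) (p : P.carrier) (n : N.carrier) :
    retwist P N (tact (free P) N X (tm (fm 1 p) n)) =
      actIn P N (Kit.twistEquiv.symm X) (tm p n) := by
  induction X using TensorProduct.induction_on with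
  | zero => simp
  | add x y hx hy => simp only [map_add, LinearMap.add_apply, hx, hy]
  | tmul b c =>
    rw [tact_tmul, fm_ρ, mul_one, retwist_tm, ← actIn_mul, ← Kit.twistEquiv_symm_mul,
      Algebra.TensorProduct.tmul_mul_tmul, mul_one, one_mul]

theorem untwist_bijective (P N : GrMod.{u} B) : Function.Bijective (lin (untwist P N)) := by
  have h1 : (lin (untwist P N)).comp (retwist P N) = LinearMap.id :=
    tensor_lin_ext fun y n => by
      refine free_induction (p := fun y => ((lin (untwist P N)).comp (retwist P N)) (tm y n) =
        tm y n) (by rw [zero_tm, map_zero]) (fun x y hx hy => by rw [add_tm, map_add, hx, hy])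
        (fun b p => ?_) y
      rw [LinearMap.comp_apply, retwist_tm, untwist_actIn]
      have : twist B (Kit.twistEquiv.symm (b ⊗ₜ 1)) = b ⊗ₜ 1 :=
        Kit.twistEquiv.apply_symm_apply _
      rw [this, tact_tmul, fm_ρ, mul_one, map_one]
      rfl
  have h2 : (retwist P N).comp (lin (untwist P N)) = LinearMap.id :=
    free_lin_ext fun b t => by
      refine tensor_induction (p := fun t => ((retwist P N).comp (lin (untwist P N))) (fm b t) =
        fm b t) (by rw [fm_zero, map_zero]) (fun x y hx hy => by rw [fm_add, map_add, hx, hy])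
        (fun p n => ?_) t
      rw [LinearMap.comp_apply, untwist_fm, retwist_tact]
      have : Coalgebra.comul (R := F2) b = Kit.twistEquiv (b ⊗ₜ[F2] (1 : B)) := by
        change _ = Coalgebra.comul (R := F2) b * (1 ⊗ₜ[F2] 1)
        rw [← Algebra.TensorProduct.one_def, mul_one]
      rw [this, LinearEquiv.symm_apply_apply, actIn_tmul, map_one]
      rfl
  exact ⟨Function.LeftInverse.injective (LinearMap.congr_fun h2),
    Function.RightInverse.surjective (LinearMap.congr_fun h1)⟩

/-- `P` is a retract of `free P`, so `P ⊗ N` is a retract of `free P ⊗ N`. The diagonal action there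
can be untwisted to that of the free module on `P ⊗ N`. -/
theorem projective_tensor {P : GrMod.{u} B} (hP : Projective P) (N : GrMod.{u} B) :
    Projective (P.tensor N) := by
  obtain ⟨i, hi⟩ := exists_retract_free P hP
  have := projective_free (P.tensor N)
  refine projective_of_retract (Q := free (P.tensor N))
    (tensorHom i (𝟙 N) ≫ homInv (untwist P N) (untwist_bijective P N))
    (untwist P N ≫ tensorHom (freeCounit P) (𝟙 N)) ?_
  rw [Category.assoc, ← Category.assoc (homInv _ _), homInv_comp, Category.id_comp,
    tensorHom_comp, hi, Category.comp_id, tensorHom_id]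

end Free

end GrMod

end StMod

namespace StMod

theorem neg_F2 {V : Type*} [AddCommGroup V] [Module F2 V] (x : V) : -x = x :=
  neg_eq_of_add_eq_zero_left (add_self_F2 x)

theorem sub_F2 {V : Type*} [AddCommGroup V] [Module F2 V] (x y : V) : x - y = x + y := by
  rw [sub_eq_add_neg, neg_F2]

theorem F2_cases (r : F2) : r = 0 ∨ r = 1 := by revert r; decide

theorem exists_functional {V : Type*} [AddCommGroup V] [Module F2 V] {S : Submodule F2 V} {x : V}
    (hx : x ∉ S) : ∃ f : V →ₗ[F2] F2, f x = 1 ∧ ∀ y ∈ S, f y = 0 := by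
  obtain ⟨f, hf, hS⟩ := Submodule.exists_le_ker_of_notMem hx
  exact ⟨f, (F2_cases _).resolve_left hf, fun y hy => hS hy⟩

/-- In a bounded below acyclic module, the top class of `B` acts injectively on the lowest
degree. -/
def Detects (B : Type) [Ring B] [Bialgebra F2 B] [GrBialg B] [SubA1 B] [Kit B] : Prop :=
  ∀ (M : GrMod.{u} B), (∀ i : Fin 2, M.Acyc (SubA1.Q (B := B) i)) → ∀ n : ℤ,
    (∀ m : ℤ, m < n → M.gr m = ⊥) → ∀ k ∈ M.gr n, M.ρ (Kit.top (B := B)) k = 0 → k = 0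

namespace GrMod

/-! ### Acyclic bounded below modules are projective, and homology isomorphisms are stable
equivalences -/

section Margolis

variable {B : Type} [Ring B] [Bialgebra F2 B] [GrBialg B] [SubA1 B] [Kit B]

theorem homog_mulLeft_gen (j : Fin 2) : Homog (GrBialg.deg (B := B)) GrBialg.deg (Kit.wt B j)
    (LinearMap.mulLeft F2 (Kit.gen j)) := fun _ _ hy => Kit.mul_mem (Kit.gen_mem j) hy

/-- Left multiplication by a generator raises degrees by its positive weight, so starting from `1`
no component of negative degree can arise. -/
theorem pr_neg_eq_zero (b : B) : ∀ i : ℤ, i < 0 → pr (Kit.internal (B := B)) i b = 0 := by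
  refine Kit.induction (p := fun b => ∀ i : ℤ, i < 0 → pr (Kit.internal (B := B)) i b = 0)
    ?_ ?_ ?_ ?_ b
  · intro i hi
    exact pr_of_ne (Kit.internal (B := B)) (Kit.one_mem (B := B)) hi.ne'
  · intro i _
    exact map_zero _
  · intro x y hx hy i hi
    rw [map_add, hx i hi, hy i hi, add_zero]
  · intro j x hx i hi
    have := pr_homog (Kit.internal (B := B)) (Kit.internal (B := B)) (homog_mulLeft_gen j) (i - Kit.wt B j) x
    have hw := Kit.wt_pos (B := B) j
    rwa [add_sub_cancel, hx _ (by omega), map_zero] at this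

theorem deg_neg {n : ℤ} (hn : n < 0) : GrBialg.deg (B := B) n = ⊥ :=
  (Submodule.eq_bot_iff _).2 fun b hb => by
    rw [← pr_of_mem (Kit.internal (B := B)) hb, pr_neg_eq_zero b n hn]

theorem boundedBelow_free {N : GrMod.{u} B} (hN : N.BoundedBelow) : (free N).BoundedBelow := by
  obtain ⟨a, ha⟩ := hN
  refine ⟨a, fun n hn => eq_bot_iff.2 (free_gr_le fun i j b hb x hx h => ?_)⟩
  rw [Submodule.mem_bot]
  rcases lt_or_ge i 0 with hi | hi
  · rw [deg_neg hi, Submodule.mem_bot] at hb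
    rw [hb, zero_fm]
  · rw [ha j (by omega), Submodule.mem_bot] at hx
    rw [hx, fm_zero]

/-- The decomposable elements of a module. -/
def decomposables (M : GrMod.{u} B) : Submodule F2 M.carrier :=
  LinearMap.range (M.ρ (Kit.gen 0)) ⊔ LinearMap.range (M.ρ (Kit.gen 1))

theorem gen_mem_decomposables (M : GrMod.{u} B) (i : Fin 2) (x : M.carrier) :
    M.ρ (Kit.gen i) x ∈ decomposables M := by
  fin_cases i
  · exact Submodule.mem_sup_left ⟨x, rfl⟩
  · exact Submodule.mem_sup_right ⟨x, rfl⟩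

theorem decomposables_stable (M : GrMod.{u} B) (b : B) :
    ∀ x ∈ decomposables M, M.ρ b x ∈ decomposables M := fun x hx =>
  Kit.induction (p := fun b => M.ρ b x ∈ decomposables M) (by rw [map_one]; exact hx)
    (by rw [map_zero]; exact Submodule.zero_mem _)
    (fun b c hb hc => by rw [map_add]; exact Submodule.add_mem _ hb hc)
    (fun i b _ => by rw [ρ_mul]; exact gen_mem_decomposables M i _) b

theorem decomposables_pr (M : GrMod.{u} B) :
    ∀ x ∈ decomposables M, ∀ n, pr M.isInternal n x ∈ decomposables M := fun x hx n => by
  obtain ⟨y, hy, z, hz, rfl⟩ := Submodule.mem_sup.1 hx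
  rw [map_add]
  exact Submodule.add_mem _
    (Submodule.mem_sup_left (range_pr_mem M.isInternal M.isInternal (homog_ρ M (Kit.gen_mem 0)) y hy n))
    (Submodule.mem_sup_right (range_pr_mem M.isInternal M.isInternal (homog_ρ M (Kit.gen_mem 1)) z hz n))

/-- The module of indecomposables of a module. -/
noncomputable def indec (M : GrMod.{u} B) : GrMod.{u} B :=
  M.quot (decomposables M) (decomposables_stable M) (decomposables_pr M)

/-- The projection onto the indecomposables. -/
noncomputable def indecπ (M : GrMod.{u} B) : M ⟶ indec M := M.quotπ _ _ _

theorem indecπ_surjective (M : GrMod.{u} B) : Function.Surjective (lin (indecπ M)) :=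
  Submodule.mkQ_surjective _

theorem indecπ_eq_zero (M : GrMod.{u} B) (x : M.carrier) :
    lin (indecπ M) x = 0 ↔ x ∈ decomposables M := Submodule.Quotient.mk_eq_zero _

/-- The generators act as zero on the indecomposables, so only the constant part of `b` acts. -/
theorem indec_ρ (M : GrMod.{u} B) (b : B) (v : (indec M).carrier) :
    (indec M).ρ b v = Coalgebra.counit (R := F2) b • v := by
  refine Kit.induction (p := fun b => (indec M).ρ b v = Coalgebra.counit (R := F2) b • v)
    (by rw [map_one, Bialgebra.counit_one, one_smul]; rfl) (by simp)
    (fun x y hx hy => by rw [map_add, LinearMap.add_apply, hx, hy, map_add, add_smul])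
    (fun i x hx => ?_) b
  obtain ⟨m, rfl⟩ := indecπ_surjective M v
  rw [ρ_mul, hx, map_smul, ← lin_ρ, (indecπ_eq_zero M _).2 (gen_mem_decomposables M i m),
    Bialgebra.counit_mul, Kit.counit_gen, zero_mul, smul_zero, zero_smul]

theorem exists_lowest {B : Type} [Ring B] [Bialgebra F2 B] [GrBialg B]
    {M : GrMod.{u} B} (hM : M.BoundedBelow) (h : ¬ ∀ x : M.carrier, x = 0) :
    ∃ n, (∀ m < n, M.gr m = ⊥) ∧ M.gr n ≠ ⊥ := by
  obtain ⟨a, ha⟩ := hM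
  have hex : ∃ n, M.gr n ≠ ⊥ := by
    by_contra! h'
    refine h (gr_induction M.isInternal rfl (fun x y hx hy => by rw [hx, hy, add_zero])
      fun n x hx => ?_)
    rwa [h' n, Submodule.mem_bot] at hx
  obtain ⟨n, hn, hn'⟩ := Int.exists_least_of_bdd (P := fun n => M.gr n ≠ ⊥)
    ⟨a, fun z hz => not_lt.1 fun h => hz (ha z h)⟩ hex
  exact ⟨n, fun m hm => by_contra fun h => not_lt.2 (hn' m h) hm, hn⟩

/-- A bounded below module with vanishing Margolis homology is projective. -/
theorem projective_of_acyc (hD : Detects.{u} B) {M : GrMod.{u} B} (hM : M.BoundedBelow)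
    (hq : ∀ i, M.Acyc (SubA1.Q i)) : Projective M := by
  -- The minimal free cover: `Φ` sends the generators of a free module to representatives of a basis
  -- of the indecomposables.
  obtain ⟨s, hs, hsπ⟩ := (homog_lin (indecπ M)).exists_section M.isInternal (indec M).isInternal
    (indecπ_surjective M)
  set Φ := freeLift s hs with hΦ
  have hsurj : Function.Surjective (lin Φ) := by
    rw [← LinearMap.range_eq_top]
    obtain ⟨a, ha⟩ := hM
    -- Nakayama's lemma by induction on the degree above the lower bound: modulo the image of the
    -- section, an element is a sum of generators applied to elements of smaller degree.
    have key : ∀ k : ℕ, ∀ n, n < a + k → ∀ v ∈ M.gr n, v ∈ LinearMap.range (lin Φ) := by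
      intro k
      induction k with
      | zero =>
        intro n hn v hv
        rw [ha n (by simpa using hn), Submodule.mem_bot] at hv
        rw [hv]; exact Submodule.zero_mem _
      | succ k ih =>
        intro n hn v hv
        have h1 : v - s (lin (indecπ M) v) ∈ decomposables M := by
          rw [← indecπ_eq_zero, map_sub, hsπ, sub_self]
        obtain ⟨_, ⟨y, rfl⟩, _, ⟨z, rfl⟩, hyz⟩ := Submodule.mem_sup.1 h1
        have h2 : v - s (lin (indecπ M) v) ∈ M.gr n := Submodule.sub_mem _ hv
          (by simpa using hs n _ (lin_mem (indecπ M) hv))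
        -- The elements `y` and `z` need not be homogeneous. Taking degree `n` components replaces
        -- them by components of degree `n - wt`, to which the induction hypothesis applies.
        have h3 := congrArg (pr M.isInternal n) hyz
        have e0 := pr_homog M.isInternal M.isInternal (homog_ρ M (Kit.gen_mem 0))
          (n - Kit.wt B 0) y
        have e1 := pr_homog M.isInternal M.isInternal (homog_ρ M (Kit.gen_mem 1))
          (n - Kit.wt B 1) z
        rw [add_sub_cancel] at e0 e1
        rw [pr_of_mem _ h2, map_add, e0, e1] at h3
        have w0 := Kit.wt_pos (B := B) 0
        have w1 := Kit.wt_pos (B := B) 1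
        have h4 : v = M.ρ (Kit.gen 0) (pr M.isInternal (n - Kit.wt B 0) y) +
            M.ρ (Kit.gen 1) (pr M.isInternal (n - Kit.wt B 1) z) + s (lin (indecπ M) v) := by
          rw [h3]; abel
        rw [h4]
        push_cast at hn
        refine Submodule.add_mem _ (Submodule.add_mem _
          (range_lin_stable Φ _ _ (ih _ (by omega) _ (pr_mem _ _ _)))
          (range_lin_stable Φ _ _ (ih _ (by omega) _ (pr_mem _ _ _))))
          ⟨fm 1 (lin (indecπ M) v), ?_⟩
        rw [hΦ, freeLift_fm, map_one]
        rfl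
    refine eq_top_iff.2 fun v _ => ?_
    refine gr_induction M.isInternal (p := fun v => v ∈ LinearMap.range (lin Φ))
      (Submodule.zero_mem _) (fun x y => Submodule.add_mem _) (fun n v hv => ?_) v
    exact key (n - a + 1).toNat n (by omega) v hv
  -- Minimality enters here: the top class kills every non-constant part of `f`, and the constant
  -- part is what `Φ` induces on indecomposables. Hence the top class annihilates the kernel of `Φ`.
  have htop : ∀ f, (free (indec M)).ρ Kit.top f = fm Kit.top (lin (indecπ M) (lin Φ f)) := by
    refine free_induction (by simp [fm_zero]) (fun x y hx hy => by
      rw [map_add, hx, hy, map_add, map_add, fm_add]) (fun b v => ?_)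
    rw [fm_ρ, Kit.top_mul, hΦ, freeLift_fm, lin_ρ, hsπ, indec_ρ, fm_smul, fm_smul']
  -- The kernel is bounded below and acyclic, so on its lowest nonzero degree the top class would
  -- act injectively; but it acts by zero.
  have hzero : ∀ k : (kern Φ).carrier, k = 0 := by
    by_contra h
    have hV : (indec M).BoundedBelow :=
      boundedBelow_of_surjective (indecπ M) (indecπ_surjective M) hM
    obtain ⟨n, hn, hn'⟩ := exists_lowest (boundedBelow_kern Φ (boundedBelow_free hV)) h
    refine hn' ((Submodule.eq_bot_iff _).2 fun k hk => hD (kern Φ)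
      (fun i => acyc_kern (Kit.Q_sq i) Φ hsurj (acyc_free _ i) (hq i)) n hn k hk ?_)
    apply kernι_injective Φ
    rw [lin_ρ, htop, kernι_lin, map_zero, map_zero, fm_zero]
  have hinj : Function.Injective (lin Φ) := (injective_iff_map_eq_zero _).2 fun x hx => by
    obtain ⟨k, rfl⟩ := mem_range_kernι Φ x hx
    rw [hzero k, map_zero]
  have := projective_free (indec M)
  exact projective_of_retract _ _ (homInv_comp Φ ⟨hinj, hsurj⟩)

/-- The unit module, shifted so that the top class of `B ⊗ unit` is in degree `0`. -/
noncomputable def shiftedUnit : GrMod.{u} B := suspend (-Kit.topDeg B) unit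

/-- The generator of `shiftedUnit`. -/
def shiftedOne : (shiftedUnit.{u} (B := B)).carrier := (ULift.up 1 : ULift.{u} F2)

theorem shiftedOne_mem : shiftedOne.{u} (B := B) ∈ shiftedUnit.gr (-Kit.topDeg B) := by
  have h : (shiftedUnit.{u} (B := B)).gr (-Kit.topDeg B) = ⊤ := if_pos (sub_self _)
  rw [h]
  trivial

theorem shiftedOne_ne : shiftedOne.{u} (B := B) ≠ 0 := fun h =>
  one_ne_zero (α := F2) (congrArg ULift.down h)

/-- The top class of the free module on `shiftedUnit`. -/
noncomputable def topClass : (free (shiftedUnit.{u} (B := B))).carrier := fm Kit.top shiftedOne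

theorem topClass_mem : topClass.{u} (B := B) ∈ (free (shiftedUnit.{u} (B := B))).gr 0 :=
  fm_mem Kit.top_mem shiftedOne_mem (by ring)

theorem topClass_ne : topClass.{u} (B := B) ≠ 0 := by
  intro h
  obtain ⟨f, hf, -⟩ := exists_functional (S := ⊥) (x := shiftedOne.{u} (B := B))
    (by simpa using shiftedOne_ne)
  have := congrArg (flift (N := shiftedUnit.{u} (B := B))
    ((LinearMap.lsmul F2 B).flip.compl₂ f)) h
  rw [topClass, flift_fm, map_zero] at this
  apply Kit.top_ne (B := B)
  simpa [hf] using this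

/-- `B` acts on the top class through the counit, so only `(ε ⊗ 1) X` is left. For `X = Δ(b)` this
is `b`, by the counit axiom. -/
theorem tact_topClass (M : GrMod.{u} B) (X : B ⊗[F2] B) (m : M.carrier) :
    tact (free shiftedUnit) M X (tm topClass m) = tm topClass
      (M.ρ (TensorProduct.lid F2 B ((Coalgebra.counit (R := F2) (A := B)).rTensor B X)) m) := by
  induction X using TensorProduct.induction_on with
  | zero => simp [tm_zero]
  | add x y hx hy => simp only [map_add, LinearMap.add_apply, hx, hy, tm_add]
  | tmul b c =>
    rw [tact_tmul, topClass, fm_ρ, Kit.mul_top, fm_smul, LinearMap.rTensor_tmul,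
      TensorProduct.lid_tmul, map_smul, LinearMap.smul_apply]
    exact TensorProduct.smul_tmul _ _ _

/-- A projective bounded below module containing a given one. -/
noncomputable def hull (M : GrMod.{u} B) : GrMod.{u} B := (free shiftedUnit).tensor M

/-- The embedding in the hull. -/
noncomputable def hullι (M : GrMod.{u} B) : M ⟶ hull M :=
  mkHom (TensorProduct.mk F2 (free (shiftedUnit.{u} (B := B))).carrier M.carrier topClass)
    (fun _ _ hx => tm_mem topClass_mem hx rfl)
    (fun b v => by
      change tm topClass (M.ρ b v) =
        tact _ _ (Coalgebra.comul (R := F2) b) (tm topClass v)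
      rw [tact_topClass, Coalgebra.rTensor_counit_comul, TensorProduct.lid_tmul, one_smul])

/-- A linear functional with value `1` at the top class provides a left inverse, which need not be
linear over `B`. -/
theorem hullι_injective (M : GrMod.{u} B) : Function.Injective (lin (hullι M)) := by
  obtain ⟨f, hf, -⟩ := exists_functional (S := ⊥) (x := topClass.{u} (B := B))
    (by simpa using topClass_ne)
  have : ∀ m, tlift (M := free (shiftedUnit.{u} (B := B))) ((LinearMap.lsmul F2 M.carrier).comp f)
      (lin (hullι M) m) = m := fun m => by
    change tlift _ (tm topClass m) = m
    rw [tlift_tm, LinearMap.comp_apply, hf]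
    exact one_smul F2 m
  exact Function.LeftInverse.injective this

theorem projective_hull (M : GrMod.{u} B) : Projective (hull M) :=
  projective_tensor (projective_free _) M

theorem boundedBelow_hull {M : GrMod.{u} B} (hM : M.BoundedBelow) : (hull M).BoundedBelow :=
  boundedBelow_tensor (boundedBelow_free (boundedBelow_suspend _ boundedBelow_unit)) hM

/-- The cokernel of `(f, i) : M → N ⊕ J` plays the role of a mapping cone. If `(n, j)` is a cycle
modulo the image of some `m`, injectivity of `f` on homology makes `m` a boundary. Surjectivity of
`f` on homology and acyclicity of `J` then express `(n, j)` as a boundary modulo the image of `M`.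
-/
theorem acyc_coker {B : Type} [Ring B] [Bialgebra F2 B] [GrBialg B] {M N J : GrMod.{u} B} {q : B} (hqq : q * q = 0) (f : M ⟶ N) (i : M ⟶ J)
    (hi : Function.Injective (lin i)) (hJ : J.Acyc q) (hf : QIso f q) :
    (coker (sumLift f i)).Acyc q := by
  have hqq' : ∀ (K : GrMod.{u} B) (x : K.carrier), K.ρ q (K.ρ q x) = 0 := fun K x => by
    rw [← ρ_mul, hqq]; simp
  intro c hc
  obtain ⟨nj, rfl⟩ := cokerπ_surjective _ c
  obtain ⟨n, j, rfl⟩ := exists_sp nj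
  rw [← lin_ρ, cokerπ_eq_zero] at hc
  obtain ⟨m, hm⟩ := hc
  rw [lin_sumLift, sp_ρ, sp_inj] at hm
  obtain ⟨h1, h2⟩ := hm
  have hqm : M.ρ q m = 0 := hi (by rw [lin_ρ, h2, hqq', map_zero])
  obtain ⟨m', rfl⟩ := hf.inj m hqm ⟨n, h1.symm⟩
  obtain ⟨m'', n'', hm'', hn''⟩ := hf.surj (n - lin f m') (by rw [map_sub, ← h1, lin_ρ, sub_self])
  obtain ⟨j'', hj''⟩ := hJ (j - lin i m' - lin i m'') (by
    rw [map_sub, map_sub, ← h2, lin_ρ, sub_self, ← lin_ρ, hm'', map_zero, sub_zero])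
  refine ⟨lin (cokerπ _) (sp n'' j''), ?_⟩
  rw [← lin_ρ, eq_comm, ← sub_eq_zero, ← map_sub, cokerπ_eq_zero]
  refine ⟨m' + m'', ?_⟩
  rw [lin_sumLift, sp_ρ, sp_sub, sp_inj, hj'', map_add, map_add, eq_sub_iff_add_eq, add_assoc,
    ← hn'']
  exact ⟨by abel, by abel⟩

/-- A morphism of bounded below modules that induces isomorphisms of Margolis homology groups is
a stable equivalence. -/
theorem isStableEquiv_of_qIso (hD : Detects.{u} B) {M N : GrMod.{u} B} (hM : M.BoundedBelow)
    (hN : N.BoundedBelow) (f : M ⟶ N) (hf : ∀ i, QIso f (SubA1.Q i)) : IsStableEquiv f := by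
  set φ := sumLift f (hullι M) with hφ
  have hC : Projective (coker φ) := projective_of_acyc hD
    (boundedBelow_of_surjective (cokerπ φ) (cokerπ_surjective φ)
      (boundedBelow_directSum hN (boundedBelow_hull hM)))
    (fun i => acyc_coker (Kit.Q_sq i) f _ (hullι_injective M)
      (acyc_of_projective (projective_hull M) i) (hf i))
  -- The cokernel is projective, so the sequence splits and `N ⊕ hull M` is isomorphic to `M ⊕ coker
  -- φ`, a sum in which both added terms are projective.
  obtain ⟨s, hs⟩ := projective_iff.1 hC _ _ (𝟙 _) (cokerπ φ) (cokerπ_surjective φ)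
  have hs' : ∀ c, lin (cokerπ φ) (lin s c) = c := fun c =>
    congrArg (fun g => lin g c) hs
  have hφπ : ∀ m, lin (cokerπ φ) (lin φ m) = 0 := fun m => (cokerπ_eq_zero φ _).2 ⟨m, rfl⟩
  have hΨ : Function.Bijective (lin (sumDesc φ s)) := by
    constructor
    · refine (injective_iff_map_eq_zero _).2 fun x hx => ?_
      obtain ⟨m, c, rfl⟩ := exists_sp x
      rw [lin_sumDesc] at hx
      have h2 := congrArg (lin (cokerπ φ)) hx
      rw [map_add, hφπ, hs', zero_add, map_zero] at h2
      rw [h2, map_zero, add_zero, hφ, lin_sumLift, sp_zero, sp_inj] at hx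
      rw [sp_zero, sp_inj]
      exact ⟨hullι_injective M (by rw [hx.2, map_zero]), h2⟩
    · intro y
      have : y - lin s (lin (cokerπ φ) y) ∈ LinearMap.range (lin φ) := by
        rw [← cokerπ_eq_zero, map_sub, hs', sub_self]
      obtain ⟨m, hm⟩ := this
      exact ⟨sp m (lin (cokerπ φ) y), by rw [lin_sumDesc, hm, sub_add_cancel]⟩
  set r := homInv _ hΨ ≫ sumFst M (coker φ) with hr
  have hrΨ : ∀ m c, lin r (lin (sumDesc φ s) (sp m c)) = m := fun m c => by
    rw [← lin_comp_apply, hr, ← Category.assoc, comp_homInv, Category.id_comp, lin_sumFst]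
  have hr1 : ∀ m, lin r (lin φ m) = m := fun m => by
    have h1 := hrΨ m 0
    rwa [lin_sumDesc, map_zero, add_zero] at h1
  have hr2 : ∀ y, lin φ (lin r y) = y - lin s (lin (cokerπ φ) y) := fun y => by
    obtain ⟨x, rfl⟩ := hΨ.2 y
    obtain ⟨m, c, rfl⟩ := exists_sp x
    rw [hrΨ, lin_sumDesc, map_add, hφπ, hs', zero_add, add_sub_cancel_right]
  -- The stable inverse is the retraction `r` restricted to `N`. From `r φ = 1`, the composite on
  -- `M` differs from the identity by a map through `hull M`. From `φ r = 1 - s π`, the composite on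
  -- `N` differs from it by a map through `coker φ`.
  refine ⟨sumInl N (hull M) ≫ r, ⟨hull M, projective_hull M, hullι M, sumInr N (hull M) ≫ r, ?_⟩,
    ⟨coker φ, hC, sumInl N (hull M) ≫ cokerπ φ, s ≫ sumFst N (hull M), ?_⟩⟩
  · refine LinearMap.ext fun m => ?_
    rw [LinearMap.sub_apply, lin_id, LinearMap.id_apply]
    simp only [lin_comp_apply, lin_sumInl, lin_sumInr]
    have h1 := hr1 m
    have h2 : lin φ m = sp (lin f m) 0 + sp 0 (lin (hullι M) m) := by
      rw [sp_add, add_zero, zero_add, hφ, lin_sumLift]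
    rw [h2, map_add] at h1
    rw [sub_F2]
    apply eq_of_add_eq_zero_F2
    rw [add_assoc, add_comm m, ← add_assoc, h1, add_self_F2]
  · refine LinearMap.ext fun n => ?_
    rw [LinearMap.sub_apply, lin_id, LinearMap.id_apply]
    simp only [lin_comp_apply, lin_sumInl]
    obtain ⟨x, y, hxy⟩ := exists_sp (lin s (lin (cokerπ φ) (sp n 0)))
    have h1 := hr2 (sp n 0)
    rw [hxy, sp_sub] at h1
    replace h1 := (sp_inj.1 h1)
    rw [hxy, lin_sumFst, h1.1, sub_F2 n, sub_F2, add_comm n x, add_assoc, add_self_F2, add_zero]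

end Margolis

end GrMod

end StMod

namespace StMod

namespace GrMod

/-! ### The stable category, the unit and distributivity -/

section Stable

variable {B : Type} [Ring B] [Bialgebra F2 B] [GrBialg B] {M N K : GrMod.{u} B}

theorem stablyEq_iff {f g : M ⟶ N} : StablyEq f g ↔ ∃ (P : GrMod.{u} B) (_ : Projective P)
    (i : M ⟶ P) (p : P ⟶ N), ∀ x, lin f x = lin g x + lin p (lin i x) := by
  refine exists_congr fun P => exists_congr fun _ => exists_congr fun i => exists_congr fun p => ?_
  rw [LinearMap.ext_iff]
  refine forall_congr' fun x => ?_
  rw [LinearMap.sub_apply, sub_eq_iff_eq_add, add_comm]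
  rfl

theorem StablyEq.of_eq {f g : M ⟶ N} (h : f = g) (P : GrMod.{u} B) (hP : Projective P) :
    StablyEq f g :=
  stablyEq_iff.2 ⟨P, hP, zeroHom M P, zeroHom P N, fun x => by rw [h]; exact (add_zero _).symm⟩

theorem StablyEq.comp_right {f g : M ⟶ N} (h : StablyEq f g) (k : N ⟶ K) :
    StablyEq (f ≫ k) (g ≫ k) := by
  obtain ⟨P, hP, i, p, hip⟩ := stablyEq_iff.1 h
  exact stablyEq_iff.2 ⟨P, hP, i, p ≫ k, fun x => by simp only [lin_comp_apply, hip, map_add]⟩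

theorem StablyEq.comp_left {f g : M ⟶ N} (h : StablyEq f g) (k : K ⟶ M) :
    StablyEq (k ≫ f) (k ≫ g) := by
  obtain ⟨P, hP, i, p, hip⟩ := stablyEq_iff.1 h
  exact stablyEq_iff.2 ⟨P, hP, k ≫ i, p, fun x => by simp only [lin_comp_apply, hip]⟩

theorem StablyIso.symm' (h : StablyIso M N) : StablyIso N M := by
  obtain ⟨f, g, h1, h2⟩ := h
  exact ⟨g, f, h2, h1⟩

theorem IsStableEquiv.comp_bijective {f : M ⟶ N} (hf : IsStableEquiv f) {e : N ⟶ K}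
    (he : Function.Bijective (lin e)) : IsStableEquiv (f ≫ e) := by
  obtain ⟨g, h1, h2⟩ := hf
  refine ⟨homInv e he ≫ g, ?_, ?_⟩
  · rw [Category.assoc, ← Category.assoc e, comp_homInv, Category.id_comp]
    exact h1
  · have := (h2.comp_left (homInv e he)).comp_right e
    rw [Category.comp_id, homInv_comp] at this
    simpa only [Category.assoc] using this

/-- A map through an acyclic module takes cycles to boundaries, so stably equal maps agree on
homology and stable inverses induce inverse maps. -/
theorem qIso_of_isStableEquiv {q : B} (hP : ∀ P : GrMod.{u} B, Projective P → P.Acyc q)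
    {f : M ⟶ N} (hf : IsStableEquiv f) : QIso f q := by
  have key : ∀ {X Y : GrMod.{u} B} (f : X ⟶ Y) (g : Y ⟶ X), StablyEq (f ≫ g) (𝟙 X) →
      ∀ v, X.ρ q v = 0 → ∃ u, v = lin g (lin f v) + X.ρ q u := by
    intro X Y f g h v hv
    obtain ⟨P, hP', i, p, hip⟩ := stablyEq_iff.1 h
    obtain ⟨w, hw⟩ := hP P hP' (lin i v) (by rw [← lin_ρ, hv, map_zero])
    have h1 := hip v
    rw [← hw, lin_ρ] at h1
    refine ⟨lin p w, ?_⟩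
    change lin g (lin f v) = v + _ at h1
    rw [h1, add_assoc, add_self_F2, add_zero]
  obtain ⟨g, h1, h2⟩ := hf
  constructor
  · rintro v hv ⟨w, hw⟩
    obtain ⟨u, hu⟩ := key f g h1 v hv
    exact ⟨lin g w + u, by rw [map_add, ← lin_ρ, hw, ← hu]⟩
  · intro w hw
    obtain ⟨u, hu⟩ := key g f h2 w hw
    exact ⟨lin g w, u, by rw [← lin_ρ, hw, map_zero], hu⟩

/-- The generator of the unit module. -/
def uone : (unit.{u} (B := B)).carrier := (ULift.up 1 : ULift.{u} F2)

theorem uone_mem : uone.{u} (B := B) ∈ (unit (B := B)).gr 0 := by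
  have h : (unit.{u} (B := B)).gr 0 = if (0 : ℤ) = 0 then ⊤ else ⊥ := rfl
  rw [h, if_pos rfl]
  trivial

theorem unit_cases (x : (unit.{u} (B := B)).carrier) : x = 0 ∨ x = uone := by
  rcases F2_cases (ULift.down x) with h | h
  · exact Or.inl (ULift.down_injective h)
  · exact Or.inr (ULift.down_injective h)

theorem unit_ρ (b : B) (x : (unit.{u} (B := B)).carrier) :
    unit.ρ b x = Coalgebra.counit (R := F2) b • x := rfl

theorem unit_mem_gr {n : ℤ} (hn : n ≠ 0) {x : (unit.{u} (B := B)).carrier}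
    (hx : x ∈ unit.gr n) : x = 0 := by
  have h : (unit.{u} (B := B)).gr n = ⊥ := if_neg hn
  rwa [h] at hx

/-- The linear map from the unit module with a given value at the generator. -/
noncomputable def unitLin {V : Type*} [AddCommGroup V] [Module F2 V] (x : V) :
    (unit.{u} (B := B)).carrier →ₗ[F2] V :=
  (LinearMap.toSpanSingleton F2 V x).comp
    (ULift.moduleEquiv (R := F2) (M := F2) : ULift.{u} F2 ≃ₗ[F2] F2).toLinearMap

theorem unitLin_uone {V : Type*} [AddCommGroup V] [Module F2 V] (x : V) :
    unitLin (B := B) x uone = x := one_smul F2 x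

theorem tact_uone (N : GrMod.{u} B) (Y : B ⊗[F2] B) (n : N.carrier) :
    tact unit N Y (tm uone n) = tm uone
      (N.ρ (TensorProduct.lid F2 B ((Coalgebra.counit (R := F2) (A := B)).rTensor B Y)) n) := by
  induction Y using TensorProduct.induction_on with
  | zero => simp [tm_zero]
  | add x y hx hy => simp only [map_add, LinearMap.add_apply, hx, hy, tm_add]
  | tmul b c =>
    rw [tact_tmul, unit_ρ, LinearMap.rTensor_tmul, TensorProduct.lid_tmul, map_smul,
      LinearMap.smul_apply]
    exact TensorProduct.smul_tmul _ _ _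

/-- The isomorphism `N → unit ⊗ N`. -/
noncomputable def unitorInv (N : GrMod.{u} B) : N ⟶ unit.tensor N :=
  mkHom (TensorProduct.mk F2 (unit.{u} (B := B)).carrier N.carrier uone)
    (fun _ _ hx => tm_mem uone_mem hx rfl)
    (fun b v => by
      change tm uone (N.ρ b v) = tact _ _ (Coalgebra.comul (R := F2) b) (tm uone v)
      rw [tact_uone, Coalgebra.rTensor_counit_comul, TensorProduct.lid_tmul, one_smul])

theorem lin_unitorInv (n : N.carrier) : lin (unitorInv N) n = tm uone n := rfl

theorem unitorInv_bijective (N : GrMod.{u} B) : Function.Bijective (lin (unitorInv N)) := by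
  constructor
  · refine Function.LeftInverse.injective (g := tlift (M := unit) (N := N)
      (unitLin LinearMap.id)) fun n => ?_
    rw [lin_unitorInv, tlift_tm, unitLin_uone]
    rfl
  · rw [← LinearMap.range_eq_top, eq_top_iff]
    intro x _
    refine tensor_induction (p := fun x => x ∈ LinearMap.range (lin (unitorInv N)))
      (Submodule.zero_mem _) (fun x y => Submodule.add_mem _) (fun x y => ?_) x
    rcases unit_cases x with rfl | rfl
    · rw [zero_tm]; exact Submodule.zero_mem _
    · exact ⟨y, rfl⟩

/-- The distributivity morphism `(X ⊕ Y) ⊗ N → (X ⊗ N) ⊕ (Y ⊗ N)`. -/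
noncomputable def distrib (X Y N : GrMod.{u} B) :
    (X.directSum Y).tensor N ⟶ (X.tensor N).directSum (Y.tensor N) :=
  sumLift (tensorHom (sumFst X Y) (𝟙 N)) (tensorHom (sumDesc (zeroHom X Y) (𝟙 Y)) (𝟙 N))

theorem distrib_bijective (X Y N : GrMod.{u} B) : Function.Bijective (lin (distrib X Y N)) := by
  rw [distrib]
  refine Function.bijective_iff_has_inverse.2 ⟨lin (sumDesc (tensorHom (sumInl X Y) (𝟙 N))
    (tensorHom (sumInr X Y) (𝟙 N))), fun z => ?_, fun z => ?_⟩
  · refine tensor_induction (p := fun z => lin (sumDesc (tensorHom (sumInl X Y) (𝟙 N))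
      (tensorHom (sumInr X Y) (𝟙 N))) (lin (sumLift (tensorHom (sumFst X Y) (𝟙 N))
      (tensorHom (sumDesc (zeroHom X Y) (𝟙 Y)) (𝟙 N))) z) = z) (by simp only [map_zero])
      (fun x y hx hy => by rw [map_add, map_add, hx, hy]) (fun x n => ?_) z
    obtain ⟨x, y, rfl⟩ := exists_sp x
    rw [lin_sumLift, lin_sumDesc, tensorHom_tm, tensorHom_tm, tensorHom_tm, tensorHom_tm,
      lin_sumInl, lin_sumInr, lin_sumFst, lin_sumDesc, lin_id, LinearMap.id_apply,
      LinearMap.id_apply, ← add_tm, sp_add, add_zero, zero_add, lin_id, LinearMap.id_apply]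
    congr 2
    exact zero_add y
  · obtain ⟨a, b, rfl⟩ := exists_sp z
    rw [lin_sumDesc, lin_sumLift, sp_inj]
    constructor
    · have h1 : tensorHom (sumInl X Y) (𝟙 N) ≫ tensorHom (sumFst X Y) (𝟙 N) = 𝟙 _ := by
        rw [tensorHom_comp, ← tensorHom_id]
        congr 1
        exact hom_ext (LinearMap.ext fun x => add_zero x)
      have h2 : ∀ b, lin (tensorHom (sumFst X Y) (𝟙 N)) (lin (tensorHom (sumInr X Y) (𝟙 N)) b) = 0 :=
        tensor_induction (by simp only [map_zero])
          (fun x y hx hy => by rw [map_add, map_add, hx, hy, add_zero])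
          (fun x y => by
            rw [tensorHom_tm, tensorHom_tm, lin_sumInr, lin_sumFst, zero_tm])
      rw [map_add, h2, add_zero, ← lin_comp_apply, h1]
      rfl
    · have h1 : tensorHom (sumInr X Y) (𝟙 N) ≫ tensorHom (sumDesc (zeroHom X Y) (𝟙 Y)) (𝟙 N) =
          𝟙 _ := by
        rw [tensorHom_comp, ← tensorHom_id]
        congr 1
        exact hom_ext (LinearMap.ext fun x => zero_add x)
      have h2 : ∀ a, lin (tensorHom (sumDesc (zeroHom X Y) (𝟙 Y)) (𝟙 N))
          (lin (tensorHom (sumInl X Y) (𝟙 N)) a) = 0 :=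
        tensor_induction (by simp only [map_zero])
          (fun x y hx hy => by rw [map_add, map_add, hx, hy, add_zero])
          (fun x y => by
            rw [tensorHom_tm, tensorHom_tm, lin_sumInl, lin_sumDesc, map_zero]
            exact (congrArg (fun z => tm z _) (add_zero _)).trans (zero_tm _))
      rw [map_add, h2, zero_add, ← lin_comp_apply, h1]
      rfl

end Stable

/-! ### Tensor functors induced by stably equivalent modules -/

section Functors

variable {B : Type} [Ring B] [Bialgebra F2 B] [GrBialg B] [SubA1 B] [Kit B] {M N X : GrMod.{u} B}

/-- A factorization through `P` becomes one through `P ⊗ N`, which is again projective. -/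
theorem StablyEq.tensorHom_id {f g : M ⟶ X} (h : StablyEq f g) (N : GrMod.{u} B) :
    StablyEq (tensorHom f (𝟙 N)) (tensorHom g (𝟙 N)) := by
  obtain ⟨P, hP, i, p, hip⟩ := stablyEq_iff.1 h
  refine stablyEq_iff.2 ⟨P.tensor N, projective_tensor hP N, tensorHom i (𝟙 N),
    tensorHom p (𝟙 N), fun x => ?_⟩
  refine tensor_induction (p := fun x => lin (tensorHom f (𝟙 N)) x =
    lin (tensorHom g (𝟙 N)) x + lin (tensorHom p (𝟙 N)) (lin (tensorHom i (𝟙 N)) x))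
    (by simp) (fun x y hx hy => ?_) (fun x y => ?_) x
  · simp only [map_add, hx, hy]
    abel
  · simp only [tensorHom_tm, hip, add_tm]
    rfl

theorem IsStableEquiv.tensorHom_id {f : M ⟶ X} (hf : IsStableEquiv f) (N : GrMod.{u} B) :
    IsStableEquiv (tensorHom f (𝟙 N)) := by
  obtain ⟨g, h1, h2⟩ := hf
  refine ⟨tensorHom g (𝟙 N), ?_, ?_⟩
  · have := h1.tensorHom_id N
    rwa [GrMod.tensorHom_id, ← Category.id_comp (𝟙 N), ← tensorHom_comp] at this
  · have := h2.tensorHom_id N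
    rwa [GrMod.tensorHom_id, ← Category.id_comp (𝟙 N), ← tensorHom_comp] at this

/-- A stable isomorphism `M ≃ X` yields one of the functors `M ⊗ -` and `X ⊗ -`, hence of `M ⊗ -`
and any functor isomorphic to `X ⊗ -`. -/
theorem stablyNatIso_of_stablyIso (h : StablyIso M X) (G : GrMod.{u} B ⥤ GrMod.{u} B)
    (e : ∀ N, X.tensor N ⟶ G.obj N) (he : ∀ N, Function.Bijective (lin (e N)))
    (hnat : ∀ (N N' : GrMod.{u} B) (g : N ⟶ N') x y,
      lin (e N') (tm x (lin g y)) = lin (G.map g) (lin (e N) (tm x y))) :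
    StablyNatIso (tensorFunctor M) G := by
  obtain ⟨f, hf⟩ := h
  refine ⟨fun N => tensorHom f (𝟙 N) ≫ e N, fun N => (hf.tensorHom_id N).comp_bijective (he N),
    fun N N' g => StablyEq.of_eq (hom_ext (tensor_lin_ext fun x y => ?_)) (free N)
      (projective_free N)⟩
  exact hnat N N' g (lin f x) y

theorem stablyNatIso_tensor (h : StablyIso M X) :
    StablyNatIso (tensorFunctor M) (tensorFunctor X) :=
  stablyNatIso_of_stablyIso h _ (fun N => 𝟙 (X.tensor N)) (fun _ => Function.bijective_id)
    (fun _ _ _ _ _ => rfl)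

theorem stablyNatIso_zero (h : StablyIso M zero) :
    StablyNatIso (tensorFunctor M) zeroFunctor := by
  have hz : ∀ (N : GrMod.{u} B) (x : ((zero (B := B)).tensor N).carrier), x = 0 := fun N =>
    tensor_induction rfl (fun x y hx hy => by rw [hx, hy, add_zero]) fun x y => by
      rw [show x = 0 from Subsingleton.elim (α := PUnit) _ _, zero_tm]
  exact stablyNatIso_of_stablyIso h _ (fun N => zeroHom _ _)
    (fun N => ⟨fun x y _ => by rw [hz N x, hz N y],
      fun y => ⟨0, Subsingleton.elim (α := PUnit) _ _⟩⟩)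
    (fun _ _ _ _ _ => rfl)

theorem stablyNatIso_unit (h : StablyIso M unit) :
    StablyNatIso (tensorFunctor M) (𝟭 (GrMod.{u} B)) := by
  have hinv : ∀ (N : GrMod.{u} B) (n : N.carrier),
      lin (homInv (unitorInv N) (unitorInv_bijective N)) (tm uone n) = n := fun N n => by
    rw [← lin_unitorInv, ← lin_comp_apply, comp_homInv]
    rfl
  refine stablyNatIso_of_stablyIso h _ (fun N => homInv (unitorInv N) (unitorInv_bijective N))
    (fun N => ?_) (fun N N' g x y => ?_)
  · exact Function.bijective_iff_has_inverse.2 ⟨lin (unitorInv N),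
      fun x => congrArg (fun g => lin g x) (homInv_comp _ (unitorInv_bijective N)),
      fun x => congrArg (fun g => lin g x) (comp_homInv _ (unitorInv_bijective N))⟩
  · rcases unit_cases x with rfl | rfl
    · rw [zero_tm, zero_tm, map_zero, map_zero, map_zero]
    · change lin (homInv (unitorInv N') (unitorInv_bijective N')) _ =
        lin g (lin (homInv (unitorInv N) (unitorInv_bijective N)) _)
      rw [hinv, hinv]

theorem stablyNatIso_sum {X Y : GrMod.{u} B} (h : StablyIso M (X.directSum Y)) :
    StablyNatIso (tensorFunctor M) (sumFunctor (tensorFunctor X) (tensorFunctor Y)) :=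
  stablyNatIso_of_stablyIso h _ (fun N => distrib X Y N) (fun N => distrib_bijective X Y N)
    (fun _ _ _ _ _ => rfl)

end Functors

end GrMod

end StMod

namespace StMod

namespace GrMod

/-! ### The Künneth theorem and modules with `H ⊗ H ≅ H` -/

section Kunneth

variable {B : Type} [Ring B] [Bialgebra F2 B] [GrBialg B]

/-- The homology of `M` with respect to `q` is one-dimensional, in degree `0`. -/
def OneDim (M : GrMod.{u} B) (q : B) : Prop :=
  ∃ z ∈ M.gr 0, M.ρ q z = 0 ∧ (¬ ∃ u, M.ρ q u = z) ∧
    ∀ v, M.ρ q v = 0 → (∃ u, M.ρ q u = v) ∨ ∃ u, v = z + M.ρ q u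

/-- A homogeneous deformation retraction of `M`, with differential `q`, onto its homology. -/
structure HomologyRetract (M : GrMod.{u} B) (q : B) where
  π : M.carrier →ₗ[F2] M.carrier
  h : M.carrier →ₗ[F2] M.carrier
  homog : Homog M.gr M.gr 0 π
  ρ_π : ∀ v, M.ρ q (π v) = 0
  π_ρ : ∀ v, π (M.ρ q v) = 0
  π_π : ∀ v, π (π v) = π v
  homotopy : ∀ v, M.ρ q (h v) + h (M.ρ q v) = v + π v

/-- Write `d` for the action of `q` and take a homogeneous `g` with `d g d = d`. Then `π = (1 +
dg)(1 + gd)` and `h = g + g g d` satisfy `d h + h d = 1 + π`, by expansion with `d² = 0` in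
characteristic two. -/
theorem exists_homologyRetract (M : GrMod.{u} B) {q : B} {k : ℤ} (hq : q ∈ GrBialg.deg k)
    (hqq : q * q = 0) : Nonempty (HomologyRetract M q) := by
  obtain ⟨g, hg, hdg⟩ := (homog_ρ M hq).exists_genInverse M.isInternal
  have dd : ∀ v, M.ρ q (M.ρ q v) = 0 := fun v => by rw [← ρ_mul, hqq]; simp
  refine ⟨{
    π := (LinearMap.id + (M.ρ q).comp g).comp (LinearMap.id + g.comp (M.ρ q))
    h := g + g.comp (g.comp (M.ρ q))
    homog := ?_
    ρ_π := fun v => ?_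
    π_ρ := fun v => ?_
    π_π := fun v => ?_
    homotopy := fun v => ?_ }⟩
  · have h1 : ∀ n, ∀ v ∈ M.gr n, v + g (M.ρ q v) ∈ M.gr n := fun n v hv =>
      Submodule.add_mem _ hv (by simpa using hg _ _ (M.smul_mem k q hq n v hv))
    have h2 : ∀ n, ∀ v ∈ M.gr n, v + M.ρ q (g v) ∈ M.gr n := fun n v hv =>
      Submodule.add_mem _ hv (by simpa using M.smul_mem k q hq _ _ (hg n v hv))
    intro n v hv
    rw [zero_add]
    exact h2 n _ (h1 n v hv)
  all_goals
    simp only [LinearMap.comp_apply, LinearMap.add_apply, LinearMap.id_apply, map_add, hdg, dd,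
      map_zero, add_zero, add_self_F2]
  abel_nf
  simp only [two_zsmul, add_self_F2, add_zero]

variable {M : GrMod.{u} B} {q : B}

theorem HomologyRetract.acyc (r : HomologyRetract M q) (h : ∀ v, r.π v = 0) : M.Acyc q :=
  fun v hv => ⟨r.h v, by simpa [hv, h v] using r.homotopy v⟩

theorem HomologyRetract.eq_add (r : HomologyRetract M q) {v : M.carrier} (hv : M.ρ q v = 0) :
    v = r.π v + M.ρ q (r.h v) := by
  have := r.homotopy v
  rw [hv, map_zero, add_zero] at this
  rw [this, add_comm, add_assoc, add_self_F2, add_zero]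

/-- The Künneth theorem. -/
noncomputable def HomologyRetract.tensor {N : GrMod.{u} B} (r : HomologyRetract M q)
    (s : HomologyRetract N q)
    (hq : Coalgebra.comul (R := F2) q = q ⊗ₜ 1 + 1 ⊗ₜ q) : HomologyRetract (M.tensor N) q where
  π := tmap r.π s.π
  -- The homotopy `h ⊗ 1 + π ⊗ h` deforms one factor after the other; in characteristic two it needs
  -- no signs.
  h := tmap r.h LinearMap.id + tmap r.π s.h
  homog := homog_tmap (k := 0) (l := 0) r.homog s.homog
  ρ_π v := by
    have : ((M.tensor N).ρ q).comp (tmap r.π s.π) = 0 := tensor_lin_ext fun x y => by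
      rw [LinearMap.comp_apply, tmap_tm, tensor_ρ_of_primitive hq, r.ρ_π, s.ρ_π, zero_tm, tm_zero,
        add_zero]
      rfl
    exact LinearMap.congr_fun this v
  π_ρ v := by
    have : (tmap r.π s.π).comp ((M.tensor N).ρ q) = 0 := tensor_lin_ext fun x y => by
      rw [LinearMap.comp_apply, tensor_ρ_of_primitive hq, map_add, tmap_tm, tmap_tm, r.π_ρ, s.π_ρ,
        zero_tm, tm_zero, add_zero]
      rfl
    exact LinearMap.congr_fun this v
  π_π v := by
    have : (tmap r.π s.π).comp (tmap r.π s.π) = tmap r.π s.π := tensor_lin_ext fun x y => by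
      rw [LinearMap.comp_apply, tmap_tm, tmap_tm, r.π_π, s.π_π]
    exact LinearMap.congr_fun this v
  homotopy v := by
    have : ((M.tensor N).ρ q).comp (tmap r.h LinearMap.id + tmap r.π s.h) +
        (tmap r.h LinearMap.id + tmap r.π s.h).comp ((M.tensor N).ρ q) =
        LinearMap.id + tmap r.π s.π := tensor_lin_ext fun x y => by
      have hx : r.h (M.ρ q x) = M.ρ q (r.h x) + (x + r.π x) := by
        rw [← r.homotopy x, ← add_assoc, add_self_F2, zero_add]
      have hy : s.h (N.ρ q y) = N.ρ q (s.h y) + (y + s.π y) := by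
        rw [← s.homotopy y, ← add_assoc, add_self_F2, zero_add]
      simp only [LinearMap.add_apply, LinearMap.comp_apply, LinearMap.id_apply, map_add, tmap_tm,
        tensor_ρ_of_primitive hq, r.ρ_π, r.π_ρ, zero_tm, hx, hy, tm_add, add_tm]
      apply eq_of_add_eq_zero_F2
      abel_nf
      simp only [two_zsmul, add_self_F2]
    exact LinearMap.congr_fun this v

/-- The harmonic elements of degree `n`. -/
noncomputable def HomologyRetract.harm (r : HomologyRetract M q) (n : ℤ) : Submodule F2 M.carrier :=
  M.gr n ⊓ LinearMap.eqLocus r.π LinearMap.id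

theorem HomologyRetract.mem_harm (r : HomologyRetract M q) {n : ℤ} {v : M.carrier} :
    v ∈ r.harm n ↔ v ∈ M.gr n ∧ r.π v = v := Iff.rfl

theorem HomologyRetract.π_mem_harm (r : HomologyRetract M q) {n : ℤ} {v : M.carrier}
    (hv : v ∈ M.gr n) : r.π v ∈ r.harm n :=
  ⟨by simpa using r.homog n v hv, r.π_π v⟩

/-- A harmonic boundary `v = π v = π (q u)` is zero, so harmonic elements embed into Margolis
homology. -/
theorem HomologyRetract.finite_harm (r : HomologyRetract M q) (n : ℤ)
    (hfin : Module.Finite F2 (MargolisH M q n)) : Module.Finite F2 (r.harm n) := by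
  let f : r.harm n →ₗ[F2] MargolisH M q n := (Submodule.mkQ _).comp
    (Submodule.inclusion (fun v hv => ⟨by
      have := r.ρ_π v
      rwa [hv.2] at this, hv.1⟩ : r.harm n ≤ LinearMap.ker (M.ρ q) ⊓ M.gr n))
  refine Module.Finite.of_injective f ((injective_iff_map_eq_zero f).2 fun v hv => ?_)
  rw [LinearMap.comp_apply, Submodule.mkQ_apply, Submodule.Quotient.mk_eq_zero] at hv
  obtain ⟨u, hu⟩ := hv
  apply Subtype.ext
  have h1 : M.ρ q u = v.1 := hu
  have h2 : r.π v.1 = v.1 := v.2.2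
  rw [ZeroMemClass.coe_zero, ← h2, ← h1, r.π_ρ]

theorem HomologyRetract.exists_harm_ne (r : HomologyRetract M q) (h : ¬ M.Acyc q) :
    ∃ n, r.harm n ≠ ⊥ := by
  by_contra! h'
  refine h (r.acyc (gr_induction M.isInternal (map_zero _) (fun x y hx hy => by
    rw [map_add, hx, hy, add_zero]) fun n x hx => ?_))
  have := r.π_mem_harm hx
  rwa [h' n] at this

/-- The dimension `d` of `U` satisfies `2d ≤ d`. -/
theorem eq_bot_of_injective_prod {V : Type*} [AddCommGroup V] [Module F2 V] (U : Submodule F2 V)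
    [Module.Finite F2 U] (f : U × U →ₗ[F2] U) (hf : Function.Injective f) : U = ⊥ := by
  have := LinearMap.finrank_le_finrank_of_injective hf
  rw [Module.finrank_prod] at this
  exact Submodule.finrank_eq_zero.1 (by omega)

theorem tm_eq_zero {N : GrMod.{u} B} {x : M.carrier} {y : N.carrier} (hx : x ≠ 0)
    (h : tm x y = 0) : y = 0 := by
  obtain ⟨f, hf, -⟩ := exists_functional (S := ⊥) (x := x) (by simpa using hx)
  have := congrArg (tlift ((LinearMap.lsmul F2 N.carrier).comp f)) h
  rw [tlift_tm, map_zero, LinearMap.comp_apply, hf] at this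
  simpa using this

theorem tm_eq_zero' {N : GrMod.{u} B} {x : M.carrier} {y : N.carrier} (hy : y ≠ 0)
    (h : tm x y = 0) : x = 0 := by
  obtain ⟨f, hf, -⟩ := exists_functional (S := ⊥) (x := y) (by simpa using hy)
  have := congrArg (tlift ((LinearMap.lsmul F2 M.carrier).flip.compl₂ f)) h
  rw [tlift_tm, map_zero, LinearMap.compl₂_apply, LinearMap.flip_apply, hf] at this
  simpa using this

/-- Injectivity of `φ` on homology, in terms of harmonic representatives: `lin φ t` has zero
harmonic part and so bounds, hence `t` bounds, and a harmonic boundary is zero. -/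
theorem HomologyRetract.square_inj (r : HomologyRetract M q)
    (hq : Coalgebra.comul (R := F2) q = q ⊗ₜ 1 + 1 ⊗ₜ q) {φ : M.tensor M ⟶ M} (hφ : QIso φ q)
    {t : (M.tensor M).carrier} (ht : tmap r.π r.π t = t)
    (h : r.π (lin φ t) = 0) : t = 0 := by
  have ht' : (r.tensor r hq).π t = t := ht
  have h1 : (M.tensor M).ρ q t = 0 := by rw [← ht']; exact (r.tensor r hq).ρ_π t
  have h2 := r.eq_add (v := lin φ t) (by rw [← lin_ρ, h1, map_zero])
  rw [h, zero_add] at h2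
  obtain ⟨u, hu⟩ := hφ.inj t h1 ⟨_, h2.symm⟩
  rw [← ht', ← hu, (r.tensor r hq).π_ρ]

/-- Surjectivity of `φ` on homology, in terms of harmonic representatives. Homogeneity of the
projections and of `φ` allows a preimage of the same degree. -/
theorem HomologyRetract.square_surj (r : HomologyRetract M q)
    (hq : Coalgebra.comul (R := F2) q = q ⊗ₜ 1 + 1 ⊗ₜ q) {φ : M.tensor M ⟶ M} (hφ : QIso φ q)
    {n : ℤ} {v : M.carrier} (hv : v ∈ r.harm n) :
    ∃ t ∈ (M.tensor M).gr n, v = r.π (lin φ (tmap r.π r.π t)) := by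
  have h1 : M.ρ q v = 0 := (congrArg (M.ρ q) hv.2).symm.trans (r.ρ_π v)
  obtain ⟨t, w, ht, htw⟩ := hφ.surj v h1
  have h2 := (r.tensor r hq).eq_add ht
  have h3 : v = r.π (lin φ (tmap r.π r.π t)) := by
    have : v = r.π (lin φ t) := by
      have := congrArg r.π htw
      rwa [map_add, r.π_ρ, add_zero, show r.π v = v from hv.2] at this
    rw [this]
    conv_lhs => rw [h2]
    rw [map_add, map_add, lin_ρ, r.π_ρ, add_zero]
    rfl
  refine ⟨pr (M.tensor M).isInternal n t, pr_mem _ _ _, ?_⟩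
  have e1 := pr_homog (M.tensor M).isInternal (M.tensor M).isInternal (r.tensor r hq).homog n t
  have e2 := pr_homog (M.tensor M).isInternal M.isInternal (homog_lin φ) n (tmap r.π r.π t)
  have e3 := pr_homog M.isInternal M.isInternal r.homog n (lin φ (tmap r.π r.π t))
  rw [zero_add] at e1 e2 e3
  change _ = tmap r.π r.π (pr _ _ _) at e1
  rw [← e1]
  change v = r.π (lin φ (pr _ n (tmap r.π r.π t)))
  rw [← e2, ← e3, ← h3, pr_of_mem _ hv.1]

/-- The product of harmonic elements. -/
theorem HomologyRetract.harm_mul (r : HomologyRetract M q) (φ : M.tensor M ⟶ M)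
    {i j n : ℤ} {x y : M.carrier} (hx : x ∈ r.harm i)
    (hy : y ∈ r.harm j) (h : i + j = n) : r.π (lin φ (tm x y)) ∈ r.harm n :=
  r.π_mem_harm (lin_mem φ (tm_mem hx.1 hy.1 h))

/-- Two independent copies of `H_n` inside `(H ⊗ H)_n ≅ H_n` force `H_n = 0` by dimension. -/
theorem HomologyRetract.harm_eq_bot (r : HomologyRetract M q)
    (hq : Coalgebra.comul (R := F2) q = q ⊗ₜ 1 + 1 ⊗ₜ q) {φ : M.tensor M ⟶ M} (hφ : QIso φ q)
    [∀ n, Module.Finite F2 (r.harm n)] {n : ℤ}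
    (F : r.harm n × r.harm n →ₗ[F2] (M.tensor M).carrier) (hF : Function.Injective F)
    (hF1 : ∀ x, tmap r.π r.π (F x) = F x) (hF2 : ∀ x, F x ∈ (M.tensor M).gr n) :
    r.harm n = ⊥ := by
  refine eq_bot_of_injective_prod (r.harm n) ((r.π.comp ((lin φ).comp F)).codRestrict (r.harm n)
    fun x => r.π_mem_harm (lin_mem φ (hF2 x))) ((injective_iff_map_eq_zero _).2 fun x hx => hF ?_)
  rw [map_zero]
  exact r.square_inj hq hφ (hF1 x) (congrArg Subtype.val hx)

/-- Let `a` be the lowest degree of `H` and `z` a nonzero class there. Then `z ⊗ z` shows `2a ≥ a`,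
while hitting `z` from `H ⊗ H` shows `2a ≤ a`, so `a = 0`. Tensoring with `z` then doubles every
`H_n` with `n ≠ 0`, and a second class in `H_0` would double `H_0`. -/
theorem acyc_or_oneDim_of_retract (r : HomologyRetract M q)
    (hq : Coalgebra.comul (R := F2) q = q ⊗ₜ 1 + 1 ⊗ₜ q) {φ : M.tensor M ⟶ M} (hφ : QIso φ q)
    (hM : M.BoundedBelow)
    (hfin : ∀ n, Module.Finite F2 (MargolisH M q n)) : M.Acyc q ∨ M.OneDim q := by
  by_cases hac : M.Acyc q
  · exact Or.inl hac
  right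
  have hf : ∀ n, Module.Finite F2 (r.harm n) := fun n => r.finite_harm n (hfin n)
  obtain ⟨b, hb⟩ := hM
  obtain ⟨a, ha, ha'⟩ := Int.exists_least_of_bdd (P := fun n => r.harm n ≠ ⊥)
    ⟨b, fun z hz => not_lt.1 fun h => hz (eq_bot_iff.2 (inf_le_left.trans (hb z h).le))⟩
    (r.exists_harm_ne hac)
  have hlow : ∀ n < a, r.harm n = ⊥ := fun n hn => by_contra fun h => not_lt.2 (ha' n h) hn
  obtain ⟨z, hz, hz0⟩ := Submodule.exists_mem_ne_zero_of_ne_bot ha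
  have hzz : tm z z ≠ 0 := fun h => hz0 (tm_eq_zero hz0 h)
  have h1 : a ≤ a + a := ha' _ fun h => hzz (r.square_inj hq hφ
    (by rw [tmap_tm, hz.2]; rfl) (by
      have := r.harm_mul φ hz hz rfl
      rwa [h] at this))
  -- If `a > 0`, every splitting `i + j = a` has `i < a` or `j < a`, so the harmonic part of the
  -- tensor square vanishes in degree `a`, and `z` could not be hit.
  have h2 : a ≤ 0 := by
    by_contra h
    obtain ⟨t, ht, htv⟩ := r.square_surj hq hφ hz
    have : tmap r.π r.π t = 0 := by
      refine (tensor_gr_le (S := LinearMap.ker (tmap r.π r.π)) fun i j x hx y hy hij => ?_) ht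
      rw [LinearMap.mem_ker, tmap_tm]
      rcases lt_or_ge i a with hi | hi
      · have := r.π_mem_harm hx
        rw [hlow i hi, Submodule.mem_bot] at this
        rw [this, zero_tm]
      · have := r.π_mem_harm hy
        rw [hlow j (by omega), Submodule.mem_bot] at this
        rw [this, tm_zero]
    rw [this, map_zero, map_zero] at htv
    exact hz0 htv
  obtain rfl : a = 0 := by omega
  have hπz : r.π z = z := hz.2
  -- For `n ≠ 0` the subspaces `z ⊗ H_n` and `H_n ⊗ z` are independent: a functional with value `1`
  -- at `z` that vanishes on degree `n` separates them.
  have hne : ∀ n, n ≠ 0 → r.harm n = ⊥ := fun n hn => by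
    obtain ⟨f, hfz, hf0⟩ := exists_functional (S := M.gr n) (x := z)
      fun h => hz0 (eq_zero_of_mem_of_mem M.isInternal hz.1 h hn.symm)
    refine r.harm_eq_bot hq hφ (LinearMap.coprod
      ((TensorProduct.mk F2 M.carrier M.carrier z).comp (r.harm n).subtype)
      (((TensorProduct.mk F2 M.carrier M.carrier).flip z).comp (r.harm n).subtype)) ?_ ?_ ?_
    · refine (injective_iff_map_eq_zero _).2 fun x hx => ?_
      change tm z x.1.1 + tm x.2.1 z = 0 at hx
      have := congrArg (tlift ((LinearMap.lsmul F2 M.carrier).comp f)) hx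
      rw [map_add, tlift_tm, tlift_tm, map_zero, LinearMap.comp_apply, LinearMap.comp_apply, hfz,
        hf0 _ x.2.2.1, map_zero, LinearMap.zero_apply, add_zero] at this
      have h3 : x.1.1 = 0 := by simpa using this
      rw [h3, tm_zero, zero_add] at hx
      exact Prod.ext (Subtype.ext h3) (Subtype.ext (tm_eq_zero' hz0 hx))
    · intro x
      change tmap r.π r.π (tm z x.1.1 + tm x.2.1 z) = tm z x.1.1 + tm x.2.1 z
      rw [map_add, tmap_tm, tmap_tm, hπz, show r.π x.1.1 = x.1.1 from x.1.2.2,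
        show r.π x.2.1 = x.2.1 from x.2.2.2]
    · exact fun x => Submodule.add_mem _ (tm_mem hz.1 x.1.2.1 (zero_add n))
        (tm_mem x.2.2.1 hz.1 (add_zero n))
  -- A class `y` independent of `z` would give independent copies `z ⊗ H_0` and `y ⊗ H_0`,
  -- contradicting `H_0 ≠ 0`.
  have h0 : ∀ y ∈ r.harm 0, y = 0 ∨ y = z := fun y hy => by
    by_contra! hyz
    obtain ⟨hy0, hyz⟩ := hyz
    have hsp : z ∉ Submodule.span F2 {y} := fun h => by
      obtain ⟨c, rfl⟩ := Submodule.mem_span_singleton.1 h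
      rcases F2_cases c with rfl | rfl
      · exact hz0 (zero_smul _ _)
      · exact hyz (one_smul _ _).symm
    obtain ⟨f, hfz, hf0⟩ := exists_functional hsp
    refine ha (r.harm_eq_bot hq hφ (LinearMap.coprod
      ((TensorProduct.mk F2 M.carrier M.carrier z).comp (r.harm 0).subtype)
      ((TensorProduct.mk F2 M.carrier M.carrier y).comp (r.harm 0).subtype)) ?_ ?_ ?_)
    · refine (injective_iff_map_eq_zero _).2 fun x hx => ?_
      change tm z x.1.1 + tm y x.2.1 = 0 at hx
      have := congrArg (tlift ((LinearMap.lsmul F2 M.carrier).comp f)) hx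
      rw [map_add, tlift_tm, tlift_tm, map_zero, LinearMap.comp_apply, LinearMap.comp_apply, hfz,
        hf0 y (Submodule.mem_span_singleton_self y), map_zero, LinearMap.zero_apply,
        add_zero] at this
      have h3 : x.1.1 = 0 := by simpa using this
      rw [h3, tm_zero, zero_add] at hx
      exact Prod.ext (Subtype.ext h3) (Subtype.ext (tm_eq_zero hy0 hx))
    · intro x
      change tmap r.π r.π (tm z x.1.1 + tm y x.2.1) = tm z x.1.1 + tm y x.2.1
      rw [map_add, tmap_tm, tmap_tm, hπz, show r.π x.1.1 = x.1.1 from x.1.2.2,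
        show r.π x.2.1 = x.2.1 from x.2.2.2, show r.π y = y from hy.2]
    · exact fun x => Submodule.add_mem _ (tm_mem hz.1 x.1.2.1 (zero_add 0))
        (tm_mem hy.1 x.2.2.1 (zero_add 0))
  refine ⟨z, hz.1, by rw [← hπz]; exact r.ρ_π z, fun ⟨u, hu⟩ => hz0 (by
    rw [← hπz, ← hu, r.π_ρ]), fun v hv => ?_⟩
  have hv' := r.eq_add hv
  have hπv : r.π v = pr M.isInternal 0 (r.π v) := ext_pr M.isInternal fun n => by
    by_cases hn : n = 0
    · subst hn; rw [pr_of_mem _ (pr_mem M.isInternal 0 _)]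
    · rw [pr_of_ne _ (pr_mem M.isInternal 0 _) (Ne.symm hn)]
      have e := pr_homog M.isInternal M.isInternal r.homog n v
      rw [zero_add] at e
      rw [e]
      have := r.π_mem_harm (pr_mem M.isInternal n v)
      rwa [hne n hn] at this
  have h3 : r.π v ∈ r.harm 0 := by
    refine r.mem_harm.2 ⟨?_, r.π_π v⟩
    rw [hπv]
    exact pr_mem _ _ _
  rcases h0 _ h3 with h | h
  · rw [h, zero_add] at hv'
    exact Or.inl ⟨_, hv'.symm⟩
  · rw [h] at hv'
    exact Or.inr ⟨_, hv'⟩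

/-- The homology of a bounded below module of finite type with `H(M) ⊗ H(M) ≅ H(M)` is trivial or
one-dimensional, in degree `0`. -/
theorem acyc_or_oneDim {k : ℤ} (hk : q ∈ GrBialg.deg k) (hqq : q * q = 0)
    (hq : Coalgebra.comul (R := F2) q = q ⊗ₜ 1 + 1 ⊗ₜ q) {φ : M.tensor M ⟶ M} (hφ : QIso φ q)
    (hM : M.BoundedBelow) (hfin : ∀ n, Module.Finite F2 (MargolisH M q n)) :
    M.Acyc q ∨ M.OneDim q := by
  obtain ⟨r⟩ := exists_homologyRetract M hk hqq
  exact acyc_or_oneDim_of_retract r hq hφ hM hfin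

end Kunneth

end GrMod

end StMod

namespace StMod

namespace GrMod

/-! ### Cycles in modules with homology at most one-dimensional -/

section Cycles

variable {B : Type} [Ring B] [Bialgebra F2 B] [GrBialg B] {M : GrMod.{u} B}

/-- Homology of dimension at most one, concentrated in degree `0`. -/
def Small (M : GrMod.{u} B) (q : B) : Prop := M.Acyc q ∨ M.OneDim q

theorem exists_ρ_preimage {k m n : ℤ} {b : B} (hb : b ∈ GrBialg.deg k) {w : M.carrier}
    (hw : w ∈ M.gr n) (h : ∃ u, M.ρ b u = w) (hm : k + m = n) : ∃ u ∈ M.gr m, M.ρ b u = w :=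
  (homog_ρ M hb).exists_preimage M.isInternal M.isInternal hw h m hm

/-- If `v` were homologous to the generator `z`, taking the component in degree `n ≠ 0` would remove
`z` and leave a boundary equal to `v`. -/
theorem Small.exists_of_ne_zero {q : B} {k n m : ℤ} (h : M.Small q) (hq : q ∈ GrBialg.deg k)
    {v : M.carrier} (hv : v ∈ M.gr n) (hn : n ≠ 0) (hv0 : M.ρ q v = 0)
    (hm : k + m = n) : ∃ u ∈ M.gr m, M.ρ q u = v := by
  refine exists_ρ_preimage hq hv ?_ hm
  rcases h with h | ⟨z, hz, -, -, h⟩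
  · exact h v hv0
  rcases h v hv0 with h | ⟨u, hu⟩
  · exact h
  refine ⟨pr M.isInternal m u, ?_⟩
  have h1 := pr_homog M.isInternal M.isInternal (homog_ρ M hq) m u
  rw [← h1, hm]
  have h2 := congrArg (pr M.isInternal n) hu
  rw [map_add, pr_of_mem _ hv, pr_of_ne _ hz hn.symm, zero_add] at h2
  exact h2.symm

/-- Two cycles that do not bound are both homologous to the one generator, so over `F₂` their sum
bounds. -/
theorem Small.cases {q : B} (h : M.Small q) {v w : M.carrier} (hv : M.ρ q v = 0)
    (hw : M.ρ q w = 0) :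
    (∃ u, M.ρ q u = v) ∨ (∃ u, M.ρ q u = w) ∨ ∃ u, M.ρ q u = v + w := by
  rcases h with h | ⟨z, -, -, -, h⟩
  · exact Or.inl (h v hv)
  rcases h v hv with h1 | ⟨u, hu⟩
  · exact Or.inl h1
  rcases h w hw with h2 | ⟨u', hu'⟩
  · exact Or.inr (Or.inl h2)
  refine Or.inr (Or.inr ⟨u + u', ?_⟩)
  rw [hu, hu', map_add]
  apply eq_of_add_eq_zero_F2
  abel_nf
  simp only [two_zsmul, add_self_F2]

/-- On a homology of dimension at most one the swap of factors acts trivially. If `v + w = q u`,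
then `q (u ⊗ w + w ⊗ u)` is the wanted element, since `w ⊗ w` appears twice. -/
theorem Small.exists_symm {q : B} (h : M.Small q)
    (hq : Coalgebra.comul (R := F2) q = q ⊗ₜ 1 + 1 ⊗ₜ q) {v w : M.carrier} (hv : M.ρ q v = 0)
    (hw : M.ρ q w = 0) : ∃ X, (M.tensor M).ρ q X = tm v w + tm w v := by
  rcases h.cases hv hw with ⟨u, rfl⟩ | ⟨u, rfl⟩ | ⟨u, hu⟩
  · exact ⟨tm u w + tm w u, by
      simp only [map_add, tensor_ρ_of_primitive hq, hw, tm_zero, zero_tm, add_zero, zero_add]⟩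
  · exact ⟨tm v u + tm u v, by
      simp only [map_add, tensor_ρ_of_primitive hq, hv, tm_zero, zero_tm, add_zero, zero_add]⟩
  · refine ⟨tm u w + tm w u, ?_⟩
    simp only [map_add, tensor_ρ_of_primitive hq, hw, hu, tm_zero, zero_tm, add_zero, zero_add,
      tm_add, add_tm]
    apply eq_of_add_eq_zero_F2
    abel_nf
    simp only [two_zsmul, add_self_F2]

/-- A functional `f` vanishing on boundaries with `f x = 1` gives `f ⊗ f`, which vanishes on
boundaries of the square but not at `x ⊗ x`. -/
theorem tm_self_not_boundary {q : B}
    (hq : Coalgebra.comul (R := F2) q = q ⊗ₜ 1 + 1 ⊗ₜ q) {x : M.carrier}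
    (hx : ¬ ∃ u, M.ρ q u = x) : ¬ ∃ X, (M.tensor M).ρ q X = tm x x := by
  obtain ⟨f, hfx, hf⟩ := exists_functional (S := LinearMap.range (M.ρ q)) (x := x) hx
  rintro ⟨X, hX⟩
  have : (tlift ((LinearMap.mul F2 F2).compl₁₂ f f)).comp ((M.tensor M).ρ q) = 0 :=
    tensor_lin_ext fun u v => by
      rw [LinearMap.comp_apply, tensor_ρ_of_primitive hq, map_add, tlift_tm, tlift_tm]
      simp [hf _ (LinearMap.mem_range_self _ u), hf _ (LinearMap.mem_range_self _ v)]
  have h1 := LinearMap.congr_fun this X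
  rw [LinearMap.comp_apply, hX, tlift_tm] at h1
  simp [hfx] at h1

end Cycles

/-! ### The zigzag between `Q₀` and `Q₁` -/

section Descent

variable {B : Type} [Ring B] [Bialgebra F2 B] [GrBialg B] [SubA1 B] [Kit B] {M : GrMod.{u} B}

theorem Q0_mem : SubA1.Q (B := B) 0 ∈ GrBialg.deg 1 := Kit.Q_mem (B := B) 0

theorem Q1_mem : SubA1.Q (B := B) 1 ∈ GrBialg.deg 3 := Kit.Q_mem (B := B) 1

theorem ρ_Q_Q (i : Fin 2) (v : M.carrier) : M.ρ (SubA1.Q i) (M.ρ (SubA1.Q i) v) = 0 := by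
  rw [← ρ_mul, Kit.Q_sq]; simp

theorem ρ_Q_comm (v : M.carrier) :
    M.ρ (SubA1.Q 0) (M.ρ (SubA1.Q 1) v) = M.ρ (SubA1.Q 1) (M.ρ (SubA1.Q 0) v) := by
  rw [← ρ_mul, Kit.Q_comm, ρ_mul]

/-- In degrees at most `0`, an element whose `Q₀` is a `Q₁`-boundary can be changed by a
`Q₁`-boundary into a `Q₀`-cycle. -/
theorem exists_Q0_cycle (hM : M.BoundedBelow) (h0 : M.Small (SubA1.Q 0))
    (h1 : M.Small (SubA1.Q 1)) {n : ℤ} (hn : n ≤ 0) {y : M.carrier} (hy : y ∈ M.gr n)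
    (h : ∃ s, M.ρ (SubA1.Q 1) s = M.ρ (SubA1.Q 0) y) :
    ∃ u ∈ M.gr (n - 3), M.ρ (SubA1.Q 0) (y + M.ρ (SubA1.Q 1) u) = 0 := by
  obtain ⟨N, hN⟩ := hM
  -- Induction on the distance from the lower bound; each step of the zigzag lowers the degree by
  -- `2`.
  suffices H : ∀ (k : ℕ) (n : ℤ), n ≤ 0 → n < N + k → ∀ y ∈ M.gr n,
      (∃ s, M.ρ (SubA1.Q 1) s = M.ρ (SubA1.Q 0) y) →
      ∃ u ∈ M.gr (n - 3), M.ρ (SubA1.Q 0) (y + M.ρ (SubA1.Q 1) u) = 0 from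
    H (n - N + 1).toNat n hn (by omega) y hy h
  intro k
  induction k with
  | zero =>
    intro n _ hn y hy _
    rw [hN n (by simpa using hn), Submodule.mem_bot] at hy
    exact ⟨0, Submodule.zero_mem _, by simp [hy]⟩
  | succ k ih =>
    intro n hn hnk y hy h
    -- With `Q₁ s = Q₀ y`, the element `Q₀ s` is a `Q₁`-cycle of negative degree, so `s` satisfies
    -- the same assumption as `y`. The corrected `s` is a `Q₀`-cycle of negative degree, say `Q₀ u`,
    -- and this `u` corrects `y`.
    obtain ⟨s, hs, hsy⟩ := exists_ρ_preimage (m := n - 2) Q1_mem (ρ_mem M Q0_mem hy rfl) h (by ring)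
    have e1 : M.ρ (SubA1.Q 1) (M.ρ (SubA1.Q 0) s) = 0 := by
      rw [← ρ_Q_comm, hsy, ρ_Q_Q]
    obtain ⟨r, -, hr⟩ := h1.exists_of_ne_zero (m := n - 4) Q1_mem
      (ρ_mem M Q0_mem hs rfl) (by omega) e1 (by ring)
    obtain ⟨u', hu', hsu⟩ := ih (n - 2) (by omega) (by push_cast at hnk; omega) s hs ⟨r, hr⟩
    obtain ⟨u, hu, hu2⟩ := h0.exists_of_ne_zero (n := n - 2) (m := n - 3) Q0_mem
      (Submodule.add_mem _ hs (ρ_mem M Q1_mem hu' (by ring))) (by omega) hsu (by ring)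
    refine ⟨u, hu, ?_⟩
    rw [map_add, ρ_Q_comm, hu2, map_add, ρ_Q_Q, add_zero, hsy, add_self_F2]

/-- For a generating `Q₁`-cycle `z`, the element `Q₀ z` is a `Q₁`-cycle of degree `1`, hence a
boundary. The descent then changes `z` within its `Q₁`-homology class into a `Q₀`-cycle. -/
theorem exists_unit_class (hM : M.BoundedBelow) (h0 : M.Small (SubA1.Q 0))
    (h1 : M.OneDim (SubA1.Q 1)) : ∃ x ∈ M.gr 0, M.ρ (SubA1.Q 0) x = 0 ∧ M.ρ (SubA1.Q 1) x = 0 ∧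
      ¬ ∃ u, M.ρ (SubA1.Q 1) u = x := by
  have h1' : M.Small (SubA1.Q 1) := Or.inr h1
  obtain ⟨z, hz, hz0, hz1, -⟩ := h1
  obtain ⟨r, -, hr⟩ := h1'.exists_of_ne_zero (m := -2) Q1_mem
      (ρ_mem M Q0_mem hz rfl) (by omega) (by rw [← ρ_Q_comm, hz0, map_zero]) (by ring)
  obtain ⟨u, hu, hzu⟩ := exists_Q0_cycle hM h0 h1' le_rfl hz ⟨r, hr⟩
  refine ⟨_, Submodule.add_mem _ hz (ρ_mem M Q1_mem hu (by ring)), hzu, ?_, ?_⟩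
  · rw [map_add, hz0, ρ_Q_Q, add_zero]
  · rintro ⟨v, hv⟩
    refine hz1 ⟨v + u, ?_⟩
    rw [map_add, hv, add_assoc, add_self_F2, add_zero]

end Descent

end GrMod

end StMod

namespace StMod

/-- A grading with coordinates: if every element of `B` is a combination of the homogeneous `e i`,
and linear functionals vanish on the elements of the wrong degree, the grading is internal. -/
theorem isInternal_of_coord {V : Type*} [AddCommGroup V] [Module F2 V] {ι : Type*} [Fintype ι]
    (𝒱 : ℤ → Submodule F2 V) (e : ι → V) (d : ι → ℤ) (he : ∀ i, e i ∈ 𝒱 (d i))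
    (c : V →ₗ[F2] (ι → F2)) (hec : ∀ v, v = ∑ i, c v i • e i)
    (hc : ∀ n, ∀ v ∈ 𝒱 n, ∀ i, d i ≠ n → c v i = 0) : DirectSum.IsInternal 𝒱 := by
  refine isInternal_of_finsupp 𝒱 (fun x => ?_) (∑ i, (Finsupp.lsingle (d i)).comp
    ((LinearMap.toSpanSingleton F2 V (e i)).comp ((LinearMap.proj i).comp c))) ?_
  · rw [hec x]
    exact Submodule.sum_mem _ fun i _ => Submodule.smul_mem _ _
      (Submodule.mem_iSup_of_mem (d i) (he i))
  · intro n v hv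
    have : ∀ i, Finsupp.single (d i) (c v i • e i) = Finsupp.single n (c v i • e i) := fun i => by
      by_cases h : d i = n
      · rw [h]
      · rw [hc n v hv i h]; simp
    simp only [LinearMap.sum_apply, LinearMap.comp_apply, LinearMap.toSpanSingleton_apply,
      LinearMap.proj_apply, Finsupp.lsingle_apply, this]
    conv_rhs => rw [hec v]
    exact (map_sum (Finsupp.lsingle (R := F2) n) _ _).symm

/-- The grading on a space of coordinate vectors. -/
def coordGr {ι : Type*} (d : ι → ℤ) (n : ℤ) : Submodule F2 (ι → F2) where
  carrier := {v | ∀ i, d i ≠ n → v i = 0}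
  add_mem' hx hy i hi := by rw [Pi.add_apply, hx i hi, hy i hi, add_zero]
  zero_mem' _ _ := rfl
  smul_mem' r x hx i hi := by rw [Pi.smul_apply, hx i hi, smul_zero]

/-! ### Explicit structure of `E(1)` -/

namespace E1

/-- Left multiplication by the generators in the basis `1, Q₀, Q₁, Q₀Q₁`. -/
def lmat : Fin 2 → Module.End F2 (Fin 4 → F2) :=
  ![{ toFun := fun v => ![0, v 0, 0, v 2]
      map_add' := fun x y => by ext i; fin_cases i <;> simp
      map_smul' := fun r x => by ext i; fin_cases i <;> simp },
    { toFun := fun v => ![0, 0, v 0, v 1]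
      map_add' := fun x y => by ext i; fin_cases i <;> simp
      map_smul' := fun r x => by ext i; fin_cases i <;> simp }]

theorem lmat_zero (v : Fin 4 → F2) : lmat 0 v = ![0, v 0, 0, v 2] := rfl

theorem lmat_one (v : Fin 4 → F2) : lmat 1 v = ![0, 0, v 0, v 1] := rfl

/-- The regular representation in coordinates. -/
noncomputable def rep : E1 →ₐ[F2] Module.End F2 (Fin 4 → F2) :=
  lift lmat (by ext v i; fin_cases i <;> simp [lmat_zero])
    (by ext v i; fin_cases i <;> simp [lmat_one])
    (by ext v i; fin_cases i <;> simp [lmat_one, lmat_zero])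

theorem rep_gen (i : Fin 2) : rep (gen i) = lmat i := lift_gen _ _ _ _ i

/-- The coordinates in the basis `1, Q₀, Q₁, Q₀Q₁`. -/
noncomputable def coord : E1 →ₗ[F2] (Fin 4 → F2) :=
  (LinearMap.applyₗ (![1, 0, 0, 0] : Fin 4 → F2)).comp rep.toLinearMap

theorem coord_one : coord 1 = ![1, 0, 0, 0] := by simp [coord]

theorem coord_gen_mul (i : Fin 2) (b : E1) : coord (gen i * b) = lmat i (coord b) := by
  simp [coord, rep_gen]

/-- The basis `1, Q₀, Q₁, Q₀Q₁`. -/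
noncomputable def word : Fin 4 → E1 := ![1, gen 0, gen 1, gen 0 * gen 1]

/-- The degrees of the basis elements. -/
def wordDegree : Fin 4 → ℤ := ![0, 1, 3, 4]

theorem adjoin (S : Subalgebra F2 E1) (hS : ∀ i, gen i ∈ S) : S = ⊤ := by
  refine eq_top_iff.2 fun b _ => ?_
  obtain ⟨x, rfl⟩ := RingQuot.mkAlgHom_surjective F2 E1Rel b
  induction x using FreeAlgebra.induction with
  | grade0 r => rw [AlgHom.commutes]; exact S.algebraMap_mem r
  | grade1 i => exact hS i
  | mul x y hx hy => rw [map_mul]; exact S.mul_mem (hx trivial) (hy trivial)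
  | add x y hx hy => rw [map_add]; exact S.add_mem (hx trivial) (hy trivial)

/-- The span of the words contains `1` and is stable under left multiplication by the generators;
the matrices `lmat` record that multiplication. Together with `coord_word` this shows that the words
form a basis. -/
theorem eq_sum_word (b : E1) : b = ∑ i, coord b i • word i := by
  refine induction_of_adjoin adjoin (p := fun b => b = ∑ i, coord b i • word i) ?_ ?_ ?_ ?_ b
  · simp [coord_one, word, Fin.sum_univ_four]
  · simp
  · intro x y hx hy
    simp only [map_add, Pi.add_apply, add_smul, Finset.sum_add_distrib, ← hx, ← hy]
  · intro i x hx
    rw [coord_gen_mul]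
    conv_lhs => rw [hx]
    fin_cases i
    · simp [lmat_zero, word, Fin.sum_univ_four, mul_add, gen00, ← mul_assoc]
    · simp [lmat_one, word, Fin.sum_univ_four, mul_add, gen11, gen01]
      simp [← mul_assoc, gen11]

theorem coord_word (i : Fin 4) : coord (word i) = Pi.single i 1 := by
  fin_cases i <;> ext j <;> fin_cases j <;> simp [coord, word, rep_gen, lmat_zero, lmat_one]

/-- The element with given coordinates. -/
noncomputable def ofCoord : (Fin 4 → F2) →ₗ[F2] E1 := Fintype.linearCombination F2 word

theorem ofCoord_coord (b : E1) : ofCoord (coord b) = b := (eq_sum_word b).symm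

theorem coord_ofCoord (v : Fin 4 → F2) : coord (ofCoord v) = v := by
  rw [ofCoord, Fintype.linearCombination_apply, map_sum]
  simp only [map_smul, coord_word]
  ext j
  simp [Finset.sum_apply, Pi.single_apply]

theorem coord_injective : Function.Injective coord := fun x y h => by
  rw [← ofCoord_coord x, h, ofCoord_coord]

theorem coord_mem {n : ℤ} {b : E1} (hb : b ∈ GrBialg.deg n) : coord b ∈ coordGr wordDegree n := by
  have := smul_mem_of_gen (g := gen) (w := ![1, 3]) rep (coordGr wordDegree) (fun i m v hv => by
    rw [rep_gen]
    intro j hj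
    have h0 := hv 0
    have h1 := hv 1
    have h2 := hv 2
    simp only [wordDegree] at hj h0 h1 h2
    fin_cases i <;> fin_cases j <;> simp [lmat_zero, lmat_one] at hj h0 h1 h2 ⊢ <;>
      first | exact h0 (by omega) | exact h1 (by omega) | exact h2 (by omega)) n b hb 0
    ![1, 0, 0, 0] (fun j hj => by fin_cases j <;> simp [wordDegree] at hj ⊢)
  rwa [add_zero] at this

theorem word_mem (i : Fin 4) : word i ∈ GrBialg.deg (B := E1) (wordDegree i) := by
  have h0 : gen 0 ∈ wordDeg gen ![1, 3] 1 := gen_mem_wordDeg gen ![1, 3] 0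
  have h1 : gen 1 ∈ wordDeg gen ![1, 3] 3 := gen_mem_wordDeg gen ![1, 3] 1
  change word i ∈ wordDeg gen ![1, 3] (wordDegree i)
  fin_cases i
  · exact one_mem_wordDeg _ _
  · exact h0
  · exact h1
  · have h2 := wordDeg_mul h0 h1
    rw [show (1 + 3 : ℤ) = 4 by norm_num] at h2
    exact h2

/-- Contracting homotopies for the left multiplications by the generators, in coordinates. -/
def hmat : Fin 2 → Module.End F2 (Fin 4 → F2) :=
  ![{ toFun := fun v => ![v 1, 0, v 3, 0]
      map_add' := fun x y => by ext i; fin_cases i <;> simp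
      map_smul' := fun r x => by ext i; fin_cases i <;> simp },
    { toFun := fun v => ![v 2, v 3, 0, 0]
      map_add' := fun x y => by ext i; fin_cases i <;> simp
      map_smul' := fun r x => by ext i; fin_cases i <;> simp }]

/-- The homotopy strips a factor `Q_i` from a basis word: `E(1)` is free over the exterior algebra
on `Q_i`. -/
theorem lmat_hmat (i : Fin 2) (v : Fin 4 → F2) :
    lmat i (hmat i v) + hmat i (lmat i v) = v := by
  fin_cases i <;> ext j <;> fin_cases j <;> simp [lmat, hmat]

theorem comul_gen (i : Fin 2) : Coalgebra.comul (R := F2) (gen i) = gen i ⊗ₜ 1 + 1 ⊗ₜ gen i :=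
  E1.lift_gen _ _ _ _ i

noncomputable instance : Kit E1 where
  gen := gen
  wt := ![1, 3]
  wt_pos i := by fin_cases i <;> simp
  gen_mem := gen_mem_wordDeg gen ![1, 3]
  adjoin := adjoin
  internal := isInternal_of_coord _ word wordDegree word_mem coord eq_sum_word
    fun n v hv => coord_mem hv
  one_mem := one_mem_wordDeg _ _
  mul_mem := wordDeg_mul
  finite := Module.Finite.of_surjective ofCoord fun b => ⟨coord b, ofCoord_coord b⟩
  counit_gen i := E1.lift_gen _ _ _ _ i
  twist_gen i _ hy := range_twist_mul_left (comul_gen i) hy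
  top := gen 0 * gen 1
  topDeg := 4
  top_mem := word_mem 3
  top_ne h := by
    have := coord_word 3
    rw [show word 3 = gen 0 * gen 1 from rfl, h, map_zero] at this
    simpa using congrFun this 3
  gen_mul_top i := by
    fin_cases i
    · simp [← mul_assoc, gen00]
    · simp [gen01, ← mul_assoc, gen11]
  top_mul_gen i := by
    fin_cases i
    · simp [mul_assoc, ← gen01]
      simp [← mul_assoc, gen00]
    · simp [mul_assoc, gen11]
  homotopy i := ofCoord.comp ((hmat i).comp coord)
  homotopy_eq i b := by
    apply coord_injective
    change coord (gen i * _ + ofCoord (hmat i (coord (gen i * b)))) = _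
    rw [map_add, coord_gen_mul, coord_gen_mul, coord_ofCoord]
    change lmat i (coord (ofCoord (hmat i (coord b)))) + _ = _
    rw [coord_ofCoord, lmat_hmat]
  Q_mem i := gen_mem_wordDeg gen ![1, 3] i
  Q_comul := comul_gen
  Q_sq i := by
    fin_cases i
    exacts [gen00, gen11]
  Q_comm := gen01

end E1

end StMod

namespace StMod

/-! ### Explicit structure of `A(1)` -/

namespace A1

/-- Left multiplication by the generators in the basis `1, a, b, ab, ba, aba, bab, abab`, where
`a = Sq¹` and `b = Sq²`. -/
def lmat : Fin 2 → Module.End F2 (Fin 8 → F2) :=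
  ![{ toFun := fun v => ![0, v 0, 0, v 2, 0, v 4, 0, v 6]
      map_add' := fun x y => by ext i; fin_cases i <;> simp
      map_smul' := fun r x => by ext i; fin_cases i <;> simp },
    { toFun := fun v => ![0, 0, v 0, 0, v 1, v 2, v 3, v 5]
      map_add' := fun x y => by ext i; fin_cases i <;> simp
      map_smul' := fun r x => by ext i; fin_cases i <;> simp }]

theorem lmat_zero (v : Fin 8 → F2) : lmat 0 v = ![0, v 0, 0, v 2, 0, v 4, 0, v 6] := rfl

theorem lmat_one (v : Fin 8 → F2) : lmat 1 v = ![0, 0, v 0, 0, v 1, v 2, v 3, v 5] := rfl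

/-- The regular representation in coordinates. -/
noncomputable def rep : A1 →ₐ[F2] Module.End F2 (Fin 8 → F2) :=
  lift lmat (LinearMap.ext fun v => by
      ext i; fin_cases i <;> simp [lmat_zero])
    (LinearMap.ext fun v => by
      ext i; fin_cases i <;> simp [lmat_zero, lmat_one])

theorem rep_gen (i : Fin 2) : rep (gen i) = lmat i := lift_gen _ _ _ i

/-- The coordinates in the basis `1, a, b, ab, ba, aba, bab, abab`. -/
noncomputable def coord : A1 →ₗ[F2] (Fin 8 → F2) :=
  (LinearMap.applyₗ (![1, 0, 0, 0, 0, 0, 0, 0] : Fin 8 → F2)).comp rep.toLinearMap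

theorem coord_one : coord 1 = ![1, 0, 0, 0, 0, 0, 0, 0] := by simp [coord]

theorem coord_gen_mul (i : Fin 2) (b : A1) : coord (gen i * b) = lmat i (coord b) := by
  simp [coord, rep_gen]

/-- The basis `1, a, b, ab, ba, aba, bab, abab`. -/
noncomputable def word : Fin 8 → A1 :=
  ![1, gen 0, gen 1, gen 0 * gen 1, gen 1 * gen 0, gen 0 * (gen 1 * gen 0),
    gen 1 * (gen 0 * gen 1), gen 0 * (gen 1 * (gen 0 * gen 1))]

/-- The degrees of the basis elements. -/
def wordDegree : Fin 8 → ℤ := ![0, 1, 2, 3, 3, 4, 5, 6]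

theorem adjoin (S : Subalgebra F2 A1) (hS : ∀ i, gen i ∈ S) : S = ⊤ := by
  refine eq_top_iff.2 fun b _ => ?_
  obtain ⟨x, rfl⟩ := RingQuot.mkAlgHom_surjective F2 A1Rel b
  induction x using FreeAlgebra.induction with
  | grade0 r => rw [AlgHom.commutes]; exact S.algebraMap_mem r
  | grade1 i => exact hS i
  | mul x y hx hy => rw [map_mul]; exact S.mul_mem (hx trivial) (hy trivial)
  | add x y hx hy => rw [map_add]; exact S.add_mem (hx trivial) (hy trivial)

theorem gen11' (x : A1) : gen 1 * (gen 1 * x) = gen 0 * (gen 1 * (gen 0 * x)) := by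
  rw [← mul_assoc, gen11, mul_assoc, mul_assoc]

/-- With `a = Sq¹` and `b = Sq²`, both sides are `b³`, bracketed as `b(bb)` and `(bb)b`. -/
theorem gen1010 : gen 1 * (gen 0 * (gen 1 * gen 0)) = gen 0 * (gen 1 * (gen 0 * gen 1)) := by
  rw [← gen11', ← mul_assoc (gen 0), ← gen11]

theorem gen10101 : gen 1 * (gen 0 * (gen 1 * (gen 0 * gen 1))) = 0 := by
  rw [← gen11', gen11, mul_assoc, gen11', gen00', mul_zero, mul_zero]

theorem eq_sum_word (b : A1) : b = ∑ i, coord b i • word i := by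
  refine induction_of_adjoin adjoin (p := fun b => b = ∑ i, coord b i • word i) ?_ ?_ ?_ ?_ b
  · simp [coord_one, word, Fin.sum_univ_eight]
  · simp
  · intro x y hx hy
    simp only [map_add, Pi.add_apply, add_smul, Finset.sum_add_distrib, ← hx, ← hy]
  · intro i x hx
    rw [coord_gen_mul]
    conv_lhs => rw [hx]
    fin_cases i
    · simp [lmat_zero, word, Fin.sum_univ_eight, mul_add, gen00, gen00']
    · simp [lmat_one, word, Fin.sum_univ_eight, mul_add, gen11', gen00, gen00', gen1010, gen10101]
      rw [gen11, mul_assoc]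

theorem coord_word (i : Fin 8) : coord (word i) = Pi.single i 1 := by
  fin_cases i <;> ext j <;> fin_cases j <;>
    simp [word, coord, rep_gen, lmat_zero, lmat_one]

/-- The element with given coordinates. -/
noncomputable def ofCoord : (Fin 8 → F2) →ₗ[F2] A1 := Fintype.linearCombination F2 word

theorem ofCoord_coord (b : A1) : ofCoord (coord b) = b := (eq_sum_word b).symm

theorem coord_ofCoord (v : Fin 8 → F2) : coord (ofCoord v) = v := by
  rw [ofCoord, Fintype.linearCombination_apply, map_sum]
  simp only [map_smul, coord_word]
  ext j
  simp [Finset.sum_apply, Pi.single_apply]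

theorem coord_injective : Function.Injective coord := fun x y h => by
  rw [← ofCoord_coord x, h, ofCoord_coord]

theorem lmat_mem (i : Fin 2) (n : ℤ) (v : Fin 8 → F2) (hv : v ∈ coordGr wordDegree n) :
    lmat i v ∈ coordGr wordDegree ((![1, 2] : Fin 2 → ℤ) i + n) := by
  intro j hj
  fin_cases i <;> fin_cases j <;> simp [lmat_zero, lmat_one, wordDegree] at hj ⊢ <;>
    exact hv _ (by simp [wordDegree]; omega)

theorem coord_mem {n : ℤ} {b : A1} (hb : b ∈ GrBialg.deg n) : coord b ∈ coordGr wordDegree n := by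
  have := smul_mem_of_gen (g := gen) (w := ![1, 2]) rep (coordGr wordDegree) (fun i m v hv => by
    rw [rep_gen]
    exact lmat_mem i m v hv) n b hb 0
    ![1, 0, 0, 0, 0, 0, 0, 0] (fun j hj => by fin_cases j <;> simp [wordDegree] at hj ⊢)
  rwa [add_zero] at this

theorem word_mem (i : Fin 8) : word i ∈ GrBialg.deg (B := A1) (wordDegree i) := by
  have h0 : gen 0 ∈ wordDeg gen ![1, 2] 1 := gen_mem_wordDeg gen ![1, 2] 0
  have h1 : gen 1 ∈ wordDeg gen ![1, 2] 2 := gen_mem_wordDeg gen ![1, 2] 1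
  have mem : ∀ {m n k : ℤ} {x y : A1}, x ∈ wordDeg gen ![1, 2] m → y ∈ wordDeg gen ![1, 2] n →
      m + n = k → x * y ∈ wordDeg gen ![1, 2] k := fun hx hy h => h ▸ wordDeg_mul hx hy
  have h01 := mem h0 h1 (by norm_num : _ = (3 : ℤ))
  have h10 := mem h1 h0 (by norm_num : _ = (3 : ℤ))
  have h010 := mem h0 h10 (by norm_num : _ = (4 : ℤ))
  have h101 := mem h1 h01 (by norm_num : _ = (5 : ℤ))
  have h0101 := mem h0 h101 (by norm_num : _ = (6 : ℤ))
  change word i ∈ wordDeg gen ![1, 2] (wordDegree i)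
  fin_cases i
  · exact one_mem_wordDeg _ _
  · exact h0
  · exact h1
  · exact h01
  · exact h10
  · exact h010
  · exact h101
  · exact h0101

/-- Contracting homotopies for the left multiplications by the Milnor primitives, in
coordinates. -/
def hmat : Fin 2 → Module.End F2 (Fin 8 → F2) :=
  ![{ toFun := fun v => ![v 1, 0, v 3, 0, v 5, 0, v 7, 0]
      map_add' := fun x y => by ext i; fin_cases i <;> simp
      map_smul' := fun r x => by ext i; fin_cases i <;> simp },
    { toFun := fun v => ![v 4, v 5, v 6, v 7, 0, 0, 0, 0]
      map_add' := fun x y => by ext i; fin_cases i <;> simp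
      map_smul' := fun r x => by ext i; fin_cases i <;> simp }]

/-- Left multiplication by the Milnor primitives, in coordinates. -/
def qmat : Fin 2 → Module.End F2 (Fin 8 → F2) :=
  ![lmat 0, (lmat 1).comp (lmat 0) + (lmat 0).comp (lmat 1)]

theorem coord_milnor_mul (i : Fin 2) (b : A1) : coord (milnor i * b) = qmat i (coord b) := by
  fin_cases i
  · exact coord_gen_mul 0 b
  · change coord ((gen 1 * gen 0 + gen 0 * gen 1) * b) = _
    rw [add_mul, map_add, mul_assoc, mul_assoc]
    simp only [coord_gen_mul]
    rfl

/-- The homotopies exhibit `A(1)` as free, under left multiplication, over the exterior algebra on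
each Milnor primitive; for `Q₁` the word `ba` serves as the leading term of `Q₁ · 1`. -/
theorem qmat_hmat (i : Fin 2) (v : Fin 8 → F2) :
    qmat i (hmat i v) + hmat i (qmat i v) = v := by
  fin_cases i
  · ext j; fin_cases j <;> simp [qmat, hmat, lmat]
  · have h : v 4 + v 3 + v 4 = v 3 := by rw [add_comm, ← add_assoc, add_self_F2, zero_add]
    have h' : v 4 + (v 4 + v 3) = v 3 := by rw [← add_assoc, add_self_F2, zero_add]
    ext j; fin_cases j <;> simp [qmat, hmat, lmat, h']

theorem comul_gen_zero : Coalgebra.comul (R := F2) (gen 0) = gen 0 ⊗ₜ 1 + 1 ⊗ₜ gen 0 :=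
  lift_gen _ _ _ 0

theorem comul_gen_one :
    Coalgebra.comul (R := F2) (gen 1) = gen 1 ⊗ₜ 1 + gen 0 ⊗ₜ gen 0 + 1 ⊗ₜ gen 1 :=
  lift_gen _ _ _ 1

/-- The coproduct of `Sq²` has the extra term `Sq¹ ⊗ Sq¹`. Its contribution lies in the range by the
primitive case for `Sq¹`, followed by right multiplication by `1 ⊗ Sq¹ c`. -/
theorem range_twist_mul_gen_one {y : A1 ⊗[F2] A1} (hy : y ∈ LinearMap.range (twist A1)) :
    y * (gen 1 ⊗ₜ 1) ∈ LinearMap.range (twist A1) := by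
  obtain ⟨x, rfl⟩ := hy
  induction x using TensorProduct.induction_on with
  | zero => rw [map_zero, zero_mul]; exact Submodule.zero_mem _
  | add x y hx hy => rw [map_add, add_mul]; exact Submodule.add_mem _ hx hy
  | tmul b c =>
    obtain ⟨z, hz⟩ := range_twist_mul_right
      (range_twist_mul_left comul_gen_zero ⟨b ⊗ₜ[F2] (1 : A1), rfl⟩) (gen 0 * c)
    refine ⟨(b * gen 1) ⊗ₜ c + z + b ⊗ₜ (gen 1 * c), ?_⟩
    rw [map_add, map_add, hz, twist_tmul, twist_tmul, twist_tmul, twist_tmul, Bialgebra.comul_mul,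
      comul_gen_one]
    simp only [mul_assoc, add_mul, Algebra.TensorProduct.tmul_mul_tmul, one_mul, mul_one, mul_add]
    apply eq_of_add_eq_zero_F2 (V := A1 ⊗[F2] A1)
    abel_nf
    simp only [two_zsmul, add_self_F2 (V := A1 ⊗[F2] A1)]

theorem milnor_zero_sq : milnor 0 * milnor 0 = 0 := gen00

theorem milnor_comm : milnor 0 * milnor 1 = milnor 1 * milnor 0 := by
  simp [milnor, mul_add, add_mul, mul_assoc, gen00, gen00']

noncomputable instance : Kit A1 where
  gen := gen
  wt := ![1, 2]
  wt_pos i := by fin_cases i <;> simp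
  gen_mem := gen_mem_wordDeg gen ![1, 2]
  adjoin := adjoin
  internal := isInternal_of_coord _ word wordDegree word_mem coord eq_sum_word
    fun n v hv => coord_mem hv
  one_mem := one_mem_wordDeg _ _
  mul_mem := wordDeg_mul
  finite := Module.Finite.of_surjective ofCoord fun b => ⟨coord b, ofCoord_coord b⟩
  counit_gen i := A1.lift_gen _ _ _ i
  twist_gen i _ hy := by
    fin_cases i
    · exact range_twist_mul_left comul_gen_zero hy
    · exact range_twist_mul_gen_one hy
  top := gen 0 * (gen 1 * (gen 0 * gen 1))
  topDeg := 6
  top_mem := word_mem 7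
  top_ne h := by
    have := coord_word 7
    rw [show word 7 = gen 0 * (gen 1 * (gen 0 * gen 1)) from rfl, h, map_zero] at this
    simpa using congrFun this 7
  gen_mul_top i := by
    fin_cases i
    · exact gen00' _
    · exact gen10101
  top_mul_gen i := by
    fin_cases i
    · change gen 0 * (gen 1 * (gen 0 * gen 1)) * gen 0 = 0
      rw [mul_assoc, mul_assoc, mul_assoc, gen1010, gen00']
    · change gen 0 * (gen 1 * (gen 0 * gen 1)) * gen 1 = 0
      rw [mul_assoc, mul_assoc, mul_assoc, gen11, mul_assoc, gen00', mul_zero, mul_zero]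
  homotopy i := ofCoord.comp ((hmat i).comp coord)
  homotopy_eq i b := by
    apply coord_injective
    change coord (milnor i * ofCoord (hmat i (coord b)) +
      ofCoord (hmat i (coord (milnor i * b)))) = _
    rw [map_add, coord_milnor_mul, coord_milnor_mul, coord_ofCoord, coord_ofCoord, qmat_hmat]
  Q_mem := milnor_mem
  Q_comul := comul_milnor
  Q_sq i := by
    fin_cases i
    exacts [milnor_zero_sq, milnor_one_sq]
  Q_comm := milnor_comm

end A1

end StMod

namespace StMod

namespace GrMod

/-! ### The top class acts injectively on the lowest degree -/

section Detects

variable {B : Type} [Ring B] [Bialgebra F2 B] [GrBialg B] {M : GrMod.{u} B}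

/-- An element killed by `q` is a boundary, and what it bounds would lie below degree `n`. -/
theorem eq_zero_of_low {q : B} {k n m : ℤ} (hq : q ∈ GrBialg.deg k) (hM : M.Acyc q)
    (hn : ∀ m : ℤ, m < n → M.gr m = ⊥) {v : M.carrier} (hv : v ∈ M.gr m) (hm : m < n + k)
    (h : M.ρ q v = 0) : v = 0 := by
  obtain ⟨u, hu, rfl⟩ := exists_ρ_preimage (m := m - k) hq hv (hM v h) (by ring)
  rw [hn _ (by omega), Submodule.mem_bot] at hu
  rw [hu, map_zero]

variable [SubA1 B] [Kit B]

theorem eq_zero_of_Q0_Q1 (hM : ∀ i : Fin 2, M.Acyc (SubA1.Q (B := B) i)) {n : ℤ}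
    (hn : ∀ m : ℤ, m < n → M.gr m = ⊥) {v : M.carrier} (hv : v ∈ M.gr n)
    (h : M.ρ (SubA1.Q 0) (M.ρ (SubA1.Q 1) v) = 0) : v = 0 :=
  eq_zero_of_low Q0_mem (hM 0) hn hv (by omega)
    (eq_zero_of_low Q1_mem (hM 1) hn (ρ_mem M Q0_mem hv rfl) (by omega) (by rw [← ρ_Q_comm, h]))

end Detects

theorem detects_E1 : Detects.{u} E1 := fun M hM n hn k hk h =>
  eq_zero_of_Q0_Q1 hM hn hk (by rw [← ρ_mul]; exact h)

/-! ### Identities among `Sq¹`, `Sq²` and `Q₁` -/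

section Squares

/-- The operation `Sq¹`. -/
noncomputable def sq1 (M : GrMod.{u} A1) : M.carrier →ₗ[F2] M.carrier := M.ρ (A1.gen 0)

/-- The operation `Sq²`. -/
noncomputable def sq2 (M : GrMod.{u} A1) : M.carrier →ₗ[F2] M.carrier := M.ρ (A1.gen 1)

variable {M N : GrMod.{u} A1}

theorem sq1_sq1 (v : M.carrier) : M.sq1 (M.sq1 v) = 0 := by
  rw [sq1, ← ρ_mul, A1.gen00]; simp

theorem sq2_sq2 (v : M.carrier) : M.sq2 (M.sq2 v) = M.sq1 (M.sq2 (M.sq1 v)) := by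
  rw [sq1, sq2, ← ρ_mul, A1.gen11, ρ_mul, ρ_mul]

theorem ρ_Q0 (v : M.carrier) : M.ρ (SubA1.Q 0) v = M.sq1 v := rfl

theorem ρ_Q1 (v : M.carrier) :
    M.ρ (SubA1.Q 1) v = M.sq2 (M.sq1 v) + M.sq1 (M.sq2 v) := by
  change M.ρ (A1.gen 1 * A1.gen 0 + A1.gen 0 * A1.gen 1) v = _
  rw [map_add, LinearMap.add_apply, ρ_mul, ρ_mul]
  rfl

theorem sq1_mem {m n : ℤ} {v : M.carrier} (hv : v ∈ M.gr m) (h : 1 + m = n) : M.sq1 v ∈ M.gr n :=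
  ρ_mem M (Kit.gen_mem (B := A1) 0) hv h

theorem sq2_mem {m n : ℤ} {v : M.carrier} (hv : v ∈ M.gr m) (h : 2 + m = n) : M.sq2 v ∈ M.gr n :=
  ρ_mem M (Kit.gen_mem (B := A1) 1) hv h

theorem lin_sq1 (f : M ⟶ N) (v : M.carrier) : lin f (M.sq1 v) = N.sq1 (lin f v) := lin_ρ f _ v

theorem lin_sq2 (f : M ⟶ N) (v : M.carrier) : lin f (M.sq2 v) = N.sq2 (lin f v) := lin_ρ f _ v

theorem sq1_tm (x : M.carrier) (y : N.carrier) :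
    (M.tensor N).sq1 (tm x y) = tm (M.sq1 x) y + tm x (N.sq1 y) :=
  tensor_ρ_of_primitive A1.comul_gen_zero x y

theorem sq2_tm (x : M.carrier) (y : N.carrier) :
    (M.tensor N).sq2 (tm x y) = tm (M.sq2 x) y + tm (M.sq1 x) (N.sq1 y) + tm x (N.sq2 y) := by
  rw [sq2, tensor_ρ, A1.comul_gen_one, map_add, map_add]
  change tact M N _ (tm x y) + tact M N _ (tm x y) + tact M N _ (tm x y) = _
  rw [tact_tmul, tact_tmul, tact_tmul, map_one, map_one]
  rfl

theorem Q1_tm (x : M.carrier) (y : N.carrier) : (M.tensor N).ρ (SubA1.Q 1) (tm x y) =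
    tm (M.ρ (SubA1.Q 1) x) y + tm x (N.ρ (SubA1.Q 1) y) :=
  tensor_ρ_of_primitive (Kit.Q_comul 1) x y

theorem sq1_sq2_sq2 (v : M.carrier) : M.sq1 (M.sq2 (M.sq2 v)) = 0 := by rw [sq2_sq2, sq1_sq1]

theorem sq2_sq2_sq1 (v : M.carrier) : M.sq2 (M.sq2 (M.sq1 v)) = 0 := by
  rw [sq2_sq2, sq1_sq1, map_zero, map_zero]

/-- In `A(1)` one has `Sq² Sq² = Q₀ Q₁`; with the next lemma this links `Sq²` to the Milnor
primitives in the arguments below. -/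
theorem sq1_Q1 (v : M.carrier) : M.sq1 (M.ρ (SubA1.Q 1) v) = M.sq2 (M.sq2 v) := by
  rw [ρ_Q1, map_add, sq1_sq1, add_zero, sq2_sq2]

theorem Q1_sq1 (v : M.carrier) : M.ρ (SubA1.Q 1) (M.sq1 v) = M.sq2 (M.sq2 v) := by
  rw [ρ_Q1, sq1_sq1, map_zero, zero_add, sq2_sq2]

theorem Q1_sq1_comm (v : M.carrier) :
    M.ρ (SubA1.Q 1) (M.sq1 v) = M.sq1 (M.ρ (SubA1.Q 1) v) := (ρ_Q_comm v).symm

theorem detects_A1 : Detects.{u} A1 := fun M hM n hn k hk h => by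
  -- The top class of `A(1)` equals `Sq² Sq² Sq²`.
  have h3 : M.sq2 (M.sq2 (M.sq2 k)) = 0 := by
    have e : A1.gen 1 * (A1.gen 1 * A1.gen 1) = Kit.top (B := A1) := by
      change _ = A1.gen 0 * (A1.gen 1 * (A1.gen 0 * A1.gen 1))
      rw [A1.gen11, mul_assoc, A1.gen1010]
    rw [sq2, ← ρ_mul, ← ρ_mul, mul_assoc, e, h]
  have hb := sq2_mem hk rfl
  have hab := sq1_mem hb rfl
  -- Write `Sq¹ Sq² k = Q₁ y` with `y` in the lowest degree. Applying `Sq¹` gives `Q₀ Q₁ y = 0`, so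
  -- `y = 0`, and then `Sq² k` and `k` vanish in turn by low degree.
  have e1 : M.ρ (SubA1.Q 1) (M.sq1 (M.sq2 k)) = 0 := by rw [Q1_sq1, h3]
  obtain ⟨y, hy, hyk⟩ := exists_ρ_preimage (m := n) Q1_mem hab (hM 1 _ e1) (by ring)
  have e2 : M.sq2 (M.sq2 y) = 0 := by
    have := congrArg M.sq1 hyk
    rwa [sq1_Q1, sq1_sq1] at this
  have hy0 : y = 0 := eq_zero_of_Q0_Q1 hM hn hy (by rw [ρ_Q0, sq1_Q1, e2])
  rw [hy0, map_zero] at hyk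
  have e3 : M.sq2 k = 0 := eq_zero_of_low Q1_mem (hM 1) hn hb (by omega) (by
    rw [ρ_Q1, ← hyk, map_zero, zero_add, sq1_sq2_sq2])
  exact eq_zero_of_Q0_Q1 hM hn hk (by rw [ρ_Q0, sq1_Q1, e3, map_zero])

end Squares

/-! ### Squaring a class so as to kill `Sq²` -/

section Doubling

variable {M : GrMod.{u} A1}

/-- A nonzero `Q₁`-class has nonzero square under `φ`, and changing the square by a boundary before
applying `φ` does no harm. This keeps each new class nontrivial. -/
theorem not_boundary_mul {φ : M.tensor M ⟶ M} (hφ : QIso φ (SubA1.Q 1)) {e : M.carrier}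
    (he0 : M.ρ (SubA1.Q 1) e = 0) (he : ¬ ∃ u, M.ρ (SubA1.Q 1) u = e)
    (X : (M.tensor M).carrier) :
    ¬ ∃ u, M.ρ (SubA1.Q 1) u = lin φ (tm e e + (M.tensor M).ρ (SubA1.Q 1) X) := by
  rintro ⟨u, hu⟩
  obtain ⟨v, hv⟩ := hφ.inj _ (by
    rw [map_add, ρ_Q_Q, add_zero, Q1_tm, he0, zero_tm, tm_zero, add_zero]) ⟨u, hu⟩
  refine tm_self_not_boundary (Kit.Q_comul 1) he ⟨v + X, ?_⟩
  rw [map_add, hv, add_assoc, add_self_F2, add_zero]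

theorem not_boundary_sq {φ : M.tensor M ⟶ M} (hφ : QIso φ (SubA1.Q 1)) {e : M.carrier}
    (he0 : M.ρ (SubA1.Q 1) e = 0) (he : ¬ ∃ u, M.ρ (SubA1.Q 1) u = e) :
    ¬ ∃ u, M.ρ (SubA1.Q 1) u = lin φ (tm e e) := by
  have := not_boundary_mul hφ he0 he 0
  rwa [map_zero, add_zero] at this

/-- First step of the doubling: a class `e` with `Sq² e = Sq² Sq² t`. -/
theorem exists_double_one (hM : M.BoundedBelow) (h0 : M.Small (SubA1.Q 0))
    (h1 : M.OneDim (SubA1.Q 1)) {φ : M.tensor M ⟶ M} (hφ : QIso φ (SubA1.Q 1)) :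
    ∃ e ∈ M.gr 0, ∃ t ∈ M.gr (-2), M.sq1 e = 0 ∧ (¬ ∃ u, M.ρ (SubA1.Q 1) u = e) ∧
      M.sq2 e = M.sq2 (M.sq2 t) := by
  obtain ⟨x, hx, hx0, hx1, hxn⟩ := exists_unit_class hM h0 h1
  have h1' : M.Small (SubA1.Q 1) := Or.inr h1
  rw [ρ_Q0] at hx0
  have hay : M.sq1 (M.sq2 x) = 0 := by
    rwa [ρ_Q1, hx0, map_zero, zero_add] at hx1
  obtain ⟨w, hw, hwy⟩ := h1'.exists_of_ne_zero (m := -1) Q1_mem (sq2_mem hx rfl) (by omega)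
    (by rw [ρ_Q1, hay, map_zero, zero_add, sq1_sq2_sq2]) (by ring)
  -- Here `Sq² x = Q₁ w`. If `Q₀ w` is a `Q₁`-boundary, descent makes `w` equal to `Q₀ t` up to a
  -- `Q₁`-boundary, and `Q₁ Q₀ t = Sq² Sq² t`, so `x` itself serves.
  by_cases hc : ∃ s, M.ρ (SubA1.Q 1) s = M.ρ (SubA1.Q 0) w
  · obtain ⟨u, hu, huw⟩ := exists_Q0_cycle hM h0 h1' (by omega) hw hc
    obtain ⟨t, ht, htw⟩ := h0.exists_of_ne_zero (n := -1) (m := -2) Q0_mem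
      (Submodule.add_mem _ hw (ρ_mem M Q1_mem hu (by ring))) (by omega) huw (by ring)
    refine ⟨x, hx, t, ht, hx0, hxn, ?_⟩
    rw [← Q1_sq1, ← ρ_Q0, htw, map_add, ρ_Q_Q, add_zero, hwy]
  -- Otherwise `Sq¹ w` represents the only nonzero `Q₁`-class, so it is homologous to `x`. Descent
  -- in degree `-3` makes the difference `x + Sq¹ w` of the form `Q₀ Q₁ s'`.
  · have haw : M.sq1 w ∈ M.gr 0 := sq1_mem hw (by ring)
    have hqaw : M.ρ (SubA1.Q 1) (M.sq1 w) = 0 := by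
      rw [← ρ_Q0, ← ρ_Q_comm, hwy, ρ_Q0, hay]
    obtain ⟨s, hs, hsx⟩ : ∃ s ∈ M.gr (-3), M.ρ (SubA1.Q 1) s = x + M.sq1 w := by
      refine exists_ρ_preimage Q1_mem (Submodule.add_mem _ hx haw) ?_ (by ring)
      exact ((h1'.cases hx1 hqaw).resolve_left hxn).resolve_left hc
    have hqas : M.ρ (SubA1.Q 1) (M.ρ (SubA1.Q 0) s) = 0 := by
      rw [← ρ_Q_comm, hsx, ρ_Q0, map_add, hx0, sq1_sq1, add_zero]
    obtain ⟨r, -, hr⟩ := h1'.exists_of_ne_zero (m := -5) Q1_mem (ρ_mem M Q0_mem hs rfl)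
      (by omega) hqas (by ring)
    obtain ⟨u, hu, hus⟩ := exists_Q0_cycle hM h0 h1' (by omega) hs ⟨r, hr⟩
    obtain ⟨s', hs', hss⟩ := h0.exists_of_ne_zero (n := -3) (m := -4) Q0_mem
      (Submodule.add_mem _ hs (ρ_mem M Q1_mem hu (by ring))) (by omega) hus (by ring)
    have hqs : M.sq1 (M.ρ (SubA1.Q 1) s') = x + M.sq1 w := by
      rw [← ρ_Q0, ρ_Q_comm, hss, map_add, ρ_Q_Q, add_zero, hsx]
    set w' := w + M.ρ (SubA1.Q 1) s' with hw'
    have hw'm : w' ∈ M.gr (-1) := Submodule.add_mem _ hw (ρ_mem M Q1_mem hs' (by ring))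
    have hqw' : M.ρ (SubA1.Q 1) w' = M.sq2 x := by rw [hw', map_add, ρ_Q_Q, add_zero, hwy]
    have haw' : M.sq1 w' = x := by
      rw [hw', map_add, hqs, add_left_comm, add_self_F2, add_zero]
    -- Now `Q₁ w' = Sq² x` and `Sq¹ w' = x`. Hence `Sq² Sq² (w' ⊗ w') = Sq¹ Q₁ (w' ⊗ w') = Sq² x ⊗ x
    -- + x ⊗ Sq² x`, which is `Sq² (x ⊗ x)` because `Sq¹ x = 0`.
    refine ⟨lin φ (tm x x), lin_mem φ (tm_mem hx hx (by ring)), lin φ (tm w' w'),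
      lin_mem φ (tm_mem hw'm hw'm (by ring)), ?_, not_boundary_sq hφ hx1 hxn, ?_⟩
    · rw [← lin_sq1, sq1_tm, hx0, zero_tm, tm_zero, add_zero, map_zero]
    · rw [← lin_sq2, ← lin_sq2, ← lin_sq2]
      refine congrArg (lin φ) ?_
      rw [← sq1_Q1, Q1_tm, hqw', map_add, sq1_tm, sq1_tm, sq2_tm, hay, haw', hx0]
      simp only [zero_tm, tm_zero, zero_add, add_zero]

/-- Second step of the doubling: a class `e` with `Sq² e = Sq² Sq² t` and `Sq² t = Sq¹ u`. -/
theorem exists_double_two (hM : M.BoundedBelow) (h0 : M.Small (SubA1.Q 0))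
    (h1 : M.OneDim (SubA1.Q 1)) {φ : M.tensor M ⟶ M} (hφ : QIso φ (SubA1.Q 1)) :
    ∃ e ∈ M.gr 0, ∃ t ∈ M.gr (-2), ∃ u ∈ M.gr (-1), M.sq1 e = 0 ∧
      (¬ ∃ u, M.ρ (SubA1.Q 1) u = e) ∧ M.sq2 e = M.sq2 (M.sq2 t) ∧ M.sq2 t = M.sq1 u := by
  obtain ⟨e, he, t, ht, hae, hen, hbe⟩ := exists_double_one hM h0 h1 hφ
  have h1' : M.Small (SubA1.Q 1) := Or.inr h1
  have hqe : M.ρ (SubA1.Q 1) e = 0 := by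
    rw [ρ_Q1, hae, hbe, map_zero, zero_add, sq1_sq2_sq2]
  have hbt : M.sq2 t ∈ M.gr 0 := sq2_mem ht (by ring)
  have hqabt : M.ρ (SubA1.Q 1) (M.sq1 (M.sq2 t)) = 0 := by
    rw [Q1_sq1, ← hbe, sq2_sq2, hae, map_zero, map_zero]
  obtain ⟨r, -, hr⟩ := h1'.exists_of_ne_zero (m := -2) Q1_mem (sq1_mem hbt rfl) (by omega) hqabt
    (by ring)
  obtain ⟨v, hv, hvt⟩ := exists_Q0_cycle hM h0 h1' le_rfl hbt ⟨r, hr⟩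
  rw [ρ_Q0] at hvt
  set κ := M.sq2 t + M.ρ (SubA1.Q 1) v with hκ
  have hκt : M.sq2 t = κ + M.ρ (SubA1.Q 1) v := by rw [hκ, add_assoc, add_self_F2, add_zero]
  -- `κ` is `Sq² t` corrected to a `Q₀`-cycle, so its symmetrized product with `e` is a
  -- `Q₀`-boundary.
  obtain ⟨X, hX⟩ := h0.exists_symm (Kit.Q_comul 0) (v := κ) (w := e) hvt hae
  set e' := lin φ (tm e e) with he'
  set t' := lin φ (tm t e + tm e t) with ht'
  have he'm : e' ∈ M.gr 0 := lin_mem φ (tm_mem he he (by ring))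
  have ht'm : t' ∈ M.gr (-2) := lin_mem φ (Submodule.add_mem _ (tm_mem ht he (by ring))
    (tm_mem he ht (by ring)))
  have hae' : M.sq1 e' = 0 := by
    rw [he', ← lin_sq1, sq1_tm, hae, zero_tm, tm_zero, add_zero, map_zero]
  have hbe' : M.sq2 e' = M.sq2 (M.sq2 t') := by
    rw [he', ht', ← lin_sq2, ← lin_sq2, ← lin_sq2]
    refine congrArg (lin φ) ?_
    rw [← sq1_Q1, map_add, map_add, Q1_tm, Q1_tm, hqe, tm_zero, zero_tm, add_zero, zero_add,
      sq1_tm, sq1_tm, hae, tm_zero, zero_tm, add_zero, zero_add, sq1_Q1, sq2_tm, hae, tm_zero,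
      add_zero, hbe]
  -- The Cartan formula splits `Sq² (t ⊗ e + e ⊗ t)` into a part with `κ`, equal to `Sq¹ X`, a part
  -- with `v`, equal to a `Q₁`-boundary, and `t ⊗ Sq² Sq² t + Sq² Sq² t ⊗ t`. The last part is `Sq¹
  -- (t ⊗ Q₁ t) + Q₁ (Sq¹ t ⊗ t)`.
  have hbt' : M.sq2 t' = M.sq1 (lin φ (X + tm t (M.ρ (SubA1.Q 1) t))) +
      M.ρ (SubA1.Q 1) (lin φ (tm v e + tm e v + tm (M.sq1 t) t)) := by
    rw [ht', ← lin_sq2, ← lin_sq1, ← lin_ρ, ← map_add]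
    refine congrArg (lin φ) ?_
    rw [ρ_Q0] at hX
    simp only [map_add, hX, sq1_tm, sq2_tm, Q1_tm, hae, hqe, zero_tm, tm_zero, add_zero, zero_add,
      hκt, tm_add, add_tm, hbe, sq1_Q1, Q1_sq1]
    apply eq_of_add_eq_zero_F2
    abel_nf
    simp only [two_zsmul, add_self_F2]
  have hbt'' : M.sq2 t' ∈ M.gr 0 := sq2_mem ht'm (by ring)
  generalize lin φ (X + tm t (M.ρ (SubA1.Q 1) t)) = V at hbt'
  generalize lin φ (tm v e + tm e v + tm (M.sq1 t) t) = U at hbt'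
  -- `X` is not known to be homogeneous, so the components of the right degrees are extracted. Then
  -- `Sq² t' = Sq¹ V + Q₁ U`, and adding `Sq¹ U` to `t'` turns the right side into `Sq¹ (V + Sq²
  -- U)`. The value of `Sq² Sq²` does not change, because `Sq² Sq² Sq¹ = 0`.
  have hpr := congrArg (pr M.isInternal 0) hbt'
  have hprV := pr_homog M.isInternal M.isInternal (homog_ρ M Q0_mem) (-1) V
  have hprU := pr_homog M.isInternal M.isInternal (homog_ρ M Q1_mem) (-3) U
  rw [show (1 + -1 : ℤ) = 0 by ring] at hprV
  rw [show (3 + -3 : ℤ) = 0 by ring] at hprU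
  rw [map_add, pr_of_mem _ hbt'', ← ρ_Q0, hprV, hprU, ρ_Q0, ρ_Q1] at hpr
  have hV := pr_mem M.isInternal (-1) V
  have hU := pr_mem M.isInternal (-3) U
  generalize pr M.isInternal (-1) V = V at hpr hV
  generalize pr M.isInternal (-3) U = U at hpr hU
  refine ⟨e', he'm, t' + M.sq1 U, Submodule.add_mem _ ht'm (sq1_mem hU (by ring)), V + M.sq2 U,
    Submodule.add_mem _ hV (sq2_mem hU (by ring)), hae', not_boundary_sq hφ hqe hen, ?_, ?_⟩
  · rw [hbe', map_add, map_add, sq2_sq2_sq1, add_zero]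
  · rw [map_add, hpr, map_add]
    apply eq_of_add_eq_zero_F2
    abel_nf
    simp only [two_zsmul, add_self_F2]

/-- A class in degree `0` that is annihilated by `Sq¹` and `Sq²` and is no `Q₁`-boundary. -/
theorem exists_unit_class_A1 (hM : M.BoundedBelow) (h0 : M.Small (SubA1.Q 0))
    (h1 : M.OneDim (SubA1.Q 1)) {φ : M.tensor M ⟶ M} (hφ : QIso φ (SubA1.Q 1)) :
    ∃ x ∈ M.gr 0, M.sq1 x = 0 ∧ M.sq2 x = 0 ∧ ¬ ∃ u, M.ρ (SubA1.Q 1) u = x := by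
  obtain ⟨e, he, t, ht, u, hu, hae, hen, hbe, hbt⟩ := exists_double_two hM h0 h1 hφ
  have h1' : M.Small (SubA1.Q 1) := Or.inr h1
  have habt : M.sq1 (M.sq2 t) = 0 := by rw [hbt, sq1_sq1]
  have hqt : M.ρ (SubA1.Q 1) t = M.sq2 (M.sq1 t) := by rw [ρ_Q1, habt, add_zero]
  have hqe : M.ρ (SubA1.Q 1) e = 0 := by
    rw [ρ_Q1, hae, hbe, map_zero, zero_add, sq1_sq2_sq2]
  have hbbbt : M.sq2 (M.sq2 (M.sq2 t)) = 0 := by rw [← hbe, sq2_sq2, hae, map_zero, map_zero]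
  have habat : M.sq1 (M.sq2 (M.sq1 t)) = M.sq2 (M.sq2 t) := (sq2_sq2 t).symm
  obtain ⟨X, hX⟩ := h1'.exists_symm (Kit.Q_comul 1) (v := M.sq2 t) (w := e)
    (by rw [ρ_Q1, habt, map_zero, zero_add, sq1_sq2_sq2]) hqe
  -- `U` and `V` are chosen so that `Sq² Sq¹ (U + Sq² V)` equals `Sq² (e ⊗ e)`, while the correction
  -- is itself killed by `Sq¹`.
  set U := tm u e + tm e u + tm t (M.sq2 (M.sq1 t)) with hU
  set V := tm (M.sq1 t) t with hV
  have hbV : (M.tensor M).sq2 V = tm (M.sq2 (M.sq1 t)) t + tm (M.sq1 t) (M.sq2 t) := by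
    rw [hV, sq2_tm, sq1_sq1, zero_tm, add_zero]
  have haU : (M.tensor M).sq1 U = tm (M.sq2 t) e + tm e (M.sq2 t) +
      tm (M.sq1 t) (M.sq2 (M.sq1 t)) + tm t (M.sq2 (M.sq2 t)) := by
    simp only [hU, map_add, sq1_tm, hae, tm_zero, zero_tm, add_zero, zero_add, ← hbt, habat]
    abel
  have habV : (M.tensor M).sq1 ((M.tensor M).sq2 V) =
      tm (M.sq2 (M.sq2 t)) t + tm (M.sq2 (M.sq1 t)) (M.sq1 t) := by
    simp only [hbV, map_add, sq1_tm, habat, habt, sq1_sq1, tm_zero, zero_tm, add_zero]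
  refine ⟨lin φ (tm e e + (M.tensor M).sq1 (U + (M.tensor M).sq2 V)), lin_mem φ ?_, ?_, ?_, ?_⟩
  · refine Submodule.add_mem _ (tm_mem he he (by ring)) (sq1_mem (m := -1) (Submodule.add_mem _
      (Submodule.add_mem _ (Submodule.add_mem _ (tm_mem hu he (by ring)) (tm_mem he hu (by ring)))
        (tm_mem ht (sq2_mem (sq1_mem ht rfl) rfl) (by ring)))
      (sq2_mem (m := -3) (tm_mem (sq1_mem ht rfl) ht (by ring)) (by ring))) (by ring))
  · rw [← lin_sq1, map_add, sq1_sq1, sq1_tm, hae, zero_tm, tm_zero, add_zero, add_zero, map_zero]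
  · rw [← lin_sq2, map_add, map_add, map_add, haU, habV]
    simp only [map_add, sq2_tm, hae, sq2_sq2_sq1, hbbbt, habat, habt, sq1_sq2_sq2, sq1_sq1,
      tm_zero, zero_tm, add_zero, zero_add, hbe]
    abel_nf
    simp only [two_zsmul, add_self_F2]
  · have : (M.tensor M).sq1 (U + (M.tensor M).sq2 V) =
        (M.tensor M).ρ (SubA1.Q 1) (X + (M.tensor M).sq1 (tm t t)) := by
      rw [map_add (M.tensor M).sq1 U, map_add _ X, haU, habV, hX, Q1_sq1_comm, Q1_tm, hqt]
      simp only [map_add, sq1_tm, habat]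
      abel
    rw [this]
    exact not_boundary_mul hφ hqe hen _

end Doubling

end GrMod

end StMod

namespace StMod

namespace GrMod

/-! ### The monomial modules and their Margolis homology -/

section Monomials

/-- The exponents of `P_0` or of `R`. -/
structure Admissible (S : Set ℤ) : Prop where
  le : ∀ n ∈ S, -1 ≤ n
  mem : ∀ n, -1 ≤ n → n ≠ 0 → n ∈ S

theorem admissible_P0 : Admissible {n | -1 ≤ n} := ⟨fun _ h => h, fun _ h _ => h⟩

theorem admissible_R : Admissible {n | -1 ≤ n ∧ n ≠ 0} := ⟨fun _ h => h.1, fun _ h h' => ⟨h, h'⟩⟩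

open Classical in
/-- The monomial `x^n`, read as `0` if `n ∉ S`. -/
noncomputable def xp (S : Set ℤ) (n : ℤ) : Expo.{u} S →₀ F2 :=
  if h : n ∈ S then Finsupp.single ⟨⟨n⟩, h⟩ 1 else 0

variable {S : Set ℤ}

theorem xp_of_mem {n : ℤ} (h : n ∈ S) : xp.{u} S n = Finsupp.single ⟨⟨n⟩, h⟩ 1 := dif_pos h

theorem xp_of_notMem {n : ℤ} (h : n ∉ S) : xp.{u} S n = 0 := dif_neg h

theorem mono_ext {V : Type*} [AddCommGroup V] [Module F2 V] {f g : (Expo.{u} S →₀ F2) →ₗ[F2] V}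
    (h : ∀ n ∈ S, f (xp S n) = g (xp S n)) : f = g := by
  refine Finsupp.lhom_ext' fun s => LinearMap.ext_ring ?_
  have := h s.1.down s.2
  rwa [xp_of_mem s.2] at this

/-- The linear map taking `x^n` to `F n`. -/
noncomputable def monoLin {V : Type*} [AddCommGroup V] [Module F2 V] (S : Set ℤ) (F : ℤ → V) :
    (Expo.{u} S →₀ F2) →ₗ[F2] V :=
  Finsupp.linearCombination F2 fun s => F s.1.down

theorem monoLin_xp {V : Type*} [AddCommGroup V] [Module F2 V] (F : ℤ → V) {n : ℤ} (h : n ∈ S) :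
    monoLin.{u} S F (xp S n) = F n := by
  simp [monoLin, xp_of_mem h]

/-- The only exponent from `-1` on that may be absent is `0`, where both sides vanish. This lets
`P_0` and `R` be treated together. -/
theorem monoLin_xp' {V : Type*} [AddCommGroup V] [Module F2 V] (hS : Admissible S) {F : ℤ → V}
    (hF : 0 ∉ S → F 0 = 0) {n : ℤ} (hn : -1 ≤ n) : monoLin.{u} S F (xp S n) = F n := by
  by_cases h : n ∈ S
  · exact monoLin_xp F h
  · obtain rfl : n = 0 := by_contra fun h' => h (hS.mem n hn h')
    rw [xp_of_notMem h, map_zero, hF h]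

theorem homog_monoLin {V : Type*} [AddCommGroup V] [Module F2 V] {𝒱 : ℤ → Submodule F2 V}
    {F : ℤ → V} {k : ℤ} (hF : ∀ n ∈ S, F n ∈ 𝒱 (k + n)) :
    Homog (monoGr.{u} S) 𝒱 k (monoLin S F) := by
  intro n f hf
  rw [monoGr, Finsupp.supported_eq_span_single] at hf
  induction hf using Submodule.span_induction with
  | zero => rw [map_zero]; exact Submodule.zero_mem _
  | add a b _ _ ha hb => rw [map_add]; exact Submodule.add_mem _ ha hb
  | smul r a _ ha => rw [map_smul]; exact Submodule.smul_mem _ r ha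
  | mem f hf =>
    obtain ⟨s, rfl, rfl⟩ := hf
    have := hF _ s.2
    rwa [← monoLin_xp.{u} F s.2, xp_of_mem s.2] at this

theorem monoSq_xp (k : ℕ) {n : ℤ} (h : n ∈ S) :
    monoSq S k (xp.{u} S n) = ((Ring.choose n k : ℤ) : F2) • xp S (n + k) := by
  rw [xp_of_mem h]
  by_cases h' : n + k ∈ S
  · rw [xp_of_mem h']
    exact monoSq_single S k _ h'
  · rw [xp_of_notMem h', smul_zero]
    exact monoSq_single_zero S k _ h'

theorem F2_cast_even {n : ℤ} (h : n % 2 = 0) : (n : F2) = 0 :=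
  (ZMod.intCast_zmod_eq_zero_iff_dvd n 2).2 (Int.dvd_of_emod_eq_zero h)

theorem F2_cast_odd {n : ℤ} (h : n % 2 = 1) : (n : F2) = 1 := by
  have := F2_cast_even (n := n - 1) (by omega)
  rw [Int.cast_sub, Int.cast_one] at this
  exact sub_eq_zero.1 this

/-- This form is valid for negative `n` as well; it reduces the parity of the coefficient of `Sq²`
to `n` modulo `4`. -/
theorem two_mul_choose_two (n : ℤ) : 2 * Ring.choose n 2 = n * (n - 1) := by
  have succ : ∀ n : ℤ, Ring.choose (n + 1) 2 = n + Ring.choose n 2 := fun n => by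
    have := Ring.choose_succ_succ n 1
    rwa [Ring.choose_one_right] at this
  induction n using Int.induction_on with
  | zero => rw [Ring.choose_zero_pos ℤ two_pos, mul_zero, zero_mul]
  | succ n ih => rw [succ]; linarith
  | pred n ih =>
    have := succ (-n - 1)
    rw [sub_add_cancel] at this
    linarith

theorem sq1_xp_even {n : ℤ} (h : n ∈ S) (hn : n % 2 = 0) : monoSq S 1 (xp.{u} S n) = 0 := by
  rw [monoSq_xp 1 h, Ring.choose_one_right, F2_cast_even hn, zero_smul]

theorem sq1_xp_odd {n : ℤ} (h : n ∈ S) (hn : n % 2 = 1) :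
    monoSq S 1 (xp.{u} S n) = xp S (n + 1) := by
  rw [monoSq_xp 1 h, Ring.choose_one_right, F2_cast_odd hn, one_smul]
  rfl

theorem sq2_xp_low {n : ℤ} (h : n ∈ S) (hn : n % 4 = 0 ∨ n % 4 = 1) :
    monoSq S 2 (xp.{u} S n) = 0 := by
  rw [monoSq_xp 2 h, F2_cast_even, zero_smul]
  have h2 := two_mul_choose_two n
  rcases hn with hn | hn
  · obtain ⟨k, rfl⟩ : ∃ k, n = 4 * k := ⟨n / 4, by omega⟩
    have : Ring.choose (4 * k) 2 = 2 * (k * (4 * k - 1)) := by linarith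
    rw [this]; omega
  · obtain ⟨k, rfl⟩ : ∃ k, n = 4 * k + 1 := ⟨n / 4, by omega⟩
    have : Ring.choose (4 * k + 1) 2 = 2 * (k * (4 * k + 1)) := by linarith
    rw [this]; omega

theorem sq2_xp_high {n : ℤ} (h : n ∈ S) (hn : n % 4 = 2 ∨ n % 4 = 3) :
    monoSq S 2 (xp.{u} S n) = xp S (n + 2) := by
  rw [monoSq_xp 2 h, F2_cast_odd, one_smul]
  · rfl
  have h2 := two_mul_choose_two n
  rcases hn with hn | hn
  · obtain ⟨k, rfl⟩ : ∃ k, n = 4 * k + 2 := ⟨n / 4, by omega⟩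
    have : Ring.choose (4 * k + 2) 2 = 2 * (4 * (k * k) + 3 * k) + 1 := by linarith
    rw [this]; omega
  · obtain ⟨k, rfl⟩ : ∃ k, n = 4 * k + 3 := ⟨n / 4, by omega⟩
    have : Ring.choose (4 * k + 3) 2 = 2 * (4 * (k * k) + 5 * k + 1) + 1 := by linarith
    rw [this]; omega

theorem monoρ_milnor_zero : monoρ.{u} S (A1.milnor 0) = monoSq S 1 := monoρ_gen S 0

theorem monoρ_milnor_one :
    monoρ.{u} S (A1.milnor 1) = monoSq S 2 * monoSq S 1 + monoSq S 1 * monoSq S 2 := by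
  change monoρ S (A1.gen 1 * A1.gen 0 + A1.gen 0 * A1.gen 1) = _
  rw [map_add, map_mul, map_mul, monoρ_gen, monoρ_gen]
  rfl

theorem milnor_xp_even (hS : Admissible S) {n : ℤ} (h : n ∈ S) (hn : n % 2 = 0) (i : Fin 2) :
    monoρ S (A1.milnor i) (xp.{u} S n) = 0 := by
  fin_cases i
  · exact (LinearMap.congr_fun monoρ_milnor_zero _).trans (sq1_xp_even h hn)
  · refine (LinearMap.congr_fun monoρ_milnor_one _).trans ?_
    rw [LinearMap.add_apply, Module.End.mul_apply, Module.End.mul_apply, sq1_xp_even h hn,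
      map_zero, zero_add]
    rcases (by omega : n % 4 = 0 ∨ n % 4 = 2) with h4 | h4
    · rw [sq2_xp_low h (Or.inl h4), map_zero]
    · have := hS.le n h
      rw [sq2_xp_high h (Or.inl h4), sq1_xp_even (hS.mem _ (by omega) (by omega)) (by omega)]

/-- Exactly one of `Sq² Sq¹` and `Sq¹ Sq²` survives on an odd power, depending on the exponent
modulo `4`. -/
theorem milnor_xp_odd (hS : Admissible S) {n : ℤ} (h : n ∈ S) (hn : n % 2 = 1) (i : Fin 2) :
    monoρ S (A1.milnor i) (xp.{u} S n) = xp S (n + (![1, 3] : Fin 2 → ℤ) i) := by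
  have hle := hS.le n h
  fin_cases i
  · exact (LinearMap.congr_fun monoρ_milnor_zero _).trans (sq1_xp_odd h hn)
  · refine (LinearMap.congr_fun monoρ_milnor_one _).trans ?_
    rw [LinearMap.add_apply, Module.End.mul_apply, Module.End.mul_apply, sq1_xp_odd h hn]
    rcases (by omega : n % 4 = 1 ∨ n % 4 = 3) with h4 | h4
    · rw [sq2_xp_low h (Or.inr h4), map_zero, add_zero,
        sq2_xp_high (hS.mem _ (by omega) (by omega)) (by omega), add_assoc]
      rfl
    · have h1 : monoSq S 2 (xp.{u} S (n + 1)) = 0 := by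
        by_cases h' : n + 1 ∈ S
        · exact sq2_xp_low h' (by omega)
        · rw [xp_of_notMem h', map_zero]
      rw [h1, zero_add, sq2_xp_high h (Or.inr h4),
        sq1_xp_odd (hS.mem _ (by omega) (by omega)) (by omega), add_assoc]
      rfl

/-- The homology of a monomial module is spanned by at most one monomial. -/
theorem mono_cycle (hS : Admissible S) (i : Fin 2) (e : ℤ)
    (hodd : ∀ n ∈ S, n % 2 = 1 → n ≠ e → n + (![1, 3] : Fin 2 → ℤ) i ∈ S)
    (heven : ∀ n ∈ S, n % 2 = 0 → n ≠ e → n - (![1, 3] : Fin 2 → ℤ) i ∈ S)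
    {v : Expo.{u} S →₀ F2} (hv : monoρ S (A1.milnor i) v = 0) :
    (∃ u, monoρ S (A1.milnor i) u = v) ∨ ∃ u, v = xp S e + monoρ S (A1.milnor i) u := by
  set q := monoρ.{u} S (A1.milnor i)
  set j := (![1, 3] : Fin 2 → ℤ) i with hj
  have hj2 : j % 2 = 1 := by rw [hj]; fin_cases i <;> rfl
  -- `Q_i` sends odd powers to even powers `j` higher, so lowering even powers by `j` contracts the
  -- module except at the exponent `e`.
  let h := monoLin.{u} S fun n => if n % 2 = 0 then xp.{u} S (n - j) else 0
  have hh : ∀ n, n % 2 = 0 → n ∈ S → h (xp S n) = xp S (n - j) := fun n hn hnS =>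
    (monoLin_xp _ hnS).trans (if_pos hn)
  have hh' : ∀ n, n % 2 = 1 → n ∈ S → h (xp S n) = 0 := fun n hn hnS =>
    (monoLin_xp _ hnS).trans (if_neg (by omega))
  -- Modulo the line through `x^e` the homotopy formula is exact, so a cycle is a boundary up to a
  -- multiple of `x^e`.
  let Z := Submodule.span F2 {xp.{u} S e}
  have key : ((q.comp h + h.comp q + LinearMap.id : (Expo.{u} S →₀ F2) →ₗ[F2] _)) v ∈ Z := by
    rw [← Submodule.Quotient.mk_eq_zero, ← Submodule.mkQ_apply, ← LinearMap.comp_apply]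
    suffices Z.mkQ.comp (q.comp h + h.comp q + LinearMap.id) = 0 by rw [this]; rfl
    refine mono_ext fun n hn => ?_
    rw [LinearMap.comp_apply, LinearMap.zero_apply, Submodule.mkQ_apply,
      Submodule.Quotient.mk_eq_zero, LinearMap.add_apply, LinearMap.add_apply,
      LinearMap.comp_apply, LinearMap.comp_apply, LinearMap.id_apply]
    have he : n = e → xp.{u} S n ∈ Z := fun h => h ▸ Submodule.mem_span_singleton_self _
    rcases Int.emod_two_eq_zero_or_one n with h2 | h2
    · rw [hh n h2 hn, milnor_xp_even hS hn h2 i, map_zero, add_zero]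
      by_cases hm : n - j ∈ S
      · rw [milnor_xp_odd hS hm (by omega) i, ← hj, sub_add_cancel, add_self_F2]
        exact Submodule.zero_mem _
      · rw [xp_of_notMem hm, map_zero, zero_add]
        exact he (by_contra fun h => hm (heven n hn h2 h))
    · rw [hh' n h2 hn, milnor_xp_odd hS hn h2 i, map_zero, zero_add, ← hj]
      by_cases hm : n + j ∈ S
      · rw [hh _ (by omega) hm, add_sub_cancel_right, add_self_F2]
        exact Submodule.zero_mem _
      · rw [xp_of_notMem hm, map_zero, zero_add]
        exact he (by_contra fun h => hm (hodd n hn h2 h))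
  rw [LinearMap.add_apply, LinearMap.add_apply, LinearMap.comp_apply, LinearMap.comp_apply, hv,
    map_zero, add_zero, LinearMap.id_apply] at key
  obtain ⟨c, hc⟩ := Submodule.mem_span_singleton.1 key
  rcases F2_cases c with rfl | rfl
  · rw [zero_smul] at hc
    exact Or.inl ⟨h v, eq_of_add_eq_zero_F2 hc.symm⟩
  · rw [one_smul] at hc
    refine Or.inr ⟨h v, ?_⟩
    rw [hc, add_right_comm, add_self_F2, zero_add]

end Monomials

/-! ### Extending an element to a map from a monomial module -/

section Extension

variable {B : Type} [Ring B] [Bialgebra F2 B] [GrBialg B] [SubA1 B] [Kit B]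

theorem comm_of_gen {M N : GrMod.{u} B} (f : M.carrier →ₗ[F2] N.carrier)
    (h : ∀ i, f.comp (M.ρ (Kit.gen i)) = (N.ρ (Kit.gen i)).comp f) (b : B) (v : M.carrier) :
    f (M.ρ b v) = N.ρ b (f v) := by
  refine Kit.induction (p := fun b => ∀ v, f (M.ρ b v) = N.ρ b (f v)) ?_ ?_ ?_ ?_ b v
  · intro v; rw [map_one, map_one]; rfl
  · intro v; rw [map_zero, map_zero]; exact map_zero f
  · intro x y hx hy v
    rw [map_add, map_add, LinearMap.add_apply, map_add, hx, hy, LinearMap.add_apply]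
  · intro i x hx v
    rw [ρ_mul, ρ_mul, ← hx]
    exact LinearMap.congr_fun (h i) _

/-- Dependent choice with an invariant `P` and a relation `R` between consecutive terms. -/
theorem exists_seq {X : Type*} {P : ℕ → X → Prop} {R : X → X → Prop} {x : X} (h0 : P 0 x)
    (hs : ∀ k y, P k y → ∃ z, P (k + 1) z ∧ R y z) :
    ∃ g : ℕ → X, g 0 = x ∧ (∀ k, P k (g k)) ∧ ∀ k, R (g k) (g (k + 1)) := by
  have : Nonempty X := ⟨x⟩
  choose! s hs1 hs2 using hs
  let g : ℕ → X := fun k => Nat.rec x s k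
  have hg : ∀ k, P k (g k) := fun k => by
    induction k with
    | zero => exact h0
    | succ k ih => exact hs1 k _ ih
  exact ⟨g, rfl, hg, fun k => hs2 k _ (hg k)⟩

/-- An element `w` of degree `-1` or `0` such that `B` acts trivially on `Q₀ w` extends to a map
of a monomial module. -/
def Extends (B : Type) [Ring B] [Bialgebra F2 B] [GrBialg B] [SubA1 B] [Kit B] : Prop :=
  ∀ (M : GrMod.{u} B) (S : Set ℤ), Admissible S → M.Small (SubA1.Q 0) → ∀ m : ℤ, -1 ≤ m →
    ∀ w ∈ M.gr m, (∀ i, M.ρ (Kit.gen i) (M.ρ (SubA1.Q 0) w) = 0) →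
    (0 ∉ S → M.ρ (SubA1.Q 0) w = 0) → ∃ f : (restrict B (mono.{u} S)).carrier →ₗ[F2] M.carrier,
      Homog (monoGr S) M.gr (m + 1) f ∧
      (∀ b v, f ((restrict B (mono S)).ρ b v) = M.ρ b (f v)) ∧ f (xp S (-1)) = w

/-- The image `g k` of `x^(2k-1)` must satisfy `Q₀ g(k+1) = Q₁ g(k)`. The right side is a `Q₀`-cycle
of positive degree, so it bounds; the invariant `Q₁ Q₀ g(k) = 0` persists because `Q₁² = 0`. -/
theorem extends_E1 : Extends.{u} E1 := by
  intro M S hS hM m hm w hw hw0 hwS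
  obtain ⟨g, hg0, hg, hgs⟩ := exists_seq
    (P := fun k x => x ∈ M.gr (m + 2 * k) ∧ M.ρ (E1.gen 1) (M.ρ (E1.gen 0) x) = 0)
    (R := fun x y => M.ρ (E1.gen 0) y = M.ρ (E1.gen 1) x) (x := w) ⟨by simpa using hw, hw0 1⟩
    (fun k y ⟨hy, hy0⟩ => by
      obtain ⟨u, hu, huy⟩ := hM.exists_of_ne_zero (m := m + 2 * (k + 1 : ℕ)) Q0_mem
        (ρ_mem M Q1_mem hy rfl) (by omega) (by rw [ρ_Q_comm]; exact hy0) (by push_cast; ring)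
      exact ⟨u, ⟨hu, (congrArg (M.ρ (E1.gen 1)) huy).trans (ρ_Q_Q 1 y)⟩, huy⟩)
  let F : ℤ → M.carrier := fun n =>
    if n % 2 = 1 then g ((n + 1) / 2).toNat else M.ρ (E1.gen 0) (g ((n + 1) / 2).toNat)
  have F1 : ∀ k : ℕ, F (2 * k - 1) = g k := fun k => by
    simp only [F]
    rw [if_pos (by omega), show ((2 * (k : ℤ) - 1 + 1) / 2).toNat = k by omega]
  have F2 : ∀ k : ℕ, F (2 * k) = M.ρ (E1.gen 0) (g k) := fun k => by
    simp only [F]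
    rw [if_neg (by omega), show ((2 * (k : ℤ) + 1) / 2).toNat = k by omega]
  have hFS : 0 ∉ S → F 0 = 0 := fun h => by
    have := F2 0
    rw [Nat.cast_zero, mul_zero] at this
    rw [this, hg0]
    exact hwS h
  have cases : ∀ n ∈ S, ∃ k : ℕ, n = 2 * k - 1 ∨ n = 2 * k := fun n hn => by
    have := hS.le n hn
    exact ⟨((n + 1) / 2).toNat, by omega⟩
  refine ⟨monoLin S F, homog_monoLin fun n hn => ?_, comm_of_gen _ fun i => ?_, ?_⟩
  · obtain ⟨k, rfl | rfl⟩ := cases n hn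
    · rw [F1, show m + 1 + (2 * (k : ℤ) - 1) = m + 2 * k by ring]
      exact (hg k).1
    · rw [F2]
      exact ρ_mem M Q0_mem (hg k).1 (by ring)
  · refine mono_ext fun n hn => ?_
    have hle := hS.le n hn
    change monoLin S F (monoρ S (SubA1.incl (E1.gen i)) (xp S n)) =
      M.ρ (E1.gen i) (monoLin S F (xp S n))
    rw [monoLin_xp F hn, show SubA1.incl (E1.gen i) = A1.milnor i from SubA1.incl_Q (B := E1) i]
    obtain ⟨k, rfl | rfl⟩ := cases n hn
    · rw [milnor_xp_odd hS hn (by omega), F1]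
      fin_cases i
      · refine (monoLin_xp' hS hFS ?_).trans ((congrArg F ?_).trans (F2 k))
        · change -1 ≤ 2 * (k : ℤ) - 1 + 1
          omega
        · change 2 * (k : ℤ) - 1 + 1 = 2 * k
          ring
      · refine (monoLin_xp' hS hFS ?_).trans
          ((congrArg F ?_).trans ((F2 (k + 1)).trans (hgs k)))
        · change -1 ≤ 2 * (k : ℤ) - 1 + 3
          omega
        · change 2 * (k : ℤ) - 1 + 3 = 2 * ((k + 1 : ℕ) : ℤ)
          push_cast
          ring
    · rw [milnor_xp_even hS hn (by omega), map_zero, F2]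
      fin_cases i
      · exact (ρ_Q_Q 0 _).symm
      · exact (hg k).2.symm
  · exact (monoLin_xp' hS hFS le_rfl).trans ((F1 0).trans hg0)

/-- The module repeats with period `4`: `x^(4k-1)` generates the powers up to `x^(4k+2)`, and
adjacent blocks are glued by `Sq¹ g(k+1) = Sq² Sq¹ Sq² g(k)`. If `Sq² Sq¹ g(k) = 0`, the right side
is a `Q₀`-cycle of positive degree. The invariant persists since `Sq² Sq² Sq¹ = 0`. -/
theorem extends_A1 : Extends.{u} A1 := by
  intro M S hS hM m hm w hw hw0 hwS
  obtain ⟨g, hg0, hg, hgs⟩ := exists_seq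
    (P := fun k x => x ∈ M.gr (m + 4 * k) ∧ M.sq2 (M.sq1 x) = 0)
    (R := fun x y => M.sq1 y = M.sq2 (M.sq1 (M.sq2 x))) (x := w) ⟨by simpa using hw, hw0 1⟩
    (fun k y ⟨hy, hy0⟩ => by
      obtain ⟨u, hu, huy⟩ := hM.exists_of_ne_zero (m := m + 4 * (k + 1 : ℕ)) Q0_mem
        (sq2_mem (sq1_mem (sq2_mem hy rfl) rfl) rfl) (by omega)
        (by rw [ρ_Q0, ← sq2_sq2, sq2_sq2 y, hy0, map_zero, map_zero]) (by push_cast; ring)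
      rw [ρ_Q0] at huy
      exact ⟨u, ⟨hu, by rw [huy, sq2_sq2, sq1_sq1, map_zero, map_zero]⟩, huy⟩)
  -- The exponents `4k-1, 4k, 4k+1, 4k+2` carry `1, Sq¹, Sq², Sq¹ Sq²` applied to `g k`; the index
  -- `k` is the floor of `(n + 1) / 4`.
  let F : ℤ → M.carrier := fun n =>
    if n % 4 = 3 then g ((n + 1) / 4).toNat else
    if n % 4 = 0 then M.sq1 (g ((n + 1) / 4).toNat) else
    if n % 4 = 1 then M.sq2 (g ((n + 1) / 4).toNat) else M.sq1 (M.sq2 (g ((n + 1) / 4).toNat))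
  have F1 : ∀ k : ℕ, F (4 * k - 1) = g k := fun k => by
    simp only [F]
    rw [if_pos (by omega), show ((4 * (k : ℤ) - 1 + 1) / 4).toNat = k by omega]
  have F2 : ∀ k : ℕ, F (4 * k) = M.sq1 (g k) := fun k => by
    simp only [F]
    rw [if_neg (by omega), if_pos (by omega), show ((4 * (k : ℤ) + 1) / 4).toNat = k by omega]
  have F3 : ∀ k : ℕ, F (4 * k + 1) = M.sq2 (g k) := fun k => by
    simp only [F]
    rw [if_neg (by omega), if_neg (by omega), if_pos (by omega),
      show ((4 * (k : ℤ) + 1 + 1) / 4).toNat = k by omega]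
  have F4 : ∀ k : ℕ, F (4 * k + 2) = M.sq1 (M.sq2 (g k)) := fun k => by
    simp only [F]
    rw [if_neg (by omega), if_neg (by omega), if_neg (by omega),
      show ((4 * (k : ℤ) + 2 + 1) / 4).toNat = k by omega]
  have hFS : 0 ∉ S → F 0 = 0 := fun h => by
    have := F2 0
    rw [Nat.cast_zero, mul_zero] at this
    rw [this, hg0]
    exact hwS h
  have cases : ∀ n ∈ S, ∃ k : ℕ, n = 4 * k - 1 ∨ n = 4 * k ∨ n = 4 * k + 1 ∨ n = 4 * k + 2 :=
    fun n hn => by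
      have := hS.le n hn
      exact ⟨((n + 1) / 4).toNat, by omega⟩
  refine ⟨monoLin S F, homog_monoLin fun n hn => ?_, comm_of_gen _ fun i => ?_, ?_⟩
  · obtain ⟨k, rfl | rfl | rfl | rfl⟩ := cases n hn
    · rw [F1, show m + 1 + (4 * (k : ℤ) - 1) = m + 4 * k by ring]
      exact (hg k).1
    · rw [F2]
      exact sq1_mem (hg k).1 (by ring)
    · rw [F3]
      exact sq2_mem (hg k).1 (by ring)
    · rw [F4]
      exact sq1_mem (sq2_mem (hg k).1 rfl) (by ring)
  · refine mono_ext fun n hn => ?_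
    have hle := hS.le n hn
    change monoLin S F (monoρ S (A1.gen i) (xp S n)) =
      M.ρ (A1.gen i) (monoLin S F (xp S n))
    rw [monoLin_xp F hn, monoρ_gen]
    fin_cases i
    · change monoLin S F (monoSq S 1 (xp S n)) = M.sq1 (F n)
      obtain ⟨k, rfl | rfl | rfl | rfl⟩ := cases n hn
      · rw [sq1_xp_odd hn (by omega), monoLin_xp' hS hFS (by omega), sub_add_cancel, F1, F2]
      · rw [sq1_xp_even hn (by omega), map_zero, F2, sq1_sq1]
      · rw [sq1_xp_odd hn (by omega), monoLin_xp' hS hFS (by omega), F3, ← F4]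
        exact congrArg F (by ring)
      · rw [sq1_xp_even hn (by omega), map_zero, F4, sq1_sq1]
    · change monoLin S F (monoSq S 2 (xp S n)) = M.sq2 (F n)
      obtain ⟨k, rfl | rfl | rfl | rfl⟩ := cases n hn
      · rw [sq2_xp_high hn (by omega), monoLin_xp' hS hFS (by omega), F1, ← F3]
        exact congrArg F (by ring)
      · rw [sq2_xp_low hn (by omega), map_zero, F2, (hg k).2]
      · rw [sq2_xp_low hn (by omega), map_zero, F3, sq2_sq2, (hg k).2, map_zero]
      · rw [sq2_xp_high hn (by omega), monoLin_xp' hS hFS (by omega), F4, ← hgs k, ← F2]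
        exact congrArg F (by push_cast; ring)
  · exact (monoLin_xp' hS hFS le_rfl).trans ((F1 0).trans hg0)

end Extension

end GrMod

end StMod

namespace StMod

namespace GrMod

/-! ### Homology isomorphisms from a generating cycle -/

section HomologyClass

variable {B : Type} [Ring B] [Bialgebra F2 B] [GrBialg B] {M P N : GrMod.{u} B} {q : B}

/-- `x` is a cycle that generates the homology of `M`. -/
def HomologyGen (M : GrMod.{u} B) (q : B) (x : M.carrier) : Prop :=
  M.ρ q x = 0 ∧ ∀ v, M.ρ q v = 0 → (∃ u, M.ρ q u = v) ∨ ∃ u, v = x + M.ρ q u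

theorem qIso_of_acyc (hP : P.Acyc q) (hM : M.Acyc q) (f : P ⟶ M) : QIso f q where
  inj v hv _ := hP v hv
  surj w hw := by
    obtain ⟨u, hu⟩ := hM w hw
    exact ⟨0, u, map_zero _, by rw [map_zero, zero_add, hu]⟩

/-- The target has homology of dimension at most one, so a generator with nonzero image already
gives an isomorphism. -/
theorem qIso_of_homologyGen {x : P.carrier} (hP : P.HomologyGen q x) (hM : M.Small q) (f : P ⟶ M)
    (hf : ¬ ∃ u, M.ρ q u = lin f x) : QIso f q where
  inj v hv := by
    rintro ⟨w, hw⟩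
    rcases hP.2 v hv with h | ⟨u, rfl⟩
    · exact h
    · refine absurd ⟨w + lin f u, ?_⟩ hf
      rw [map_add, hw, map_add, lin_ρ, add_assoc, add_self_F2, add_zero]
  surj w hw := by
    have hx : M.ρ q (lin f x) = 0 := by rw [← lin_ρ, hP.1, map_zero]
    rcases hM.cases hx hw with h | ⟨u, hu⟩ | ⟨u, hu⟩
    · exact absurd h hf
    · exact ⟨0, u, map_zero _, by rw [map_zero, zero_add, hu]⟩
    · exact ⟨x, u, hP.1, by rw [hu, ← add_assoc, add_self_F2, zero_add]⟩

theorem HomologyGen.sum_left {x : P.carrier} (hP : P.HomologyGen q x) (hN : N.Acyc q) :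
    (P.directSum N).HomologyGen q (sp x 0) := by
  refine ⟨by rw [sp_ρ, hP.1, map_zero, sp_zero], fun v hv => ?_⟩
  obtain ⟨y, z, rfl⟩ := exists_sp v
  rw [sp_ρ, sp_zero, sp_inj] at hv
  obtain ⟨u, rfl⟩ := hN z hv.2
  rcases hP.2 y hv.1 with ⟨w, rfl⟩ | ⟨w, rfl⟩
  · exact Or.inl ⟨sp w u, sp_ρ _ _ _⟩
  · exact Or.inr ⟨sp w u, by rw [sp_ρ, sp_add, zero_add]⟩

theorem HomologyGen.sum_right {x : N.carrier} (hN : N.HomologyGen q x) (hP : P.Acyc q) :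
    (P.directSum N).HomologyGen q (sp 0 x) := by
  refine ⟨by rw [sp_ρ, hN.1, map_zero, sp_zero], fun v hv => ?_⟩
  obtain ⟨y, z, rfl⟩ := exists_sp v
  rw [sp_ρ, sp_zero, sp_inj] at hv
  obtain ⟨u, rfl⟩ := hP y hv.1
  rcases hN.2 z hv.2 with ⟨w, rfl⟩ | ⟨w, rfl⟩
  · exact Or.inl ⟨sp u w, sp_ρ _ _ _⟩
  · exact Or.inr ⟨sp u w, by rw [sp_ρ, sp_add, zero_add]⟩

theorem acyc_zero : (zero : GrMod.{u} B).Acyc q := fun _ _ => ⟨0, rfl⟩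

end HomologyClass

/-! ### Homology of `P_0` and `ΣR` -/

section Classes

variable (B : Type) [Ring B] [Bialgebra F2 B] [GrBialg B] [SubA1 B]

/-- The monomial `x^n` as an element of a monomial module. -/
noncomputable def xr (S : Set ℤ) (n : ℤ) : (restrict B (mono.{u} S)).carrier := xp S n

theorem restrict_mono_ρ_Q {S : Set ℤ} (i : Fin 2) (v : (restrict B (mono.{u} S)).carrier) :
    (restrict B (mono.{u} S)).ρ (SubA1.Q i) v = monoρ.{u} S (A1.milnor i) v :=
  congrArg (fun b => monoρ.{u} S b v) (SubA1.incl_Q (B := B) i)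

theorem restrict_mono_acyc {S : Set ℤ} (hS : Admissible S) (i : Fin 2)
    (hodd : ∀ n ∈ S, n % 2 = 1 → n + (![1, 3] : Fin 2 → ℤ) i ∈ S)
    (heven : ∀ n ∈ S, n % 2 = 0 → n - (![1, 3] : Fin 2 → ℤ) i ∈ S) :
    (restrict B (mono.{u} S)).Acyc (SubA1.Q i) := fun v hv => by
  -- The exponent `-2` lies outside `S`, so `x^(-2)` reads as `0` and no exceptional class remains.
  rcases mono_cycle hS i (-2) (fun n h h' _ => hodd n h h') (fun n h h' _ => heven n h h')
    ((restrict_mono_ρ_Q B i v).symm.trans hv) with ⟨u, hu⟩ | ⟨u, hu⟩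
  · exact ⟨u, (restrict_mono_ρ_Q B i u).trans hu⟩
  · rw [xp_of_notMem fun h => absurd (hS.le _ h) (by omega), zero_add] at hu
    exact ⟨u, (restrict_mono_ρ_Q B i u).trans hu.symm⟩

theorem restrict_mono_homologyGen {S : Set ℤ} (hS : Admissible S) (i : Fin 2) (e : ℤ)
    (he : monoρ S (A1.milnor i) (xp.{u} S e) = 0)
    (hodd : ∀ n ∈ S, n % 2 = 1 → n ≠ e → n + (![1, 3] : Fin 2 → ℤ) i ∈ S)
    (heven : ∀ n ∈ S, n % 2 = 0 → n ≠ e → n - (![1, 3] : Fin 2 → ℤ) i ∈ S) :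
    (restrict B (mono.{u} S)).HomologyGen (SubA1.Q i) (xr B S e) := by
  refine ⟨(restrict_mono_ρ_Q B i _).trans he, fun v hv => ?_⟩
  rcases mono_cycle hS i e hodd heven ((restrict_mono_ρ_Q B i v).symm.trans hv) with
    ⟨u, hu⟩ | ⟨u, hu⟩
  · exact Or.inl ⟨u, (restrict_mono_ρ_Q B i u).trans hu⟩
  · exact Or.inr ⟨u, hu.trans (congrArg (xp.{u} S e + ·) (restrict_mono_ρ_Q B i u).symm)⟩

/-- The class `x^0` of `P_0`. -/
noncomputable def P0one : (P0.{u} B).carrier := xp {n | -1 ≤ n} 0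

/-- The class `x^{-1}` of `ΣR`. -/
noncomputable def Rinv : (suspend 1 (R.{u} B)).carrier := xp {n | -1 ≤ n ∧ n ≠ 0} (-1)

/-- `Q₀` pairs each odd power with the next even one, starting with `x⁻¹ ↦ x⁰`. -/
theorem acyc_P0 : (P0.{u} B).Acyc (SubA1.Q 0) :=
  restrict_mono_acyc B admissible_P0 0
    (fun n (hn : -1 ≤ n) _ => show -1 ≤ n + 1 by omega)
    (fun n (hn : -1 ≤ n) h => show -1 ≤ n - 1 by omega)

/-- `Q₁` pairs `x^n` with `x^(n+3)` for odd `n ≥ -1`; only `x⁰` is left over. -/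
theorem homologyGen_P0 : (P0.{u} B).HomologyGen (SubA1.Q 1) (P0one B) :=
  restrict_mono_homologyGen B admissible_P0 1 0
    (milnor_xp_even admissible_P0 (show (-1 : ℤ) ≤ 0 by omega) rfl 1)
    (fun n (hn : -1 ≤ n) _ _ => show -1 ≤ n + 3 by omega)
    (fun n (hn : -1 ≤ n) _ _ => show -1 ≤ n - 3 by omega)

/-- Once `x⁰` is removed, the `Q₁`-pairing is perfect. -/
theorem acyc_R : (suspend 1 (R.{u} B)).Acyc (SubA1.Q 1) :=
  restrict_mono_acyc B admissible_R 1
    (fun n (hn : -1 ≤ n ∧ n ≠ 0) _ => show -1 ≤ n + 3 ∧ n + 3 ≠ 0 by omega)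
    (fun n (hn : -1 ≤ n ∧ n ≠ 0) _ => show -1 ≤ n - 3 ∧ n - 3 ≠ 0 by omega)

/-- Removing `x⁰` leaves `x⁻¹` without its `Q₀`-partner; the suspension moves it to degree `0`. -/
theorem homologyGen_R :
    (suspend 1 (R.{u} B)).HomologyGen (SubA1.Q 0) (Rinv B) :=
  restrict_mono_homologyGen B admissible_R 0 (-1)
    (by
      rw [milnor_xp_odd admissible_R (show (-1 : ℤ) ≤ -1 ∧ (-1 : ℤ) ≠ 0 by omega) rfl 0]
      exact xp_of_notMem fun h => h.2 rfl)
    (fun n (hn : -1 ≤ n ∧ n ≠ 0) _ _ => show -1 ≤ n + 1 ∧ n + 1 ≠ 0 by omega)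
    (fun n (hn : -1 ≤ n ∧ n ≠ 0) _ _ => show -1 ≤ n - 1 ∧ n - 1 ≠ 0 by omega)

theorem boundedBelow_restrict_mono {S : Set ℤ} (hS : Admissible S) :
    (restrict B (mono.{u} S)).BoundedBelow := by
  refine ⟨-1, fun n hn => (Submodule.eq_bot_iff _).2 fun f hf => Finsupp.ext fun s => ?_⟩
  by_contra h
  have h1 : s.1.down = n := hf (Finsupp.mem_support_iff.2 h)
  have := hS.le _ s.2
  omega

end Classes

/-! ### The classification -/

section Classification

variable {B : Type} [Ring B] [Bialgebra F2 B] [GrBialg B] [SubA1 B] [Kit B] {M : GrMod.{u} B}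

theorem counit_Q (i : Fin 2) : Coalgebra.counit (R := F2) (SubA1.Q (B := B) i) = 0 := by
  refine GrBialg.counit_eq_zero _ ?_ _ (Kit.Q_mem i)
  fin_cases i <;> simp

theorem ρ_of_gen {x : M.carrier} (h : ∀ i, M.ρ (Kit.gen i) x = 0) (b : B) :
    M.ρ b x = Coalgebra.counit (R := F2) b • x := by
  refine Kit.induction (p := fun b => M.ρ b x = Coalgebra.counit (R := F2) b • x) ?_ ?_ ?_ ?_ b
  · simp
  · simp
  · intro y z hy hz
    rw [map_add, LinearMap.add_apply, hy, hz, map_add, add_smul]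
  · intro i y hy
    rw [ρ_mul, hy, map_smul, h, Bialgebra.counit_mul, Kit.counit_gen, zero_mul, smul_zero,
      zero_smul]

/-- The map from the unit to `M` given by an element annihilated by the generators. -/
noncomputable def unitHom {x : M.carrier} (hx : x ∈ M.gr 0) (h : ∀ i, M.ρ (Kit.gen i) x = 0) :
    unit ⟶ M :=
  mkHom (unitLin x) (fun n y hy => by
    rw [zero_add]
    by_cases hn : n = 0
    · subst hn
      rcases unit_cases y with rfl | rfl
      · rw [map_zero]; exact Submodule.zero_mem _
      · rwa [unitLin_uone]
    · rw [unit_mem_gr hn hy, map_zero]; exact Submodule.zero_mem _) (fun b y => by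
    rw [unit_ρ, map_smul]
    rcases unit_cases y with rfl | rfl
    · rw [map_zero, map_zero, smul_zero]
    · rw [unitLin_uone, ρ_of_gen h])

theorem lin_unitHom {x : M.carrier} (hx : x ∈ M.gr 0) (h : ∀ i, M.ρ (Kit.gen i) x = 0) :
    lin (unitHom hx h) uone = x := unitLin_uone x

theorem homologyGen_unit (i : Fin 2) : (unit.{u} (B := B)).HomologyGen (SubA1.Q i) uone := by
  refine ⟨by rw [unit_ρ, counit_Q, zero_smul], fun v _ => ?_⟩
  rcases unit_cases v with rfl | rfl
  · exact Or.inl ⟨0, map_zero _⟩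
  · exact Or.inr ⟨0, by rw [map_zero, add_zero]⟩

theorem isStableEquiv_of_qIso_pair (hD : Detects.{u} B) {N : GrMod.{u} B} (hM : M.BoundedBelow)
    (hN : N.BoundedBelow) (f : N ⟶ M) (h0 : QIso f (SubA1.Q 0)) (h1 : QIso f (SubA1.Q 1)) :
    StablyIso M N :=
  StablyIso.symm' ⟨f, isStableEquiv_of_qIso hD hN hM f fun i => by
    fin_cases i
    exacts [h0, h1]⟩

/-- A generating `Q₀`-cycle of degree `0` is extended from `x⁻¹`. The extension raises degrees by
`1`, which the suspension absorbs. -/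
theorem exists_hom_R (hE : Extends.{u} B) (h0 : M.OneDim (SubA1.Q 0)) :
    ∃ f : suspend 1 (R B) ⟶ M, ¬ ∃ u, M.ρ (SubA1.Q 0) u = lin f (Rinv B) := by
  have h0' : M.Small (SubA1.Q 0) := Or.inr h0
  obtain ⟨z, hz, hz0, hz1, -⟩ := h0
  obtain ⟨f, hf, hfρ, hfw⟩ := hE M _ admissible_R h0' 0 (by norm_num) z hz
    (fun i => by rw [hz0, map_zero]) (fun _ => hz0)
  refine ⟨mkHom (M := suspend 1 (R B)) f (fun n v hv => ?_) hfρ, ?_⟩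
  · have := hf (n - 1) v hv
    rwa [show (0 + 1 + (n - 1) : ℤ) = 0 + n by ring] at this
  · rintro ⟨u, hu⟩
    exact hz1 ⟨u, hu.trans hfw⟩

/-- With `x = Q₀ w`, the extension sends `x⁻¹` to `w`, hence `x⁰ = Q₀ x⁻¹` to `x`. -/
theorem exists_hom_P0 (hE : Extends.{u} B) (h0 : M.Small (SubA1.Q 0)) {x : M.carrier}
    (hx : x ∈ M.gr 0) (hxg : ∀ i, M.ρ (Kit.gen i) x = 0) (hx0 : ∃ w, M.ρ (SubA1.Q 0) w = x) :
    ∃ f : P0 B ⟶ M, lin f (P0one B) = x := by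
  obtain ⟨w, hw, rfl⟩ := exists_ρ_preimage (m := -1) Q0_mem hx hx0 (by ring)
  obtain ⟨f, hf, hfρ, hfw⟩ := hE M _ admissible_P0 h0 (-1) le_rfl w hw hxg
    (fun h => absurd (show (-1 : ℤ) ≤ 0 by omega) h)
  refine ⟨mkHom (M := P0 B) f hf hfρ, ?_⟩
  rw [← hfw]
  refine Eq.trans (congrArg f ?_) (hfρ (SubA1.Q 0) (xr B _ (-1)))
  exact ((restrict_mono_ρ_Q B 0 _).trans
    (milnor_xp_odd admissible_P0 (show (-1 : ℤ) ≤ -1 by omega) rfl 0)).symm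

/-- A class in degree `0` on which `B` acts trivially, and which is no `Q₁`-boundary. -/
def HasUnitClass (B : Type) [Ring B] [Bialgebra F2 B] [GrBialg B] [SubA1 B] [Kit B] : Prop :=
  ∀ M : GrMod.{u} B, M.BoundedBelow → M.Small (SubA1.Q 0) → M.OneDim (SubA1.Q 1) →
    ∀ φ : M.tensor M ⟶ M, QIso φ (SubA1.Q 1) →
    ∃ x ∈ M.gr 0, (∀ i, M.ρ (Kit.gen i) x = 0) ∧ ¬ ∃ u, M.ρ (SubA1.Q 1) u = x

theorem hasUnitClass_E1 : HasUnitClass.{u} E1 := fun M hM h0 h1 _ _ => by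
  obtain ⟨x, hx, hx0, hx1, hxn⟩ := exists_unit_class hM h0 h1
  refine ⟨x, hx, fun i => ?_, hxn⟩
  fin_cases i
  exacts [hx0, hx1]

theorem hasUnitClass_A1 : HasUnitClass.{u} A1 := fun M hM h0 h1 φ hφ => by
  obtain ⟨x, hx, hx0, hx1, hxn⟩ := exists_unit_class_A1 hM h0 h1 hφ
  refine ⟨x, hx, fun i => ?_, hxn⟩
  fin_cases i
  exacts [hx0, hx1]

/-- The classification of the stably idempotent modules. -/
theorem classification (hD : Detects.{u} B) (hE : Extends.{u} B) (hU : HasUnitClass.{u} B)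
    (hM : M.BoundedBelow) (hfin : M.FiniteMargolis) (hid : M.StablyIdempotent) :
    StablyIso M zero ∨ StablyIso M unit ∨ StablyIso M (P0 B) ∨ StablyIso M (suspend 1 (R B)) ∨
      StablyIso M (directSum (P0 B) (suspend 1 (R B))) := by
  obtain ⟨φ, hφ⟩ := hid
  have hφ' : ∀ i, QIso φ (SubA1.Q i) := fun i =>
    qIso_of_isStableEquiv (fun P hP => acyc_of_projective hP i) hφ
  have hsmall : ∀ i, M.Small (SubA1.Q i) := fun i =>
    acyc_or_oneDim (Kit.Q_mem i) (Kit.Q_sq i) (Kit.Q_comul i) (hφ' i) hM (hfin i)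
  have bP : (P0.{u} B).BoundedBelow := boundedBelow_restrict_mono B admissible_P0
  have bR : (suspend 1 (R.{u} B)).BoundedBelow :=
    boundedBelow_suspend 1 (boundedBelow_restrict_mono B admissible_R)
  rcases hsmall 1 with h1 | h1
  · rcases hsmall 0 with h0 | h0
    · exact Or.inl (isStableEquiv_of_qIso_pair hD hM boundedBelow_zero (zeroHom zero M)
        (qIso_of_acyc acyc_zero h0 _) (qIso_of_acyc acyc_zero h1 _))
    · obtain ⟨f, hf⟩ := exists_hom_R hE h0
      exact Or.inr (Or.inr (Or.inr (Or.inl (isStableEquiv_of_qIso_pair hD hM bR f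
        (qIso_of_homologyGen (homologyGen_R B) (hsmall 0) f hf)
        (qIso_of_acyc (acyc_R B) h1 f)))))
  · obtain ⟨x, hx, hxg, hxn⟩ := hU M hM (hsmall 0) h1 φ (hφ' 1)
    -- Whether the unit class is a `Q₀`-boundary separates `F₂`, where it also generates `H(M, Q₀)`,
    -- from the cases with a summand `P_0`, whose `Q₀`-homology vanishes.
    by_cases hx0 : ∃ w, M.ρ (SubA1.Q 0) w = x
    · obtain ⟨f, hf⟩ := exists_hom_P0 hE (hsmall 0) hx hxg hx0
      rcases hsmall 0 with h0 | h0
      · exact Or.inr (Or.inr (Or.inl (isStableEquiv_of_qIso_pair hD hM bP f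
          (qIso_of_acyc (acyc_P0 B) h0 f)
          (qIso_of_homologyGen (homologyGen_P0 B) (hsmall 1) f (by rwa [hf])))))
      · obtain ⟨g, hg⟩ := exists_hom_R hE h0
        -- Each summand carries one of the two homologies and is acyclic for the other, so the sum
        -- of the two maps can be checked one differential at a time.
        exact Or.inr (Or.inr (Or.inr (Or.inr (isStableEquiv_of_qIso_pair hD hM
          (boundedBelow_directSum bP bR) (sumDesc f g)
          (qIso_of_homologyGen ((homologyGen_R B).sum_right (acyc_P0 B)) (hsmall 0) _
            (by rwa [lin_sumDesc, map_zero, zero_add]))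
          (qIso_of_homologyGen ((homologyGen_P0 B).sum_left (acyc_R B)) (hsmall 1) _
            (by rwa [lin_sumDesc, map_zero, add_zero, hf]))))))
    · exact Or.inr (Or.inl (isStableEquiv_of_qIso_pair hD hM boundedBelow_unit (unitHom hx hxg)
        (qIso_of_homologyGen (homologyGen_unit 0) (hsmall 0) _ (by rwa [lin_unitHom]))
        (qIso_of_homologyGen (homologyGen_unit 1) (hsmall 1) _ (by rwa [lin_unitHom]))))

theorem stable_cases (h : StablyIso M zero ∨ StablyIso M unit ∨ StablyIso M (P0 B) ∨
    StablyIso M (suspend 1 (R B)) ∨ StablyIso M (directSum (P0 B) (suspend 1 (R B)))) :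
    (StablyIso M zero ∧ StablyNatIso (tensorFunctor M) zeroFunctor) ∨
      (StablyIso M unit ∧ StablyNatIso (tensorFunctor M) (𝟭 (GrMod.{u} B))) ∨
      (StablyIso M (P0 B) ∧ StablyNatIso (tensorFunctor M) (L1 B)) ∨
      (StablyIso M (suspend 1 (R B)) ∧ StablyNatIso (tensorFunctor M) (L0 B)) ∨
      (StablyIso M (directSum (P0 B) (suspend 1 (R B))) ∧
        StablyNatIso (tensorFunctor M) (sumFunctor (L1 B) (L0 B))) :=
  h.imp (fun h => ⟨h, stablyNatIso_zero h⟩) <| Or.imp (fun h => ⟨h, stablyNatIso_unit h⟩) <|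
    Or.imp (fun h => ⟨h, stablyNatIso_tensor h⟩) <|
    Or.imp (fun h => ⟨h, stablyNatIso_tensor h⟩) fun h => ⟨h, stablyNatIso_sum h⟩

end Classification

end GrMod

end StMod
open StMod StMod.GrMod in
theorem mainTheorem2 :
    (∀ M : GrMod.{u} A1, M.BoundedBelow → M.FiniteMargolis → M.StablyIdempotent →
      (StablyIso M zero ∧ StablyNatIso (tensorFunctor M) zeroFunctor) ∨
      (StablyIso M unit ∧ StablyNatIso (tensorFunctor M) (𝟭 (GrMod.{u} A1))) ∨
      (StablyIso M (P0 A1) ∧ StablyNatIso (tensorFunctor M) (L1 A1)) ∨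
      (StablyIso M (suspend 1 (R A1)) ∧ StablyNatIso (tensorFunctor M) (L0 A1)) ∨
      (StablyIso M (directSum (P0 A1) (suspend 1 (R A1))) ∧
        StablyNatIso (tensorFunctor M) (sumFunctor (L1 A1) (L0 A1)))) ∧
    (∀ M : GrMod.{u} E1, M.BoundedBelow → M.FiniteMargolis → M.StablyIdempotent →
      (StablyIso M zero ∧ StablyNatIso (tensorFunctor M) zeroFunctor) ∨
      (StablyIso M unit ∧ StablyNatIso (tensorFunctor M) (𝟭 (GrMod.{u} E1))) ∨
      (StablyIso M (P0 E1) ∧ StablyNatIso (tensorFunctor M) (L1 E1)) ∨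
      (StablyIso M (suspend 1 (R E1)) ∧ StablyNatIso (tensorFunctor M) (L0 E1)) ∨
      (StablyIso M (directSum (P0 E1) (suspend 1 (R E1))) ∧
        StablyNatIso (tensorFunctor M) (sumFunctor (L1 E1) (L0 E1)))) :=
  ⟨fun _ hM hfin hid => stable_cases (classification detects_A1 extends_A1 hasUnitClass_A1 hM hfin
    hid), fun _ hM hfin hid => stable_cases (classification detects_E1 extends_E1 hasUnitClass_E1 hM
    hfin hid)⟩
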